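/- Let $C_0>0$. There is a constant $C>0$, depending only on $C_0$, with the following property. Let $n\ge 1$ and let $X_1,\dots,X_n$ be random variables on a probability space, with values in the nonnegative integers, that are 1-dependent: for all $s\ge 1$ and $t>s+1$ the $\sigma$-algebras generated by $X_1,\dots,X_s$ and by $X_t,\dots,X_n$ are independent. Put $X_k\equiv 0$ for $k\le 0$, $S_n=X_1+\cdots+X_n$, $\nu_j(k)=\mathbb E\,X_k(X_k-1)\cdots(X_k-j+1)$, and $$\lambda=\mathbb E S_n,\qquad \Gamma_2=\tfrac12(\operatorname{Var}S_n-\mathbb E S_n).$$ For random variables $Y_1,Y_2,Y_3$ put $\hat{\mathbb E}^+(Y_1,Y_2)=\mathbb E Y_1Y_2+\mathbb E Y_1\,\mathbb E Y_2$ and $\hat{\mathbb E}^+(Y_1,Y_2,Y_3)=\mathbb E Y_1Y_2Y_3+\mathbb E Y_1\,\mathbb E Y_2Y_3+\hat{\mathbb E}^+(Y_1,Y_2)\,\mathbb E Y_3$; let $\hat{\mathbb E}^+_2(X_{k-1},X_k)=\hat{\mathbb E}^+(X_{k-1}(X_{k-1}-1),X_k)+\hat{\mathbb E}^+(X_{k-1},X_k(X_k-1))$,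 and $$R_0=\sum_{k=1}^n\{\nu_2(k)+\nu_1^2(k)+\mathbb E X_{k-1}X_k\},$$ $$R_1=\sum_{k=1}^n\Big\{\nu_1^3(k)+\nu_1(k)\nu_2(k)+\nu_3(k)+[\nu_1(k-2)+\nu_1(k-1)+\nu_1(k)]\,\mathbb E X_{k-1}X_k+\hat{\mathbb E}^+_2(X_{k-1},X_k)+\hat{\mathbb E}^+(X_{k-2},X_{k-1},X_k)\Big\}.$$ Assume that $$\nu_1(k)\le \tfrac1{100},\quad \nu_2(k)\le\nu_1(k),\quad |X_k|\le C_0 \text{ a.s.}\quad(k=1,\dots,n),$$ $$\lambda\ge 1,\qquad \sum_{k=1}^n\nu_2(k)\le\frac{\lambda}{20},\qquad \sum_{k=2}^n|\operatorname{Cov}(X_{k-1},X_k)|\le\frac{\lambda}{20}.$$ For a finite signed measure $M$ on $\mathbb Z$ write $M(x)=\sum_{k\le x}M\{k\}$ and $\|M\|_W=\sum_{j\in\mathbb Z}|M(j)|\in[0,\infty]$ (if $M$ is concentrated on the nonnegative integers, this is $\sum_{j\ge0}|M(j)|$). Let $F_n$ be the distribution of $S_n$. With $z=e^{it}-1$,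 let $\Pi$, $\Pi_1$, $G$ and $TP$ be the finite signed measures on $\mathbb Z$ with Fourier–Stieltjes transforms $\sum_k e^{itk}M\{k\}$ equal to, respectively, $$e^{\lambda z},\qquad \Gamma_2z^2e^{\lambda z},\qquad e^{\lambda z+\Gamma_2z^2},\qquad \exp\{\lfloor-2\Gamma_2\rfloor it+(\lambda+2\Gamma_2+\tilde\delta)z\},$$ where $\tilde\delta=-2\Gamma_2-\lfloor-2\Gamma_2\rfloor$. Then $$\|F_n-\Pi\|_W\le C\frac{R_0}{\sqrt\lambda},\qquad \|F_n-\Pi-\Pi_1\|_W\le C\Big(\frac{R_0^2}{\lambda\sqrt\lambda}+\frac{R_1}{\lambda}\Big),$$ $$\|F_n-G\|_W\le C\frac{R_1}{\lambda},\qquad \|F_n-TP\|_W\le C\Big(\frac{R_1+|\Gamma_2|}{\lambda}+\frac{\tilde\delta}{\sqrt\lambda}\Big).$$ If $\Gamma_2>0$, and $NB$ is the negative binomial distribution $NB\{j\}=\frac{\Gamma(r+j)}{j!\,\Gamma(r)}\bar q^{\,r}(1-\bar q)^j$ $(j\ge0)$ with $\frac{r(1-\bar q)}{\bar q}=\lambda$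 and $r\big(\frac{1-\bar q}{\bar q}\big)^2=2\Gamma_2$, then $$\|F_n-NB\|_W\le C\Big(\frac{R_1}{\lambda}+\frac{\Gamma_2^2}{\lambda^2}\Big).$$ If $\Gamma_2<0$, and $BI$ is the binomial distribution with $N=\lfloor\lambda^2/(2|\Gamma_2|)\rfloor$ trials and success probability $\bar p=\lambda/N$, then $$\|F_n-BI\|_W\le C\Big(\frac{R_1}{\lambda}+\frac{\Gamma_2^2}{\lambda^2}\Big).$$ -/

import Mathlib

open MeasureTheory ProbabilityTheory

namespace OneDep

noncomputable section

/-! ### Signed measures on the integers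

A (finite, signed) measure `M` on `ℤ` is given by its point masses `k ↦ M{k}`. -/

/-- The measure on `ℤ` that is concentrated on the nonnegative integers, with masses `f`. -/
def onNat (f : ℕ → ℝ) : ℤ → ℝ := fun k => if 0 ≤ k then f k.toNat else 0

/-- The analogue of the distribution function, `M(x) = ∑_{k ≤ x} M{k}`. -/
def cumul (M : ℤ → ℝ) (x : ℤ) : ℝ := ∑' k : Set.Iic x, M k

/-- The Wasserstein norm `∑_j |M(j)|`, with values in `[0, ∞]`. The sum is over all integers;
for a measure concentrated on the nonnegative integers, `M(j) = 0` for `j < 0`. -/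
def wassersteinNorm (M : ℤ → ℝ) : ENNReal := ∑' j : ℤ, ENNReal.ofReal |cumul M j|

/-- `M` is a finite signed measure on `ℤ` with Fourier-Stieltjes transform
`φ t = ∑_k e^{itk} M{k}`. -/
def HasTransform (M : ℤ → ℝ) (φ : ℝ → ℂ) : Prop :=
  Summable (fun k : ℤ => |M k|) ∧
    ∀ t : ℝ, HasSum (fun k : ℤ => (M k : ℂ) * Complex.exp (Complex.I * t * k)) (φ t)

/-- `z(t) = e^{it} - 1`. -/
def zt (t : ℝ) : ℂ := Complex.exp (Complex.I * t) - 1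

/-! ### The approximating measures -/

/-- Poisson distribution with parameter `a`. -/
def poissonMass (a : ℝ) : ℤ → ℝ :=
  onNat fun k => Real.exp (-a) * a ^ k / (k.factorial : ℝ)

/-- The second order difference of the Poisson distribution with parameter `a`, times `g`. -/
def poissonCorrection (a g : ℝ) : ℤ → ℝ := fun k =>
  g * (poissonMass a k - 2 * poissonMass a (k - 1) + poissonMass a (k - 2))

/-- The compound Poisson (possibly signed) measure with transform `exp (a z + g z²)`. As
`a z + g z² = (g - a) + (a - 2 g) e^{it} + g e^{2it}`, its mass at `k` is
`e^{g - a} ∑_{i + 2 j = k} (a - 2 g)^i g^j / (i! j!)`. -/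
def compoundPoissonMass (a g : ℝ) : ℤ → ℝ :=
  onNat fun k => Real.exp (g - a) * ∑ j ∈ Finset.range (k / 2 + 1),
    (a - 2 * g) ^ (k - 2 * j) / ((k - 2 * j).factorial : ℝ) * (g ^ j / (j.factorial : ℝ))

/-- Translated Poisson: the law of `⌊-2g⌋ + Y`, `Y` Poisson with parameter `a + 2g + δ`,
where `δ` is the fractional part of `-2g`. -/
def translatedPoissonMass (a g : ℝ) : ℤ → ℝ := fun k =>
  poissonMass (a + 2 * g + Int.fract (-2 * g)) (k - ⌊-2 * g⌋)

/-- Negative binomial distribution with parameters `r` and `q`. -/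
def negBinomialMass (r q : ℝ) : ℤ → ℝ :=
  onNat fun j => Real.Gamma (r + j) / ((j.factorial : ℝ) * Real.Gamma r) * q ^ r * (1 - q) ^ j

/-- The parameter `r` of the negative binomial approximation. -/
def nbR (a g : ℝ) : ℝ := a ^ 2 / (2 * g)

/-- The parameter `q` of the negative binomial approximation. -/
def nbQ (a g : ℝ) : ℝ := a / (a + 2 * g)

/-- Binomial distribution with parameters `N` and `p`. -/
def binomialMass (N : ℕ) (p : ℝ) : ℤ → ℝ :=
  onNat fun k => (N.choose k : ℝ) * p ^ k * (1 - p) ^ (N - k)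

/-- The number of trials `N = ⌊a² / (2|g|)⌋` of the binomial approximation. -/
def biN (a g : ℝ) : ℕ := ⌊a ^ 2 / (2 * |g|)⌋₊

/-- The success probability `a / N` of the binomial approximation. -/
def biP (a g : ℝ) : ℝ := a / (biN a g : ℝ)

/-! ### The definitions above match the defining transforms and equations -/

theorem nb_params_iff {a g : ℝ} (ha : 0 < a) (hg : 0 < g) (r q : ℝ) :
    (r * (1 - q) / q = a ∧ r * ((1 - q) / q) ^ 2 = 2 * g) ↔ r = nbR a g ∧ q = nbQ a g := by
  have hag : 0 < a + 2 * g := by positivity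
  constructor
  · rintro ⟨h1, h2⟩
    have hq : q ≠ 0 := by
      rintro rfl
      simp at h1
      exact ha.ne h1
    have h3 : a * ((1 - q) / q) = 2 * g := by
      rw [← h2, ← h1]
      ring
    have h4 : a * (1 - q) = 2 * g * q := by
      field_simp at h3
      linarith
    have hq' : q = a / (a + 2 * g) := by
      rw [eq_div_iff hag.ne']
      linarith
    have h5 : r * (1 - q) = a * q := by
      field_simp at h1
      linarith
    refine ⟨?_, hq'⟩
    unfold nbR
    rw [eq_div_iff (by positivity)]
    have h6 : r * (2 * g * q) = a ^ 2 * q := by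
      rw [← h4]
      linear_combination a * h5
    apply mul_right_cancel₀ hq
    linarith
  · rintro ⟨rfl, rfl⟩
    unfold nbR nbQ
    constructor
    · field_simp
      ring
    · field_simp
      ring

theorem hasTransform_onNat {f : ℕ → ℝ} {φ : ℝ → ℂ} (hf : Summable fun k => |f k|)
    (h : ∀ t : ℝ, HasSum (fun k : ℕ => (f k : ℂ) * Complex.exp (Complex.I * t) ^ k) (φ t)) :
    HasTransform (onNat f) φ := by
  have hz : ∀ k : ℤ, k ∉ Set.range (Nat.cast : ℕ → ℤ) → onNat f k = 0 := by
    intro k hk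
    unfold onNat
    rw [if_neg]
    intro h0
    exact hk ⟨k.toNat, Int.toNat_of_nonneg h0⟩
  constructor
  · refine (Function.Injective.summable_iff (g := (Nat.cast : ℕ → ℤ)) Nat.cast_injective ?_).1 ?_
    · intro k hk
      simp [hz k hk]
    · refine hf.congr ?_
      intro k
      simp [onNat]
  · intro t
    refine (Function.Injective.hasSum_iff (g := (Nat.cast : ℕ → ℤ)) Nat.cast_injective ?_).1 ?_
    · intro k hk
      simp [hz k hk]
    · convert h t using 1
      funext k
      simp only [Function.comp, onNat, Int.natCast_nonneg, if_true, Int.toNat_natCast,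
        Int.cast_natCast]
      rw [← Complex.exp_nat_mul]
      congr 2
      ring

theorem HasTransform.shift {M : ℤ → ℝ} {φ : ℝ → ℂ} (h : HasTransform M φ) (m : ℤ) :
    HasTransform (fun k => M (k - m)) (fun t => Complex.exp (Complex.I * t * m) * φ t) := by
  refine ⟨(Equiv.subRight m).summable_iff.2 h.1, fun t => ?_⟩
  have := (Equiv.subRight m).hasSum_iff.2 ((h.2 t).mul_left (Complex.exp (Complex.I * t * m)))
  convert! this using 1
  funext k
  simp only [Function.comp, Equiv.subRight_apply]
  rw [mul_left_comm, ← Complex.exp_add]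
  congr 2
  push_cast
  ring

theorem hasSum_expC (x : ℂ) : HasSum (fun n : ℕ => x ^ n / (n.factorial : ℂ)) (Complex.exp x) := by
  rw [Complex.exp_eq_exp_ℂ]
  exact NormedSpace.expSeries_div_hasSum_exp x

theorem summable_abs_exp (a : ℝ) : Summable fun n : ℕ => |a ^ n / (n.factorial : ℝ)| := by
  refine (Real.summable_pow_div_factorial |a|).congr fun n => ?_
  rw [abs_div, abs_pow, Nat.abs_cast]

theorem hasTransform_poisson (a : ℝ) :
    HasTransform (poissonMass a) fun t => Complex.exp (a * zt t) := by
  refine hasTransform_onNat ?_ fun t => ?_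
  · refine ((summable_abs_exp a).mul_left (Real.exp (-a))).congr fun n => ?_
    rw [mul_div_assoc, abs_mul, abs_of_pos (Real.exp_pos _)]
  · have h := (hasSum_expC (a * Complex.exp (Complex.I * t))).mul_left (Complex.exp (-a))
    rw [← Complex.exp_add] at h
    convert! h using 1
    · funext k
      push_cast
      ring
    · unfold zt
      congr 1
      ring

theorem hasTransform_poissonCorrection (a g : ℝ) :
    HasTransform (poissonCorrection a g) fun t => Complex.exp (a * zt t) * (g * zt t ^ 2) := by
  have h0 := hasTransform_poisson a
  have h1 := h0.shift 1
  have h2 := h0.shift 2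
  refine ⟨?_, fun t => ?_⟩
  · have := (((h0.1.of_abs.sub (h1.1.of_abs.mul_left 2)).add h2.1.of_abs).mul_left g).abs
    exact this
  · have := (((h0.2 t).sub ((h1.2 t).mul_left 2)).add (h2.2 t)).mul_left (g : ℂ)
    convert! this using 1
    · funext k
      unfold poissonCorrection
      push_cast
      ring
    · have e : Complex.exp (Complex.I * t * (2 : ℤ)) = Complex.exp (Complex.I * t) ^ 2 := by
        rw [← Complex.exp_nat_mul]
        congr 1
        push_cast
        ring
      simp only [e]
      unfold zt
      push_cast
      ring_nf

theorem hasTransform_translatedPoisson (a g : ℝ) :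
    HasTransform (translatedPoissonMass a g) fun t =>
      Complex.exp (⌊-2 * g⌋ * (Complex.I * t) + (a + 2 * g + Int.fract (-2 * g) : ℝ) * zt t) := by
  have h := (hasTransform_poisson (a + 2 * g + Int.fract (-2 * g))).shift ⌊-2 * g⌋
  refine ⟨h.1, fun t => ?_⟩
  convert! h.2 t using 1
  simp only
  rw [← Complex.exp_add]
  congr 1
  ring

theorem hasTransform_binomial (N : ℕ) (p : ℝ) :
    HasTransform (binomialMass N p) fun t => (1 + p * zt t) ^ N := by
  have hz : ∀ k ∉ Finset.range (N + 1), (N.choose k : ℝ) = 0 := by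
    intro k hk
    rw [Nat.choose_eq_zero_of_lt (by simpa [Nat.lt_succ_iff] using hk), Nat.cast_zero]
  refine hasTransform_onNat ?_ fun t => ?_
  · refine summable_of_ne_finset_zero (s := Finset.range (N + 1)) fun k hk => ?_
    simp [hz k hk]
  · have e : (1 + p * zt t) ^ N = ∑ k ∈ Finset.range (N + 1),
        (((N.choose k : ℝ) * p ^ k * (1 - p) ^ (N - k) : ℝ) : ℂ)
          * Complex.exp (Complex.I * t) ^ k := by
      have : 1 + p * zt t = p * Complex.exp (Complex.I * t) + (1 - p) := by
        unfold zt
        ring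
      rw [this, add_pow]
      refine Finset.sum_congr rfl fun k _ => ?_
      push_cast
      ring
    rw [e]
    refine hasSum_sum_of_ne_finset_zero fun k hk => ?_
    simp [hz k hk]

/-- Coefficients of `w ↦ exp (g w²)`. -/
def evenCoeff (g : ℝ) (m : ℕ) : ℝ := if Even m then g ^ (m / 2) / ((m / 2).factorial : ℝ) else 0

theorem evenCoeff_eq_zero (g : ℝ) (m : ℕ) (hm : m ∉ Set.range fun j : ℕ => 2 * j) :
    evenCoeff g m = 0 := by
  unfold evenCoeff
  rw [if_neg]
  rintro ⟨r, hr⟩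
  exact hm ⟨r, by simp only; omega⟩

theorem evenCoeff_two_mul (g : ℝ) (j : ℕ) :
    evenCoeff g (2 * j) = g ^ j / (j.factorial : ℝ) := by
  simp [evenCoeff]

theorem two_mul_injective : Function.Injective fun j : ℕ => 2 * j := by
  intro i j h
  simpa using h

theorem summable_abs_evenCoeff (g : ℝ) : Summable fun m => |evenCoeff g m| := by
  refine (two_mul_injective.summable_iff ?_).1 ?_
  · intro m hm
    simp [evenCoeff_eq_zero g m hm]
  · refine (summable_abs_exp g).congr fun j => ?_
    simp only [Function.comp, evenCoeff_two_mul]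

theorem hasSum_evenCoeff (g : ℝ) (w : ℂ) :
    HasSum (fun m => (evenCoeff g m : ℂ) * w ^ m) (Complex.exp (g * w ^ 2)) := by
  refine (two_mul_injective.hasSum_iff ?_).1 ?_
  · intro m hm
    simp [evenCoeff_eq_zero g m hm]
  · convert hasSum_expC (g * w ^ 2) using 1
    funext j
    simp only [Function.comp, evenCoeff_two_mul]
    push_cast
    ring

theorem sum_range_eq_antidiagonal (a g : ℝ) (k : ℕ) :
    ∑ j ∈ Finset.range (k / 2 + 1),
      (a - 2 * g) ^ (k - 2 * j) / ((k - 2 * j).factorial : ℝ) * (g ^ j / (j.factorial : ℝ)) =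
    ∑ p ∈ Finset.HasAntidiagonal.antidiagonal k,
      (a - 2 * g) ^ p.1 / (p.1.factorial : ℝ) * evenCoeff g p.2 := by
  refine Finset.sum_of_injOn (fun j => (k - 2 * j, 2 * j)) ?_ ?_ ?_ ?_
  · intro i _ j _ h
    have := congrArg Prod.snd h
    simp only at this
    omega
  · intro j hj
    simp only [Finset.coe_range, Set.mem_Iio, Finset.mem_coe, Finset.HasAntidiagonal.mem_antidiagonal] at hj ⊢
    omega
  · rintro ⟨i, m⟩ hp hn
    rw [Finset.HasAntidiagonal.mem_antidiagonal] at hp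
    simp only at hp
    rw [evenCoeff_eq_zero, mul_zero]
    rintro ⟨j, hj⟩
    simp only at hj
    subst hj
    refine hn ⟨j, ?_, ?_⟩
    · simp only [Finset.coe_range, Set.mem_Iio]
      omega
    · simp only [Prod.mk.injEq, and_true]
      omega
  · intro j _
    simp only [evenCoeff_two_mul]

theorem hasTransform_compoundPoisson (a g : ℝ) :
    HasTransform (compoundPoissonMass a g) fun t =>
      Complex.exp (a * zt t + g * zt t ^ 2) := by
  unfold compoundPoissonMass
  simp only [sum_range_eq_antidiagonal]
  refine hasTransform_onNat ?_ fun t => ?_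
  · have h := summable_norm_sum_mul_antidiagonal_of_summable_norm
      (f := fun n : ℕ => (a - 2 * g) ^ n / (n.factorial : ℝ)) (g := evenCoeff g)
      (summable_abs_exp _) (summable_abs_evenCoeff g)
    refine (h.mul_left (Real.exp (g - a))).congr fun k => ?_
    rw [abs_mul, abs_of_pos (Real.exp_pos _), Real.norm_eq_abs]
  · set w := Complex.exp (Complex.I * t) with hw
    have hs1 := hasSum_expC (((a - 2 * g : ℝ) : ℂ) * w)
    have hs2 := hasSum_evenCoeff g w
    have hn := summable_norm_sum_mul_antidiagonal_of_summable_norm hs1.summable.norm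
      hs2.summable.norm
    have ht := tsum_mul_tsum_eq_tsum_sum_antidiagonal_of_summable_norm hs1.summable.norm
      hs2.summable.norm
    rw [hs1.tsum_eq, hs2.tsum_eq] at ht
    have h := hn.of_norm.hasSum
    rw [← ht, ← Complex.exp_add] at h
    have h' := h.mul_left (Complex.exp (g - a))
    rw [← Complex.exp_add] at h'
    convert! h' using 1
    · funext k
      push_cast
      rw [mul_assoc, Finset.sum_mul]
      congr 1
      refine Finset.sum_congr rfl fun p hp => ?_
      rw [← Finset.HasAntidiagonal.mem_antidiagonal.1 hp, mul_pow]
      ring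
    · unfold zt
      rw [← hw]
      congr 1
      push_cast
      ring

/-! ### Sums of one-dependent nonnegative integer-valued random variables

The summands are `X 1, …, X n`; by convention `X k = 0` for `k ≤ 0`. -/

variable {Ω : Type*} [MeasurableSpace Ω]

/-- `X 1, …, X n` are 1-dependent: for `1 ≤ s`, `t - s > 1`, the sigma-algebras generated by
`X 1, …, X s` and by `X t, …, X n` are independent. -/
def IsOneDependent (μ : Measure Ω) (X : ℤ → Ω → ℕ) (n : ℕ) : Prop :=
  ∀ s t : ℤ, 1 ≤ s → 1 < t - s →
    Indep (⨆ i ∈ Set.Icc 1 s, MeasurableSpace.comap (X i) ⊤)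
      (⨆ j ∈ Set.Icc t (n : ℤ), MeasurableSpace.comap (X j) ⊤) μ

/-- `S_n = X_1 + ⋯ + X_n`. -/
def partialSum (X : ℤ → Ω → ℕ) (n : ℕ) (ω : Ω) : ℕ := ∑ k ∈ Finset.Icc (1 : ℤ) n, X k ω

/-- The distribution of `S_n`, as a measure on `ℤ`. -/
def sumLaw (μ : Measure Ω) (X : ℤ → Ω → ℕ) (n : ℕ) : ℤ → ℝ :=
  onNat fun k => μ.real {ω | partialSum X n ω = k}

/-- `λ = E S_n`. -/
def lam (μ : Measure Ω) (X : ℤ → Ω → ℕ) (n : ℕ) : ℝ := ∫ ω, (partialSum X n ω : ℝ) ∂μ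

/-- `Γ₂ = (Var S_n - E S_n) / 2`. -/
def Gam2 (μ : Measure Ω) (X : ℤ → Ω → ℕ) (n : ℕ) : ℝ :=
  (variance (fun ω => (partialSum X n ω : ℝ)) μ - lam μ X n) / 2

/-- The factorial moment `ν_j(k) = E X_k (X_k - 1) ⋯ (X_k - j + 1)`. -/
def nu (μ : Measure Ω) (X : ℤ → Ω → ℕ) (j : ℕ) (k : ℤ) : ℝ :=
  ∫ ω, ((X k ω).descFactorial j : ℝ) ∂μ

/-- `Ê⁺(Y₁, Y₂) = E Y₁Y₂ + E Y₁ E Y₂`. -/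
def Ep2 (μ : Measure Ω) (Y₁ Y₂ : Ω → ℝ) : ℝ :=
  ∫ ω, Y₁ ω * Y₂ ω ∂μ + (∫ ω, Y₁ ω ∂μ) * ∫ ω, Y₂ ω ∂μ

/-- `Ê⁺(Y₁, Y₂, Y₃) = E Y₁Y₂Y₃ + Ê⁺(Y₁) E Y₂Y₃ + Ê⁺(Y₁, Y₂) E Y₃`, with `Ê⁺(Y₁) = E Y₁`. -/
def Ep3 (μ : Measure Ω) (Y₁ Y₂ Y₃ : Ω → ℝ) : ℝ :=
  ∫ ω, Y₁ ω * Y₂ ω * Y₃ ω ∂μ + (∫ ω, Y₁ ω ∂μ) * (∫ ω, Y₂ ω * Y₃ ω ∂μ) +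
    Ep2 μ Y₁ Y₂ * ∫ ω, Y₃ ω ∂μ

/-- `E X_{k-1} X_k`. -/
def mix (μ : Measure Ω) (X : ℤ → Ω → ℕ) (k : ℤ) : ℝ :=
  ∫ ω, (X (k - 1) ω : ℝ) * (X k ω : ℝ) ∂μ

/-- `R_0`. -/
def R0 (μ : Measure Ω) (X : ℤ → Ω → ℕ) (n : ℕ) : ℝ :=
  ∑ k ∈ Finset.Icc (1 : ℤ) n, (nu μ X 2 k + nu μ X 1 k ^ 2 + mix μ X k)

/-- `Ê⁺₂(X_{k-1}, X_k) = Ê⁺(X_{k-1}(X_{k-1} - 1), X_k) + Ê⁺(X_{k-1}, X_k(X_k - 1))`. -/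
def Ep22 (μ : Measure Ω) (X : ℤ → Ω → ℕ) (k : ℤ) : ℝ :=
  Ep2 μ (fun ω => (X (k - 1) ω : ℝ) * ((X (k - 1) ω : ℝ) - 1)) (fun ω => (X k ω : ℝ)) +
    Ep2 μ (fun ω => (X (k - 1) ω : ℝ)) (fun ω => (X k ω : ℝ) * ((X k ω : ℝ) - 1))

/-- `R_1`. -/
def R1 (μ : Measure Ω) (X : ℤ → Ω → ℕ) (n : ℕ) : ℝ :=
  ∑ k ∈ Finset.Icc (1 : ℤ) n,
    (nu μ X 1 k ^ 3 + nu μ X 1 k * nu μ X 2 k + nu μ X 3 k +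
      (nu μ X 1 (k - 2) + nu μ X 1 (k - 1) + nu μ X 1 k) * mix μ X k +
      Ep22 μ X k +
      Ep3 μ (fun ω => (X (k - 2) ω : ℝ)) (fun ω => (X (k - 1) ω : ℝ)) (fun ω => (X k ω : ℝ)))

end

end OneDep

open OneDep

/-! All six bounds rest on one analytic device and one expansion.

The device: if `M` has total mass zero and transform `f(s) = ∑ M{k} e^{sk}`, then on any line `Re s
= v ≠ 0` its distribution function is the inversion integral of `f(s) / (1 - e^s)`. If `|f(s)| ≤ a
|e^s - 1| e^{λv - bt²}` on the lines `v = ±h`, choosing the sign of `v` as that of `j - λ` gives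
`|M(j)| ≤ a √(π/b) e^{-h|j - λ|}`, and summation over `j` costs `O(1/h)`
(`wassersteinNorm_le_of_gen`). With `h` of order `1/√λ` and `b` of order `λ` the powers of `λ`
cancel. Pointwise estimates on two vertical lines thus suffice, and no derivative of the transform
is needed.

The expansion (Heinrich's method): put `Y_k = e^{sX_k} - 1` and `F_k = E e^{s(X_1+⋯+X_k)}`. Peeling
off one factor `1 + Y` at a time, 1-dependence gives `F_k = F_{k-1} + ∑_{m≥1} F_{k-1-m} E
Y_k⋯Y_{k-m+1}` (`integral_expPartialSum_rec`). The block means decay geometrically in `m`, so `F_k /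
F_{k-1} = 1 + δ_k` stays close to `1` and `L = ∑ log(1 + δ_k)` is a logarithm of the transform of
`S_n`. With `z = e^s - 1`, expanding `δ_k` yields `L = λz + O(R_0|z|²)` and `L = λz + Γ₂z² +
O(R_1|z|³)`, while the smallness of the moments gives `Re L ≤ λ Re z + 0.45 λ|z|²` near the
imaginary axis (`exists_log_gen`), hence Gaussian decay in `t` (`InStrip.re_exponent_le`).

The approximations have transforms `e^T` with `T` close to `λz` or to `λz + Γ₂z²`; for `Π + Π₁` the
exponential of `Γ₂z²` is linearized. As `|e^L - e^T| ≤ e^r |L - T|` when both real parts are at most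
`r`, only `L - T` has to be estimated. One factor `|z|` pays for the denominator `1 - e^s`, and each
further one is worth `1/√λ`, which produces the rates. -/

/-! ### Inversion along vertical lines and the Wasserstein norm -/

/-- `φ` is the value at `s` of the two-sided Laplace transform `∑ₖ M{k} e^{sk}`. -/
def HasGen (M : ℤ → ℝ) (s φ : ℂ) : Prop :=
  HasSum (fun k : ℤ => (M k : ℂ) * Complex.exp (s * k)) φ

theorem HasGen.summable_abs {M : ℤ → ℝ} {s φ : ℂ} (h : HasGen M s φ) :
    Summable fun k : ℤ => |M k| * Real.exp (s.re * k) := by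
  refine h.summable.norm.congr fun k => ?_
  rw [norm_mul, Complex.norm_real, Complex.norm_exp, Real.norm_eq_abs]
  simp

theorem HasGen.sub {M N : ℤ → ℝ} {s φ ψ : ℂ} (h : HasGen M s φ) (h' : HasGen N s ψ) :
    HasGen (M - N) s (φ - ψ) := by
  unfold HasGen at *
  convert! HasSum.sub h h' using 1
  funext k
  simp only [Pi.sub_apply]
  push_cast
  ring

theorem integral_exp_int_mul_I (m : ℤ) :
    ∫ t in (-Real.pi)..Real.pi, Complex.exp ((t : ℂ) * Complex.I * m) =
      if m = 0 then 2 * (Real.pi : ℂ) else 0 := by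
  split_ifs with h
  · simp [h]
    ring
  · have hc : Complex.I * m ≠ 0 := by simp [h]
    have : ∀ t : ℝ, Complex.exp ((t : ℂ) * Complex.I * m) = Complex.exp (Complex.I * m * t) := by
      intro t
      congr 1
      ring
    simp_rw [this]
    rw [integral_exp_mul_complex hc]
    have e : Complex.I * m * (Real.pi : ℂ) =
        Complex.I * m * ((-Real.pi : ℝ) : ℂ) + m * (2 * Real.pi * Complex.I) := by
      push_cast
      ring
    rw [e, Complex.exp_periodic.int_mul m, sub_self, zero_div]

section Inversion

variable {M : ℤ → ℝ} {v : ℝ} {f : ℝ → ℂ}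

theorem coeff_eq_integral (hf : ∀ t : ℝ, HasGen M (v + t * Complex.I) (f t)) (j : ℤ) :
    ∫ t in (-Real.pi)..Real.pi, f t * Complex.exp (-(v + t * Complex.I) * j) =
      2 * Real.pi * M j := by
  have hM : Summable fun k : ℤ => |M k| * Real.exp (v * k) := by
    simpa using (hf 0).summable_abs
  have key := intervalIntegral.hasSum_integral_of_dominated_convergence (a := -Real.pi)
    (b := Real.pi) (μ := volume)
    (F := fun (k : ℤ) (t : ℝ) => (M k : ℂ) * Complex.exp ((v + t * Complex.I) * k) *
      Complex.exp (-(v + t * Complex.I) * j))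
    (f := fun t => f t * Complex.exp (-(v + t * Complex.I) * j))
    (fun k _ => |M k| * Real.exp (v * k) * Real.exp (-v * j)) ?_ ?_ ?_ ?_ ?_
  · refine key.unique ?_
    have hk : ∀ k : ℤ, ∫ t in (-Real.pi)..Real.pi,
        (M k : ℂ) * Complex.exp ((v + t * Complex.I) * k) *
          Complex.exp (-(v + t * Complex.I) * j) =
        if k = j then 2 * Real.pi * (M j : ℂ) else 0 := by
      intro k
      have e : ∀ t : ℝ, (M k : ℂ) * Complex.exp ((v + t * Complex.I) * k) *
          Complex.exp (-(v + t * Complex.I) * j) =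
          (M k * Complex.exp (v * (k - j))) *
            Complex.exp ((t : ℂ) * Complex.I * ((k - j : ℤ) : ℂ)) := by
        intro t
        rw [mul_assoc, ← Complex.exp_add, mul_assoc (M k : ℂ), ← Complex.exp_add]
        congr 2
        push_cast
        ring
      simp_rw [e]
      rw [intervalIntegral.integral_const_mul, integral_exp_int_mul_I]
      by_cases h : k = j
      · subst h
        simp
        ring
      · simp [h, sub_eq_zero]
    simp_rw [hk]
    exact hasSum_ite_eq j _
  · intro k
    exact Continuous.aestronglyMeasurable (by fun_prop)
  · intro k
    refine Filter.Eventually.of_forall fun t _ => le_of_eq ?_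
    simp [Complex.norm_exp]
  · refine Filter.Eventually.of_forall fun t _ => hM.mul_right _
  · exact intervalIntegrable_const
  · exact Filter.Eventually.of_forall fun t _ => (hf t).mul_right _

theorem continuous_of_hasGen (hf : ∀ t : ℝ, HasGen M (v + t * Complex.I) (f t)) :
    Continuous f := by
  have hM : Summable fun k : ℤ => |M k| * Real.exp (v * k) := by
    simpa using (hf 0).summable_abs
  have : f = fun t : ℝ => ∑' k : ℤ, (M k : ℂ) * Complex.exp ((v + t * Complex.I) * k) := by
    funext t
    exact (hf t).tsum_eq.symm
  rw [this]
  refine continuous_tsum (fun k => by fun_prop) hM fun k t => ?_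
  simp [Complex.norm_exp]

/-- The inversion integrals for `M(j), M(j + ε), …` form a geometric series of ratio `e^{-sε}`; `vε
> 0` makes its modulus less than one. The left tail uses `ε = -1` with `v < 0`, the right tail `ε =
1` with `v > 0`. -/
theorem hasSum_coeff_geometric (hf : ∀ t : ℝ, HasGen M (v + t * Complex.I) (f t)) (j ε : ℤ)
    (hε : 0 < v * ε) :
    HasSum (fun i : ℕ => 2 * (Real.pi : ℂ) * M (j + ε * i))
      (∫ t in (-Real.pi)..Real.pi, f t * Complex.exp (-(v + t * Complex.I) * j) /
        (1 - Complex.exp (-(v + t * Complex.I) * ε))) := by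
  have hr : ∀ t : ℝ, ‖Complex.exp (-(v + t * Complex.I) * ε)‖ = Real.exp (-(v * ε)) := by
    intro t
    simp [Complex.norm_exp]
  have hlt : Real.exp (-(v * ε)) < 1 := by
    rw [Real.exp_lt_one_iff]
    linarith
  have hc := continuous_of_hasGen hf
  have hgeo := summable_geometric_of_lt_one (Real.exp_pos _).le hlt
  simp_rw [← coeff_eq_integral hf]
  refine intervalIntegral.hasSum_integral_of_dominated_convergence
    (fun i t => ‖f t * Complex.exp (-(v + t * Complex.I) * j)‖ * Real.exp (-(v * ε)) ^ i)
    ?_ ?_ ?_ ?_ ?_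
  · intro i
    exact Continuous.aestronglyMeasurable (by fun_prop)
  · intro i
    refine Filter.Eventually.of_forall fun t _ => le_of_eq ?_
    rw [← hr t, ← norm_pow, ← norm_mul, mul_assoc, ← Complex.exp_nat_mul, ← Complex.exp_add]
    congr 3
    push_cast
    ring
  · exact Filter.Eventually.of_forall fun t _ => hgeo.mul_left _
  · simp_rw [tsum_mul_left]
    exact Continuous.intervalIntegrable (by fun_prop) _ _
  · refine Filter.Eventually.of_forall fun t _ => ?_
    have := (hasSum_geometric_of_norm_lt_one (ξ := Complex.exp (-(v + t * Complex.I) * ε))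
      (by rw [hr]; exact hlt)).mul_left (f t * Complex.exp (-(v + t * Complex.I) * j))
    convert! this using 1
    funext i
    rw [mul_assoc, ← Complex.exp_nat_mul, ← Complex.exp_add]
    congr 2
    push_cast
    ring

end Inversion

/-- The integers `k ≤ j`, enumerated downwards. -/
def natEquivIic (j : ℤ) : ℕ ≃ Set.Iic j where
  toFun i := ⟨j - i, by simp⟩
  invFun k := (j - k).toNat
  left_inv i := by simp
  right_inv k := by
    have := k.2
    simp only [Set.mem_Iic] at this
    ext
    simp
    omega

/-- The integers `k > j`, enumerated upwards. -/
def natEquivIicCompl (j : ℤ) : ℕ ≃ ((Set.Iic j)ᶜ : Set ℤ) where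
  toFun i := ⟨j + 1 + i, by simp; omega⟩
  invFun k := (k - j - 1).toNat
  left_inv i := by simp; omega
  right_inv k := by
    have := k.2
    simp only [Set.mem_compl_iff, Set.mem_Iic, not_le] at this
    ext
    simp
    omega

/-- One formula serves both signs of `v` because zero total mass removes the pole of `1/(1 - e^s)`
at `s = 0`. For `v < 0` the sum over `k ≤ j` is used directly; for `v > 0` it is minus the sum over
`k > j`. -/
theorem cumul_eq_integral {M : ℤ → ℝ} {v : ℝ} {f : ℝ → ℂ} (hv : v ≠ 0)
    (hf : ∀ t : ℝ, HasGen M (v + t * Complex.I) (f t)) (h0 : HasGen M 0 0) (j : ℤ) :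
    2 * (Real.pi : ℂ) * cumul M j =
      ∫ t in (-Real.pi)..Real.pi, f t * Complex.exp (-(v + t * Complex.I) * j) /
        (1 - Complex.exp (v + t * Complex.I)) := by
  have hM0 : HasSum (fun k : ℤ => (M k : ℂ)) 0 := by simpa [HasGen] using h0
  have hMs : Summable M := Complex.summable_ofReal.1 hM0.summable
  have hMt : ∑' k, M k = 0 := by
    have := hM0.tsum_eq
    rw [← Complex.ofReal_tsum] at this
    exact_mod_cast this
  rcases lt_or_gt_of_ne hv with h | h
  · have := (hasSum_coeff_geometric hf j (-1) (by push_cast; linarith)).tsum_eq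
    rw [tsum_mul_left, ← Complex.ofReal_tsum] at this
    have e : cumul M j = ∑' i : ℕ, M (j + -1 * i) := by
      unfold cumul
      rw [← (natEquivIic j).tsum_eq]
      refine tsum_congr fun i => ?_
      simp only [natEquivIic, Equiv.coe_fn_mk]
      congr 1
      ring
    rw [e, this]
    refine intervalIntegral.integral_congr fun t _ => ?_
    simp
  · have := (hasSum_coeff_geometric hf (j + 1) 1 (by push_cast; linarith)).tsum_eq
    rw [tsum_mul_left, ← Complex.ofReal_tsum] at this
    have e : cumul M j = -∑' i : ℕ, M (j + 1 + 1 * i) := by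
      unfold cumul
      have h1 := hMs.tsum_subtype_add_tsum_subtype_compl (Set.Iic j)
      rw [hMt, ← (natEquivIicCompl j).tsum_eq] at h1
      have h2 : ∑' i : ℕ, M (natEquivIicCompl j i) = ∑' i : ℕ, M (j + 1 + 1 * i) := by
        refine tsum_congr fun i => ?_
        simp only [natEquivIicCompl, Equiv.coe_fn_mk]
        congr 1
        ring
      rw [h2] at h1
      linarith
    rw [e, Complex.ofReal_neg, mul_neg, this, ← intervalIntegral.integral_neg]
    refine intervalIntegral.integral_congr fun t _ => ?_
    have hne : ∀ s : ℂ, 0 < s.re → 1 - Complex.exp s ≠ 0 := by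
      intro s hs h0
      have : ‖Complex.exp s‖ = 1 := by
        rw [← sub_eq_zero.1 h0, norm_one]
      rw [Complex.norm_exp, Real.exp_eq_one_iff] at this
      exact hs.ne' this
    have h1 := hne (v + t * Complex.I) (by simpa using h)
    have h2 : 1 - Complex.exp (-(v + t * Complex.I)) ≠ 0 := by
      rw [Complex.exp_neg]
      intro h3
      apply h1
      have h4 := Complex.exp_ne_zero (v + t * Complex.I)
      field_simp at h3
      linear_combination -h3
    have e3 : Complex.exp (-(v + t * Complex.I) * ((j + 1 : ℤ) : ℂ)) =
        Complex.exp (-(v + t * Complex.I) * j) * Complex.exp (-(v + t * Complex.I)) := by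
      rw [← Complex.exp_add]
      congr 1
      push_cast
      ring
    have e4 : Complex.exp (v + t * Complex.I) * Complex.exp (-(v + t * Complex.I)) = 1 := by
      rw [← Complex.exp_add, add_neg_cancel, Complex.exp_zero]
    simp only [Int.cast_one, mul_one]
    rw [e3, ← neg_div, div_eq_div_iff h2 h1]
    linear_combination (f t * Complex.exp (-(v + t * Complex.I) * j)) * e4

/-! ### Exponential decay of the distribution function and its summation over the integers -/

theorem intervalIntegral_gaussian_le {b : ℝ} (hb : 0 < b) :
    ∫ t in (-Real.pi)..Real.pi, Real.exp (-b * t ^ 2) ≤ √(Real.pi / b) := by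
  rw [intervalIntegral.integral_of_le (by linarith [Real.pi_pos]), ← integral_gaussian]
  exact setIntegral_le_integral (integrable_exp_neg_mul_sq hb)
    (Filter.Eventually.of_forall fun t => (Real.exp_pos _).le)

/-- The factor `‖e^s - 1‖` of the hypothesis cancels the denominator in the inversion formula,
leaving a Gaussian integral; the gain `1/(2π)` is dropped. -/
theorem abs_cumul_le {M : ℤ → ℝ} {v a b : ℝ} {f : ℝ → ℂ} (hv : v ≠ 0) (ha : 0 ≤ a) (hb : 0 < b)
    (hf : ∀ t : ℝ, HasGen M (v + t * Complex.I) (f t)) (h0 : HasGen M 0 0)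
    (hbd : ∀ t ∈ Set.Icc (-Real.pi) Real.pi,
      ‖f t‖ ≤ a * Real.exp (-b * t ^ 2) * ‖Complex.exp (v + t * Complex.I) - 1‖) (j : ℤ) :
    |cumul M j| ≤ a * Real.exp (-v * j) * √(Real.pi / b) := by
  have h1 := cumul_eq_integral hv hf h0 j
  have h2 : ‖2 * (Real.pi : ℂ) * cumul M j‖ = 2 * Real.pi * |cumul M j| := by
    simp [abs_of_pos Real.pi_pos]
  have hle : -Real.pi ≤ Real.pi := by linarith [Real.pi_pos]
  have h3 : ‖∫ t in (-Real.pi)..Real.pi, f t * Complex.exp (-(v + t * Complex.I) * j) /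
        (1 - Complex.exp (v + t * Complex.I))‖ ≤
      ∫ t in (-Real.pi)..Real.pi, a * Real.exp (-v * j) * Real.exp (-b * t ^ 2) := by
    refine intervalIntegral.norm_integral_le_of_norm_le hle ?_ ?_
    · refine Filter.Eventually.of_forall fun t ht => ?_
      have hz : 0 < ‖1 - Complex.exp (v + t * Complex.I)‖ := by
        rw [norm_pos_iff]
        intro h
        have : ‖Complex.exp (v + t * Complex.I)‖ = 1 := by
          rw [← sub_eq_zero.1 h, norm_one]
        rw [Complex.norm_exp, Real.exp_eq_one_iff] at this
        simp at this
        exact hv this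
      rw [norm_div, norm_mul, div_le_iff₀ hz, norm_sub_rev 1]
      have hn : ‖Complex.exp (-(v + t * Complex.I) * j)‖ = Real.exp (-v * j) := by
        simp [Complex.norm_exp]
      rw [hn]
      have := mul_le_mul_of_nonneg_right (hbd t (Set.Ioc_subset_Icc_self ht))
        (Real.exp_pos (-v * j)).le
      linarith
    · exact Continuous.intervalIntegrable (by fun_prop) _ _
  rw [← h1, h2, intervalIntegral.integral_const_mul] at h3
  have h4 := intervalIntegral_gaussian_le hb
  have h5 : 0 ≤ a * Real.exp (-v * j) := by positivity
  have h6 := mul_le_mul_of_nonneg_left h4 h5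
  have h7 := abs_nonneg (cumul M j)
  have h8 := Real.pi_gt_three
  nlinarith

/-- After a shift by `⌊x⌋`, `|j - x|` is at least `|i| - 1`, at the cost of `e^h ≤ 3`. Two geometric
series remain, each at most `2/h`. -/
theorem tsum_int_exp_neg_abs_le {h : ℝ} (h0 : 0 < h) (h1 : h ≤ 1) (x : ℝ) :
    ∑' j : ℤ, ENNReal.ofReal (Real.exp (-h * |j - x|)) ≤ ENNReal.ofReal (24 / h) := by
  have hgeo : HasSum (fun i : ℕ => Real.exp (-h) ^ i) (1 - Real.exp (-h))⁻¹ :=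
    hasSum_geometric_of_lt_one (Real.exp_pos _).le (by rw [Real.exp_lt_one_iff]; linarith)
  have hi : (1 - Real.exp (-h))⁻¹ ≤ 2 / h := by
    have h2 : Real.exp (-h) ≤ 1 - h / 2 := by
      have := Real.add_one_le_exp h
      rw [Real.exp_neg, inv_le_iff_one_le_mul₀ (Real.exp_pos h)]
      nlinarith
    rw [inv_le_comm₀ (by linarith) (by positivity), inv_div]
    linarith
  have hnat : ∑' i : ℕ, ENNReal.ofReal (Real.exp (-h) ^ i) ≤ ENNReal.ofReal (2 / h) := by
    rw [← ENNReal.ofReal_tsum_of_nonneg (fun i => by positivity) hgeo.summable, hgeo.tsum_eq]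
    exact ENNReal.ofReal_le_ofReal hi
  have hshift : ∑' j : ℤ, ENNReal.ofReal (Real.exp (-h * |j - x|)) =
      ∑' i : ℤ, ENNReal.ofReal (Real.exp (-h * |(i + ⌊x⌋ : ℤ) - x|)) :=
    ((Equiv.addRight ⌊x⌋).tsum_eq
      (fun j : ℤ => ENNReal.ofReal (Real.exp (-h * |j - x|)))).symm
  have hpt : ∀ i : ℤ, ENNReal.ofReal (Real.exp (-h * |(i + ⌊x⌋ : ℤ) - x|)) ≤
      ENNReal.ofReal 3 * ENNReal.ofReal (Real.exp (-h) ^ i.natAbs) := by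
    intro i
    rw [← ENNReal.ofReal_mul (by norm_num)]
    refine ENNReal.ofReal_le_ofReal ?_
    have ha : |(i : ℝ)| - 1 ≤ |((i + ⌊x⌋ : ℤ) : ℝ) - x| := by
      have e : (i : ℝ) = (((i + ⌊x⌋ : ℤ) : ℝ) - x) + Int.fract x := by
        rw [Int.fract]
        push_cast
        ring
      have := abs_add_le (((i + ⌊x⌋ : ℤ) : ℝ) - x) (Int.fract x)
      rw [← e, abs_of_nonneg (Int.fract_nonneg x)] at this
      linarith [Int.fract_lt_one x]
    have e2 : Real.exp (-h) ^ i.natAbs = Real.exp (-h * |(i : ℝ)|) := by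
      rw [← Real.exp_nat_mul]
      congr 1
      rw [Nat.cast_natAbs]
      push_cast
      ring
    rw [e2]
    calc Real.exp (-h * |((i + ⌊x⌋ : ℤ) : ℝ) - x|) ≤ Real.exp (h + -h * |(i : ℝ)|) := by
          rw [Real.exp_le_exp]
          nlinarith
      _ = Real.exp h * Real.exp (-h * |(i : ℝ)|) := Real.exp_add _ _
      _ ≤ 3 * Real.exp (-h * |(i : ℝ)|) := by
          gcongr
          calc Real.exp h ≤ Real.exp 1 := Real.exp_le_exp.2 h1
            _ ≤ 3 := by linarith [Real.exp_one_lt_d9]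
  rw [hshift]
  refine (ENNReal.tsum_le_tsum hpt).trans ?_
  rw [ENNReal.tsum_mul_left]
  have hint : ∑' i : ℤ, ENNReal.ofReal (Real.exp (-h) ^ i.natAbs) ≤
      ENNReal.ofReal (2 / h) + ENNReal.ofReal (2 / h) := by
    rw [tsum_of_nat_of_neg_add_one (f := fun i : ℤ => ENNReal.ofReal (Real.exp (-h) ^ i.natAbs))
      ENNReal.summable ENNReal.summable]
    refine add_le_add (by simpa using hnat) (le_trans ?_ hnat)
    refine ENNReal.tsum_le_tsum fun i => ENNReal.ofReal_le_ofReal ?_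
    have : (-((i : ℤ) + 1)).natAbs = i + 1 := by omega
    rw [this]
    exact pow_le_pow_of_le_one (Real.exp_pos _).le (by rw [Real.exp_le_one_iff]; linarith)
      (Nat.le_succ i)
  refine (mul_le_mul_right hint _).trans ?_
  rw [← ENNReal.ofReal_add (by positivity) (by positivity), ← ENNReal.ofReal_mul (by norm_num)]
  refine ENNReal.ofReal_le_ofReal ?_
  have : 0 < 1 / h := by positivity
  have e : (3 : ℝ) * (2 / h + 2 / h) = 12 * (1 / h) := by ring
  have e' : 24 / h = 24 * (1 / h) := by ring
  rw [e, e']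
  linarith

/-- Both lines are needed: `v = ±h` takes the sign of `j - l`, which turns `e^{lv - vj}` into
`e^{-h|j - l|}`. -/
theorem wassersteinNorm_le_of_gen {M : ℤ → ℝ} {h l a b : ℝ} (hh : 0 < h) (hh1 : h ≤ 1)
    (ha : 0 ≤ a) (hb : 0 < b) (h0 : HasGen M 0 0) (φ : ℂ → ℂ)
    (hφ : ∀ v : ℝ, |v| = h → ∀ t : ℝ, HasGen M (v + t * Complex.I) (φ (v + t * Complex.I)))
    (hbd : ∀ v : ℝ, |v| = h → ∀ t ∈ Set.Icc (-Real.pi) Real.pi,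
      ‖φ (v + t * Complex.I)‖ ≤ a * Real.exp (l * v) * Real.exp (-b * t ^ 2) *
        ‖Complex.exp (v + t * Complex.I) - 1‖) :
    wassersteinNorm M ≤ ENNReal.ofReal (a * √(Real.pi / b) * (24 / h)) := by
  have hpt : ∀ j : ℤ, |cumul M j| ≤ a * √(Real.pi / b) * Real.exp (-h * |j - l|) := by
    intro j
    have key : ∀ v : ℝ, |v| = h → v * (j - l) = h * |j - l| →
        |cumul M j| ≤ a * √(Real.pi / b) * Real.exp (-h * |j - l|) := by
      intro v hv hvj
      have hv0 : v ≠ 0 := by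
        rintro rfl
        simp at hv
        exact hh.ne hv
      have := abs_cumul_le hv0 (a := a * Real.exp (l * v)) (by positivity) hb (hφ v hv) h0
        (hbd v hv) j
      refine this.trans (le_of_eq ?_)
      have e : Real.exp (-h * |j - l|) = Real.exp (l * v) * Real.exp (-v * j) := by
        rw [← Real.exp_add]
        congr 1
        linarith
      rw [e]
      ring
    rcases le_total 0 ((j : ℝ) - l) with hj | hj
    · exact key h (abs_of_pos hh) (by rw [abs_of_nonneg hj])
    · exact key (-h) (by rw [abs_neg, abs_of_pos hh]) (by rw [abs_of_nonpos hj]; ring)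
  unfold wassersteinNorm
  calc ∑' j : ℤ, ENNReal.ofReal |cumul M j|
      ≤ ∑' j : ℤ, ENNReal.ofReal (a * √(Real.pi / b)) *
          ENNReal.ofReal (Real.exp (-h * |j - l|)) := by
        refine ENNReal.tsum_le_tsum fun j => ?_
        rw [← ENNReal.ofReal_mul (by positivity)]
        exact ENNReal.ofReal_le_ofReal (hpt j)
    _ ≤ ENNReal.ofReal (a * √(Real.pi / b)) * ENNReal.ofReal (24 / h) := by
        rw [ENNReal.tsum_mul_left]
        gcongr
        exact tsum_int_exp_neg_abs_le hh hh1 l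
    _ = _ := by rw [← ENNReal.ofReal_mul (by positivity)]

/-! ### Transforms of the approximating measures at complex arguments -/

theorem hasGen_onNat {f : ℕ → ℝ} {s φ : ℂ}
    (h : HasSum (fun k : ℕ => (f k : ℂ) * Complex.exp s ^ k) φ) : HasGen (onNat f) s φ := by
  refine (Function.Injective.hasSum_iff (g := (Nat.cast : ℕ → ℤ)) Nat.cast_injective ?_).1 ?_
  · intro k hk
    have : ¬ 0 ≤ k := fun h0 => hk ⟨k.toNat, Int.toNat_of_nonneg h0⟩
    simp [onNat, this]
  · convert! h using 1
    funext k
    simp only [Function.comp, onNat, Int.natCast_nonneg, if_true, Int.toNat_natCast,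
      Int.cast_natCast]
    rw [← Complex.exp_nat_mul, mul_comm s]

theorem HasGen.shift {M : ℤ → ℝ} {s φ : ℂ} (h : HasGen M s φ) (m : ℤ) :
    HasGen (fun k => M (k - m)) s (Complex.exp (s * m) * φ) := by
  have := (Equiv.subRight m).hasSum_iff.2 (HasSum.mul_left (Complex.exp (s * m)) h)
  unfold HasGen
  convert! this using 1
  funext k
  simp only [Function.comp, Equiv.subRight_apply]
  rw [mul_left_comm, ← Complex.exp_add]
  congr 2
  push_cast
  ring

theorem hasGen_poisson (a : ℝ) (s : ℂ) :
    HasGen (poissonMass a) s (Complex.exp (a * (Complex.exp s - 1))) := by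
  refine hasGen_onNat ?_
  have h := (hasSum_expC (a * Complex.exp s)).mul_left (Complex.exp (-a))
  rw [← Complex.exp_add] at h
  convert! h using 1
  · funext k
    push_cast
    ring
  · congr 1
    ring

theorem hasGen_poissonCorrection (a g : ℝ) (s : ℂ) :
    HasGen (poissonCorrection a g) s
      (Complex.exp (a * (Complex.exp s - 1)) * (g * (Complex.exp s - 1) ^ 2)) := by
  have h0 := hasGen_poisson a s
  have h1 := h0.shift 1
  have h2 := h0.shift 2
  have := HasSum.mul_left (g : ℂ) (HasSum.add (HasSum.sub h0 (HasSum.mul_left 2 h1)) h2)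
  unfold HasGen
  convert! this using 1
  · funext k
    unfold poissonCorrection
    push_cast
    ring
  · have e : Complex.exp (s * (2 : ℤ)) = Complex.exp s ^ 2 := by
      rw [← Complex.exp_nat_mul]
      congr 1
      push_cast
      ring
    rw [e]
    push_cast
    ring_nf

theorem hasGen_translatedPoisson (a g : ℝ) (s : ℂ) :
    HasGen (translatedPoissonMass a g) s
      (Complex.exp (⌊-2 * g⌋ * s + (a - ⌊-2 * g⌋ : ℝ) * (Complex.exp s - 1))) := by
  have h := (hasGen_poisson (a + 2 * g + Int.fract (-2 * g)) s).shift ⌊-2 * g⌋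
  unfold translatedPoissonMass
  convert! h using 1
  rw [← Complex.exp_add, mul_comm s]
  congr 4
  rw [Int.fract]
  ring

theorem hasGen_compoundPoisson (a g : ℝ) (s : ℂ) :
    HasGen (compoundPoissonMass a g) s
      (Complex.exp (a * (Complex.exp s - 1) + g * (Complex.exp s - 1) ^ 2)) := by
  unfold compoundPoissonMass
  simp only [sum_range_eq_antidiagonal]
  refine hasGen_onNat ?_
  have hs1 := hasSum_expC (((a - 2 * g : ℝ) : ℂ) * Complex.exp s)
  have hs2 := hasSum_evenCoeff g (Complex.exp s)
  have hn := summable_norm_sum_mul_antidiagonal_of_summable_norm hs1.summable.norm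
    hs2.summable.norm
  have ht := tsum_mul_tsum_eq_tsum_sum_antidiagonal_of_summable_norm hs1.summable.norm
    hs2.summable.norm
  rw [hs1.tsum_eq, hs2.tsum_eq] at ht
  have h := hn.of_norm.hasSum
  rw [← ht, ← Complex.exp_add] at h
  have h' := h.mul_left (Complex.exp (g - a))
  rw [← Complex.exp_add] at h'
  convert! h' using 1
  · funext k
    push_cast
    rw [mul_assoc, Finset.sum_mul]
    congr 1
    refine Finset.sum_congr rfl fun p hp => ?_
    rw [← Finset.HasAntidiagonal.mem_antidiagonal.1 hp, mul_pow]
    ring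
  · congr 1
    push_cast
    ring

theorem hasGen_binomial (N : ℕ) (p : ℝ) (s : ℂ) :
    HasGen (binomialMass N p) s ((1 + p * (Complex.exp s - 1)) ^ N) := by
  refine hasGen_onNat ?_
  have e : (1 + p * (Complex.exp s - 1)) ^ N = ∑ k ∈ Finset.range (N + 1),
      (((N.choose k : ℝ) * p ^ k * (1 - p) ^ (N - k) : ℝ) : ℂ) * Complex.exp s ^ k := by
    have : 1 + p * (Complex.exp s - 1) = p * Complex.exp s + (1 - p) := by ring
    rw [this, add_pow]
    refine Finset.sum_congr rfl fun k _ => ?_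
    push_cast
    ring
  rw [e]
  refine hasSum_sum_of_ne_finset_zero fun k hk => ?_
  rw [Nat.choose_eq_zero_of_lt (by simpa [Nat.lt_succ_iff] using hk)]
  simp

/-- Both sides are the rising factorial `r(r+1)⋯(r+j-1)` divided by `j!`. -/
theorem ringChoose_eq_Gamma {r : ℝ} (hr : 0 < r) (j : ℕ) :
    Ring.choose ((r : ℂ) + j - 1) j =
      ((Real.Gamma (r + j) / ((j.factorial : ℝ) * Real.Gamma r) : ℝ) : ℂ) := by
  have h1 : Ring.choose ((r : ℂ) + j - 1) j = Ring.multichoose (r : ℂ) j := by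
    rw [Ring.choose]
    congr 1
    ring
  have h2 := Ring.factorial_nsmul_multichoose_eq_ascPochhammer (r : ℂ) j
  rw [Polynomial.ascPochhammer_smeval_eq_eval, nsmul_eq_mul,
    ← Complex.Gamma_add_nat_div_Gamma_eq (r : ℂ)] at h2
  · have hj : (j.factorial : ℂ) ≠ 0 := by exact_mod_cast j.factorial_ne_zero
    have hg' : Complex.Gamma (r + j) = (Real.Gamma (r + j) : ℂ) := by
      rw [← Complex.Gamma_ofReal]
      push_cast
      rfl
    rw [Complex.Gamma_ofReal, hg'] at h2
    have hG : (Real.Gamma r : ℂ) ≠ 0 := by exact_mod_cast (Real.Gamma_pos_of_pos hr).ne'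
    rw [h1]
    push_cast
    field_simp at h2 ⊢
    linear_combination h2
  · intro k hk
    have h3 : r = -(k : ℝ) := by exact_mod_cast hk
    have : (0 : ℝ) ≤ k := k.cast_nonneg
    linarith

/-- Binomial series of `(1 - w)^{-r}` at `w = (1-q)e^s`. Since `1 - w = q(1 - ((1-q)/q)(e^s - 1))`
and `q > 0`, the logarithm splits and the power `q^r` cancels. -/
theorem hasGen_negBinomial {r q : ℝ} (hr : 0 < r) (hq : 0 < q) (hq1 : q < 1) {s : ℂ}
    (hs : (1 - q) * ‖Complex.exp s‖ < 1) :
    HasGen (negBinomialMass r q) s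
      (Complex.exp (-(r * Complex.log (1 - ((1 - q) / q : ℝ) * (Complex.exp s - 1))))) := by
  have hball : ((1 - q : ℝ) : ℂ) * Complex.exp s ∈ Metric.eball (0 : ℂ) 1 := by
    rw [Metric.mem_eball, edist_zero_right, ← ofReal_norm, ENNReal.ofReal_lt_one,
      norm_mul, Complex.norm_real, Real.norm_of_nonneg (by linarith)]
    exact hs
  have h := (Complex.one_div_one_sub_cpow_hasFPowerSeriesOnBall_zero (r : ℂ)).hasSum hball
  have hne : 1 - ((1 - q) / q : ℝ) * (Complex.exp s - 1) ≠ 0 := by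
    intro h0
    have hq' : (q : ℂ) ≠ 0 := by exact_mod_cast hq.ne'
    have h1 : ((1 - q : ℝ) : ℂ) * Complex.exp s = 1 := by
      push_cast at h0 ⊢
      field_simp at h0
      linear_combination -h0
    have h2 := congrArg norm h1
    rw [norm_mul, Complex.norm_real, Real.norm_of_nonneg (by linarith), norm_one] at h2
    exact hs.ne h2
  have e : 1 - ((1 - q : ℝ) : ℂ) * Complex.exp s =
      (q : ℂ) * (1 - ((1 - q) / q : ℝ) * (Complex.exp s - 1)) := by
    have hq' : (q : ℂ) ≠ 0 := by exact_mod_cast hq.ne'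
    push_cast
    field_simp
    ring
  refine hasGen_onNat ?_
  have h' := h.mul_left ((q ^ r : ℝ) : ℂ)
  convert! h' using 1
  · funext k
    rw [FormalMultilinearSeries.ofScalars_apply_eq, ringChoose_eq_Gamma hr, smul_eq_mul, mul_pow]
    push_cast
    ring
  · rw [zero_add, e, Complex.cpow_def_of_ne_zero (mul_ne_zero (by exact_mod_cast hq.ne') hne),
      Complex.log_ofReal_mul hq hne, one_div, ← Complex.exp_neg, Real.rpow_def_of_pos hq,
      Complex.ofReal_exp, ← Complex.exp_add]
    congr 1
    push_cast
    ring

/-! ### Logarithms of the solutions of a perturbed recurrence -/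

theorem prod_Icc_one_int {M : Type*} [CommMonoid M] (f : ℤ → M) (n : ℕ) :
    ∏ k ∈ Finset.Icc (1 : ℤ) n, f k = ∏ i ∈ Finset.range n, f (i + 1) := by
  symm
  refine Finset.prod_bij (fun i _ => (i : ℤ) + 1) ?_ ?_ ?_ ?_
  · intro i hi
    simp only [Finset.mem_range, Finset.mem_Icc] at hi ⊢
    omega
  · intro i _ j _ h
    simpa using h
  · intro k hk
    simp only [Finset.mem_Icc] at hk
    exact ⟨(k - 1).toNat, by simp only [Finset.mem_range]; omega, by omega⟩
  · intro i _
    rfl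

theorem sum_Icc_one_int {M : Type*} [AddCommMonoid M] (f : ℤ → M) (n : ℕ) :
    ∑ k ∈ Finset.Icc (1 : ℤ) n, f k = ∑ i ∈ Finset.range n, f (i + 1) :=
  prod_Icc_one_int (M := Multiplicative M) f n

/-- Two steps multiply the weight by `100/81`, and `(100/81)·0.0405 = 0.05`. The sum is therefore at
most its first two terms plus a twentieth of itself, whence `1/(1 - 0.05) = 20/19`. -/
theorem sum_geometric_two_step_le {x : ℕ → ℝ} (hx : ∀ i, 0 ≤ x i)
    (h2 : ∀ i, x (i + 2) ≤ 0.0405 * x i) (L : ℕ) :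
    ∑ i ∈ Finset.range L, (10 / 9 : ℝ) ^ i * x i ≤ 20 / 19 * (x 0 + 10 / 9 * x 1) := by
  have hnn : ∀ i, 0 ≤ (10 / 9 : ℝ) ^ i * x i := fun i => mul_nonneg (by positivity) (hx i)
  have h1 : ∑ i ∈ Finset.range (L + 2), (10 / 9 : ℝ) ^ i * x i =
      ∑ i ∈ Finset.range L, (10 / 9 : ℝ) ^ (i + 2) * x (i + 2) + 10 / 9 * x 1 + x 0 := by
    rw [Finset.sum_range_succ', Finset.sum_range_succ']
    norm_num
  have h3 : ∑ i ∈ Finset.range L, (10 / 9 : ℝ) ^ (i + 2) * x (i + 2) ≤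
      0.05 * ∑ i ∈ Finset.range L, (10 / 9 : ℝ) ^ i * x i := by
    rw [Finset.mul_sum]
    refine Finset.sum_le_sum fun i _ => ?_
    have := mul_le_mul_of_nonneg_left (h2 i) (by positivity : (0 : ℝ) ≤ (10 / 9) ^ (i + 2))
    refine this.trans (le_of_eq ?_)
    rw [pow_add]
    ring
  have h4 : ∑ i ∈ Finset.range L, (10 / 9 : ℝ) ^ i * x i ≤
      ∑ i ∈ Finset.range (L + 2), (10 / 9 : ℝ) ^ i * x i :=
    Finset.sum_le_sum_of_subset_of_nonneg (Finset.range_mono (by omega)) fun i _ _ => hnn i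
  linarith

/-- `F` solves `F k = F (k-1) + ∑_{m ≥ 1} F (k-1-m) q(k,m)` with `F = 1` on the nonpositive
integers, where `q(k, m)` has the majorant `Q(k, m)`, which decays in `m` and is controlled
for `m ≤ 4` by the quantities `a`, `b`, `c` and the small parameter `ζ`. -/
structure PerturbedRecurrence (n : ℕ) (F : ℤ → ℂ) (q : ℤ → ℕ → ℂ) (Q : ℤ → ℕ → ℝ)
    (a b c : ℤ → ℝ) (ζ : ℝ) : Prop where
  init : ∀ k ≤ 0, F k = 1
  rec_eq : ∀ k ≤ (n : ℤ), ∀ L : ℕ, n ≤ L →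
    F k = F (k - 1) + ∑ i ∈ Finset.range L, F (k - 2 - i) * q k (i + 1)
  norm_le : ∀ k ≤ (n : ℤ), ∀ i, ‖q k i‖ ≤ Q k i
  step : ∀ k ≤ (n : ℤ), ∀ i, 1 ≤ i → Q k (i + 2) ≤ 0.0405 * Q k i
  le_one : ∀ k ≤ (n : ℤ), Q k 1 ≤ ζ * a k
  -- Lengths two and three are bounded twice: by a moment when the block leads a tail, and by `2.01`
  -- times the bound for the preceding length when it comes second.
  le_two : ∀ k ≤ (n : ℤ), Q k 2 ≤ 2.01 * (ζ * a k)
  le_two' : ∀ k ≤ (n : ℤ), Q k 2 ≤ ζ ^ 2 * b k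
  le_three : ∀ k ≤ (n : ℤ), Q k 3 ≤ 2.01 * (ζ ^ 2 * b k)
  le_three' : ∀ k ≤ (n : ℤ), Q k 3 ≤ ζ ^ 3 * c k
  le_four : ∀ k ≤ (n : ℤ), Q k 4 ≤ 2.01 * (ζ ^ 3 * c k)
  a_nonneg : ∀ k ≤ (n : ℤ), 0 ≤ a k
  a_le : ∀ k ≤ (n : ℤ), a k ≤ 1 / 100
  b_nonneg : ∀ k ≤ (n : ℤ), 0 ≤ b k
  c_nonneg : ∀ k ≤ (n : ℤ), 0 ≤ c k
  zeta_nonneg : 0 ≤ ζ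
  zeta_le : ζ ≤ 2.01

namespace PerturbedRecurrence

variable {n : ℕ} {F : ℤ → ℂ} {q : ℤ → ℕ → ℂ} {Q : ℤ → ℕ → ℝ} {a b c : ℤ → ℝ} {ζ : ℝ}

theorem Q_nonneg (h : PerturbedRecurrence n F q Q a b c ζ) {k : ℤ} (hk : k ≤ n) (i : ℕ) :
    0 ≤ Q k i := (norm_nonneg _).trans (h.norm_le k hk i)

/-- Each step backwards enlarges `‖F‖` by at most `10/9`, and the two-step decay of `Q` beats this
growth. Omitting the first `p` blocks leaves a tail governed by the lengths `p + 1` and `p + 2`; it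
is used for `p = 0, 1, 2`. -/
theorem norm_sum_le (h : PerturbedRecurrence n F q Q a b c ζ) {k : ℤ} (hk : k ≤ n)
    (hF : ∀ j < k, ‖F (j - 1)‖ ≤ 10 / 9 * ‖F j‖) (p L : ℕ) :
    ‖∑ i ∈ Finset.range L, F (k - 2 - (i + p : ℕ)) * q k (i + p + 1)‖ ≤
      ‖F (k - 1)‖ * ((10 / 9) ^ (p + 1) * (20 / 19 * (Q k (p + 1) + 10 / 9 * Q k (p + 2)))) := by
  have hpow : ∀ m : ℕ, ‖F (k - 1 - m)‖ ≤ (10 / 9) ^ m * ‖F (k - 1)‖ := by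
    intro m
    induction m with
    | zero => simp
    | succ m ih =>
      have h1 := hF (k - 1 - m) (by omega)
      have e : k - 1 - ((m + 1 : ℕ) : ℤ) = k - 1 - m - 1 := by push_cast; ring
      rw [e, pow_succ]
      linarith
  have hterm : ∀ i : ℕ, ‖F (k - 2 - (i + p : ℕ)) * q k (i + p + 1)‖ ≤
      ‖F (k - 1)‖ * (10 / 9) ^ (p + 1) * ((10 / 9) ^ i * Q k (i + (p + 1))) := by
    intro i
    rw [norm_mul]
    have e : k - 2 - ((i + p : ℕ) : ℤ) = k - 1 - ((p + 1 + i : ℕ) : ℤ) := by push_cast; ring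
    rw [e]
    calc _ ≤ ((10 / 9) ^ (p + 1 + i) * ‖F (k - 1)‖) * Q k (i + p + 1) :=
          mul_le_mul (hpow _) (h.norm_le k hk _) (norm_nonneg _) (by positivity)
      _ = _ := by
          rw [pow_add, add_assoc i p 1]
          ring
  refine (norm_sum_le_of_le _ fun i _ => hterm i).trans ?_
  rw [← Finset.mul_sum, mul_assoc]
  have := sum_geometric_two_step_le (x := fun i => Q k (i + (p + 1)))
    (fun i => h.Q_nonneg hk _) (fun i => by
      have := h.step k hk (i + (p + 1)) (by omega)
      have e : i + (p + 1) + 2 = i + 2 + (p + 1) := by ring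
      rwa [e] at this) L
  have e0 : (0 + (p + 1)) = p + 1 := by ring
  have e1 : (1 + (p + 1)) = p + 2 := by ring
  simp only [e0, e1] at this
  gcongr

/-- The ratio bound is assumed only below `k`, so that this can serve as an induction step. The
constant covers `(10/9)(20/19)(1 + (10/9)·2.01)`. -/
theorem norm_sub_le_of_lt (h : PerturbedRecurrence n F q Q a b c ζ) {k : ℤ} (hk : k ≤ n)
    (hF : ∀ j < k, ‖F (j - 1)‖ ≤ 10 / 9 * ‖F j‖) :
    ‖F k - F (k - 1)‖ ≤ ‖F (k - 1)‖ * (3.79 * (ζ * a k)) := by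
  have h1 := h.norm_sum_le hk hF 0 n
  have h2 := h.rec_eq k hk n le_rfl
  have e : F k - F (k - 1) = ∑ i ∈ Finset.range n, F (k - 2 - (i + 0 : ℕ)) * q k (i + 0 + 1) := by
    rw [h2]
    simp
  rw [e]
  refine h1.trans (mul_le_mul_of_nonneg_left ?_ (norm_nonneg _))
  have h3 := h.le_one k hk
  have h4 := h.le_two k hk
  have h5 := mul_nonneg h.zeta_nonneg (h.a_nonneg k hk)
  norm_num at h3 h4 ⊢
  linarith

theorem zeta_mul_a_le (h : PerturbedRecurrence n F q Q a b c ζ) {k : ℤ} (hk : k ≤ n) :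
    ζ * a k ≤ 0.0201 := by
  calc ζ * a k ≤ 2.01 * (1 / 100) :=
        mul_le_mul h.zeta_le (h.a_le k hk) (h.a_nonneg k hk) (by norm_num)
    _ = _ := by norm_num

/-- Bootstrap: the ratio bound below `k` gives `‖F k - F (k-1)‖ ≤ 0.1 ‖F (k-1)‖`, because
`3.79·0.0201 < 0.1`, and `1/(1 - 0.1) = 10/9` reproduces the bound at `k`. Nonvanishing comes along
and makes ratios and logarithms available. -/
theorem norm_pred_le (h : PerturbedRecurrence n F q Q a b c ζ) :
    ∀ k ≤ (n : ℤ), F k ≠ 0 ∧ ‖F (k - 1)‖ ≤ 10 / 9 * ‖F k‖ := by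
  suffices H : ∀ N : ℕ, N ≤ n → ∀ k ≤ (N : ℤ), F k ≠ 0 ∧ ‖F (k - 1)‖ ≤ 10 / 9 * ‖F k‖ from
    H n le_rfl
  intro N
  induction N with
  | zero =>
    intro _ k hk
    rw [h.init k (by simpa using hk), h.init (k - 1) (by simp at hk; omega)]
    norm_num
  | succ N ih =>
    intro hN k hk
    have ih' := ih (by omega)
    rcases lt_or_ge k ((N + 1 : ℕ) : ℤ) with hlt | hge
    · exact ih' k (by push_cast at hlt; omega)
    · have hkn : k ≤ (n : ℤ) := by omega
      have h1 := h.norm_sub_le_of_lt hkn fun j hj => (ih' j (by push_cast at hk; omega)).2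
      have h2 := (ih' (k - 1) (by push_cast at hk; omega)).1
      have h3 := norm_pos_iff.2 h2
      have h4 := h.zeta_mul_a_le hkn
      have h5 : ‖F (k - 1)‖ ≤ ‖F k‖ + ‖F k - F (k - 1)‖ := by
        have := norm_sub_le (F k) (F k - F (k - 1))
        rwa [sub_sub_cancel] at this
      have h6 : ‖F (k - 1)‖ ≤ 10 / 9 * ‖F k‖ := by
        have : ‖F (k - 1)‖ * (3.79 * (ζ * a k)) ≤ ‖F (k - 1)‖ * 0.1 := by
          gcongr
          norm_num at h4 ⊢
          linarith
        norm_num at this h1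
        linarith
      refine ⟨?_, h6⟩
      intro h0
      rw [h0, norm_zero] at h6
      linarith

/-- `δ k = F k / F (k-1) - 1`. -/
noncomputable def delta (F : ℤ → ℂ) (k : ℤ) : ℂ := F k / F (k - 1) - 1

theorem norm_delta_le (h : PerturbedRecurrence n F q Q a b c ζ) {k : ℤ} (hk : k ≤ n) :
    ‖delta F k‖ ≤ 3.79 * (ζ * a k) := by
  have h0 := (h.norm_pred_le (k - 1) (by omega)).1
  have h1 := h.norm_sub_le_of_lt hk fun j hj => (h.norm_pred_le j (by omega)).2
  have e : delta F k = (F k - F (k - 1)) / F (k - 1) := by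
    rw [delta, sub_div, div_self h0]
  rw [e, norm_div, div_le_iff₀ (norm_pos_iff.2 h0)]
  linarith

theorem norm_delta_le_tenth (h : PerturbedRecurrence n F q Q a b c ζ) {k : ℤ} (hk : k ≤ n) :
    ‖delta F k‖ ≤ 1 / 10 := by
  have h1 := h.norm_delta_le hk
  have h2 := h.zeta_mul_a_le hk
  norm_num at h1 h2 ⊢
  linarith

theorem norm_ratio_le (h : PerturbedRecurrence n F q Q a b c ζ) {k : ℤ} (hk : k ≤ n) :
    ‖F (k - 1) / F k‖ ≤ 10 / 9 := by
  have h1 := h.norm_pred_le k hk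
  rw [norm_div, div_le_iff₀ (norm_pos_iff.2 h1.1)]
  exact h1.2

theorem ratio_sub_one (h : PerturbedRecurrence n F q Q a b c ζ) {k : ℤ} (hk : k ≤ n) :
    F (k - 1) / F k - 1 = -(delta F k * (F (k - 1) / F k)) := by
  have h1 := (h.norm_pred_le k hk).1
  have h2 := (h.norm_pred_le (k - 1) (by omega)).1
  rw [delta]
  field_simp
  ring

theorem norm_ratio_sub_one_le (h : PerturbedRecurrence n F q Q a b c ζ) {k : ℤ} (hk : k ≤ n) :
    ‖F (k - 1) / F k - 1‖ ≤ 4.22 * (ζ * a k) := by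
  rw [h.ratio_sub_one hk, norm_neg, norm_mul]
  have h5 := mul_nonneg h.zeta_nonneg (h.a_nonneg k hk)
  calc _ ≤ (3.79 * (ζ * a k)) * (10 / 9) :=
        mul_le_mul (h.norm_delta_le hk) (h.norm_ratio_le hk) (norm_nonneg _)
          (by norm_num; linarith)
    _ ≤ _ := by norm_num; linarith

theorem norm_delta_sub_first_le (h : PerturbedRecurrence n F q Q a b c ζ) {k : ℤ} (hk : k ≤ n) :
    ‖delta F k - q k 1 * (F (k - 1 - 1) / F (k - 1))‖ ≤ 4.21 * (ζ ^ 2 * b k) := by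
  have h0 := (h.norm_pred_le (k - 1) (by omega)).1
  have h1 := h.norm_sum_le hk (fun j hj => (h.norm_pred_le j (by omega)).2) 1 n
  -- The freedom in the truncation length: with `n + 1` terms, splitting off the first block leaves
  -- a sum over `range n`.
  have h2 := h.rec_eq k hk (n + 1) (by omega)
  rw [Finset.sum_range_succ'] at h2
  have e : delta F k - q k 1 * (F (k - 1 - 1) / F (k - 1)) =
      (∑ i ∈ Finset.range n, F (k - 2 - (i + 1 : ℕ)) * q k (i + 1 + 1)) / F (k - 1) := by
    rw [delta]
    field_simp
    rw [h2]
    simp only [Nat.cast_zero, sub_zero, zero_add]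
    have : k - 1 - 1 = k - 2 := by ring
    rw [this]
    ring
  rw [e, norm_div, div_le_iff₀ (norm_pos_iff.2 h0), mul_comm]
  refine h1.trans (mul_le_mul_of_nonneg_left ?_ (norm_nonneg _))
  have h3 := h.le_two' k hk
  have h4 := h.le_three k hk
  have h5 := mul_nonneg (pow_nonneg h.zeta_nonneg 2) (h.b_nonneg k hk)
  norm_num at h3 h4 ⊢
  linarith

theorem norm_delta_sub_second_le (h : PerturbedRecurrence n F q Q a b c ζ) {k : ℤ} (hk : k ≤ n) :
    ‖delta F k - q k 1 * (F (k - 1 - 1) / F (k - 1)) - q k 2 * (F (k - 3) / F (k - 1))‖ ≤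
      5 * (ζ ^ 3 * c k) := by
  have h0 := (h.norm_pred_le (k - 1) (by omega)).1
  have h1 := h.norm_sum_le hk (fun j hj => (h.norm_pred_le j (by omega)).2) 2 n
  have h2 := h.rec_eq k hk (n + 2) (by omega)
  rw [Finset.sum_range_succ', Finset.sum_range_succ'] at h2
  have e : delta F k - q k 1 * (F (k - 1 - 1) / F (k - 1)) - q k 2 * (F (k - 3) / F (k - 1)) =
      (∑ i ∈ Finset.range n, F (k - 2 - (i + 2 : ℕ)) * q k (i + 2 + 1)) / F (k - 1) := by
    rw [delta]
    field_simp
    rw [h2]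
    simp only [Nat.cast_zero, sub_zero, zero_add]
    have : k - 1 - 1 = k - 2 := by ring
    rw [this]
    have : k - 2 - ((1 : ℕ) : ℤ) = k - 3 := by push_cast; ring
    rw [this]
    norm_num [add_assoc]
    ring
  rw [e, norm_div, div_le_iff₀ (norm_pos_iff.2 h0), mul_comm]
  refine h1.trans (mul_le_mul_of_nonneg_left ?_ (norm_nonneg _))
  have h3 := h.le_three' k hk
  have h4 := h.le_four k hk
  have h5 := mul_nonneg (pow_nonneg h.zeta_nonneg 3) (h.c_nonneg k hk)
  norm_num at h3 h4 ⊢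
  linarith

theorem norm_q_one_le (h : PerturbedRecurrence n F q Q a b c ζ) {k : ℤ} (hk : k ≤ n) :
    ‖q k 1‖ ≤ ζ * a k := (h.norm_le k hk 1).trans (h.le_one k hk)

theorem norm_delta_sub_le (h : PerturbedRecurrence n F q Q a b c ζ) {k : ℤ} (hk : k ≤ n) :
    ‖delta F k - q k 1‖ ≤ ζ ^ 2 * (4.21 * b k + 4.22 * (a k * a (k - 1))) := by
  have h1 := h.norm_delta_sub_first_le hk
  have h2 := h.norm_ratio_sub_one_le (k := k - 1) (by omega)
  have h3 : ‖q k 1 * (F (k - 1 - 1) / F (k - 1) - 1)‖ ≤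
      (ζ * a k) * (4.22 * (ζ * a (k - 1))) := by
    rw [norm_mul]
    exact mul_le_mul (h.norm_q_one_le hk) h2 (norm_nonneg _)
      (mul_nonneg h.zeta_nonneg (h.a_nonneg k hk))
  have e : delta F k - q k 1 = (delta F k - q k 1 * (F (k - 1 - 1) / F (k - 1))) +
      q k 1 * (F (k - 1 - 1) / F (k - 1) - 1) := by ring
  rw [e]
  refine (norm_add_le_of_le h1 h3).trans (le_of_eq ?_)
  ring

/-- In the recurrence divided by `F (k-1)`, the ratio `F (k-2) / F (k-1) = 1/(1 + δ_{k-1})` is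
replaced by `1 - q (k-1) 1`, and `F (k-3) / F (k-1)` by `1`. Every discarded term has order `ζ³`. -/
theorem norm_delta_sub_quadratic_le (h : PerturbedRecurrence n F q Q a b c ζ) {k : ℤ}
    (hk : k ≤ n) :
    ‖delta F k - (q k 1 - q k 1 * q (k - 1) 1 + q k 2)‖ ≤
      ζ ^ 3 * (5 * c k + 5 * (b k * (a (k - 1) + a (k - 2))) +
        16 * (a k * b (k - 1) + a k * a (k - 1) * a (k - 2) + a k * a (k - 1) ^ 2)) := by
  have hk1 : k - 1 ≤ (n : ℤ) := by omega
  have hk2 : k - 2 ≤ (n : ℤ) := by omega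
  have hz := h.zeta_nonneg
  have ha := h.a_nonneg k hk
  have ha1 := h.a_nonneg _ hk1
  have ha2 := h.a_nonneg _ hk2
  have hb := h.b_nonneg k hk
  have hb1 := h.b_nonneg _ hk1
  have h1 := h.norm_delta_sub_second_le hk
  have hd := h.norm_delta_sub_le hk1
  have hdd := h.norm_delta_le hk1
  have hr1 := h.norm_ratio_le hk1
  have hs1 := h.norm_ratio_sub_one_le hk1
  have hs2 := h.norm_ratio_sub_one_le hk2
  have hF1 := (h.norm_pred_le _ hk1).1
  have hF2 := (h.norm_pred_le _ hk2).1
  have e12 : k - 1 - 1 = k - 2 := by ring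
  have e23 : k - 2 - 1 = k - 3 := by ring
  rw [e12] at hd hr1 hs1 h1
  rw [e23] at hs2
  have hu := h.ratio_sub_one hk1
  rw [e12] at hu
  set u1 := F (k - 2) / F (k - 1) with hu1
  set u2 := F (k - 3) / F (k - 2) with hu2
  set d1 := delta F (k - 1) with hd1
  have eu : F (k - 3) / F (k - 1) = u1 * u2 := by
    rw [hu1, hu2]
    field_simp
  rw [eu] at h1
  -- Applying `u1 - 1 = -d1 u1` twice gives the exact identity `u1 = 1 - d1 + d1² u1`.
  have hA : ‖q k 1 * (-(d1 - q (k - 1) 1) + d1 ^ 2 * u1)‖ ≤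
      (ζ * a k) * (ζ ^ 2 * (4.21 * b (k - 1) + 4.22 * (a (k - 1) * a (k - 2))) +
        (3.79 * (ζ * a (k - 1))) ^ 2 * (10 / 9)) := by
    rw [norm_mul]
    refine mul_le_mul (h.norm_q_one_le hk) ?_ (norm_nonneg _) (by positivity)
    refine norm_add_le_of_le (by rwa [norm_neg]) ?_
    rw [norm_mul, norm_pow]
    gcongr
  have hB : ‖q k 2 * ((u2 - 1) * u1 + (u1 - 1))‖ ≤
      (ζ ^ 2 * b k) * (4.22 * (ζ * a (k - 2)) * (10 / 9) + 4.22 * (ζ * a (k - 1))) := by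
    rw [norm_mul]
    refine mul_le_mul ((h.norm_le k hk 2).trans (h.le_two' k hk)) ?_ (norm_nonneg _)
      (by positivity)
    refine norm_add_le_of_le ?_ hs1
    rw [norm_mul]
    gcongr
  have e : delta F k - (q k 1 - q k 1 * q (k - 1) 1 + q k 2) =
      (delta F k - q k 1 * u1 - q k 2 * (u1 * u2)) +
        (q k 1 * (-(d1 - q (k - 1) 1) + d1 ^ 2 * u1) + q k 2 * ((u2 - 1) * u1 + (u1 - 1))) := by
    linear_combination (q k 1 - q k 1 * d1) * hu
  rw [e]
  refine (norm_add_le_of_le h1 (norm_add_le_of_le hA hB)).trans ?_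
  have hz3 : 0 ≤ ζ ^ 3 := by positivity
  have t1 : 0 ≤ ζ ^ 3 * (a k * b (k - 1)) := by positivity
  have t2 : 0 ≤ ζ ^ 3 * (a k * a (k - 1) * a (k - 2)) := by positivity
  have t3 : 0 ≤ ζ ^ 3 * (a k * a (k - 1) ^ 2) := by positivity
  have t4 : 0 ≤ ζ ^ 3 * (b k * a (k - 1)) := by positivity
  have t5 : 0 ≤ ζ ^ 3 * (b k * a (k - 2)) := by positivity
  norm_num
  nlinarith

theorem norm_log_sub_le (h : PerturbedRecurrence n F q Q a b c ζ) {k : ℤ} (hk : k ≤ n) :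
    ‖Complex.log (1 + delta F k) - q k 1‖ ≤
      8 * (ζ ^ 2 * (b k + a k * a (k - 1) + a k ^ 2)) := by
  have hz := h.zeta_nonneg
  have ha := h.a_nonneg k hk
  have ha1 := h.a_nonneg (k - 1) (by omega)
  have hb := h.b_nonneg k hk
  have hd := h.norm_delta_le hk
  have hd' := h.norm_delta_le_tenth hk
  have h1 := h.norm_delta_sub_le hk
  have h2 := Complex.norm_log_one_add_sub_self_le (z := delta F k) (by linarith)
  have h3 : ‖delta F k‖ ^ 2 * (1 - ‖delta F k‖)⁻¹ / 2 ≤ (3.79 * (ζ * a k)) ^ 2 * (10 / 9) / 2 := by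
    have : (1 - ‖delta F k‖)⁻¹ ≤ 10 / 9 := by
      rw [inv_le_comm₀ (by linarith) (by norm_num)]
      norm_num
      linarith
    have h0 : 0 ≤ (1 - ‖delta F k‖)⁻¹ := inv_nonneg.2 (by linarith)
    gcongr
  have e : Complex.log (1 + delta F k) - q k 1 =
      (Complex.log (1 + delta F k) - delta F k) + (delta F k - q k 1) := by ring
  rw [e]
  refine (norm_add_le_of_le (h2.trans h3) h1).trans ?_
  have t1 : 0 ≤ ζ ^ 2 * b k := by positivity
  have t2 : 0 ≤ ζ ^ 2 * (a k * a (k - 1)) := by positivity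
  have t3 : 0 ≤ ζ ^ 2 * (a k ^ 2) := by positivity
  norm_num
  nlinarith

theorem norm_log_sub_quadratic_le (h : PerturbedRecurrence n F q Q a b c ζ) {k : ℤ}
    (hk : k ≤ n) :
    ‖Complex.log (1 + delta F k) - (q k 1 - q k 1 * q (k - 1) 1 + q k 2 - q k 1 ^ 2 / 2)‖ ≤
      30 * (ζ ^ 3 * (c k + b k * (a (k - 2) + a (k - 1) + a k) + a k * b (k - 1) +
        a k * a (k - 1) * a (k - 2) + a k * a (k - 1) ^ 2 + a k ^ 2 * a (k - 1) + a k ^ 3)) := by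
  have hz := h.zeta_nonneg
  have ha := h.a_nonneg k hk
  have ha1 := h.a_nonneg (k - 1) (by omega)
  have ha2 := h.a_nonneg (k - 2) (by omega)
  have hb := h.b_nonneg k hk
  have hb1 := h.b_nonneg (k - 1) (by omega)
  have hc := h.c_nonneg k hk
  have hd := h.norm_delta_le hk
  have hd' := h.norm_delta_le_tenth hk
  have h1 := h.norm_delta_sub_le hk
  have hq := h.norm_q_one_le hk
  have hquad := h.norm_delta_sub_quadratic_le hk
  have h2 := Complex.norm_log_sub_logTaylor_le 2 (z := delta F k) (by linarith)
  have eT : Complex.logTaylor (2 + 1) (delta F k) = delta F k - delta F k ^ 2 / 2 := by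
    simp [Complex.logTaylor_succ, Complex.logTaylor_zero]
    ring
  rw [eT] at h2
  have h3 : ‖delta F k‖ ^ (2 + 1) * (1 - ‖delta F k‖)⁻¹ / ((2 : ℕ) + 1) ≤
      (3.79 * (ζ * a k)) ^ (2 + 1) * (10 / 9) / ((2 : ℕ) + 1) := by
    have : (1 - ‖delta F k‖)⁻¹ ≤ 10 / 9 := by
      rw [inv_le_comm₀ (by linarith) (by norm_num)]
      norm_num
      linarith
    have h0 : 0 ≤ (1 - ‖delta F k‖)⁻¹ := inv_nonneg.2 (by linarith)
    gcongr
  -- Passing from `δ²/2` to `(q k 1)²/2` through the difference of squares costs one more factor of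
  -- order `ζ`.
  have h4 : ‖-((delta F k - q k 1) * (delta F k + q k 1)) / 2‖ ≤
      (ζ ^ 2 * (4.21 * b k + 4.22 * (a k * a (k - 1)))) * (3.79 * (ζ * a k) + ζ * a k) / 2 := by
    rw [norm_div, norm_neg, norm_mul]
    have : ‖(2 : ℂ)‖ = 2 := by simp
    rw [this]
    have h5 := norm_add_le_of_le hd hq
    gcongr
  have e : Complex.log (1 + delta F k) -
      (q k 1 - q k 1 * q (k - 1) 1 + q k 2 - q k 1 ^ 2 / 2) =
      (Complex.log (1 + delta F k) - (delta F k - delta F k ^ 2 / 2)) +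
      ((delta F k - (q k 1 - q k 1 * q (k - 1) 1 + q k 2)) +
        -((delta F k - q k 1) * (delta F k + q k 1)) / 2) := by ring
  rw [e]
  refine (norm_add_le_of_le (h2.trans h3) (norm_add_le_of_le hquad h4)).trans ?_
  have t0 : 0 ≤ ζ ^ 3 * c k := by positivity
  have t1 : 0 ≤ ζ ^ 3 * (a k * b (k - 1)) := by positivity
  have t2 : 0 ≤ ζ ^ 3 * (a k * a (k - 1) * a (k - 2)) := by positivity
  have t3 : 0 ≤ ζ ^ 3 * (a k * a (k - 1) ^ 2) := by positivity
  have t4 : 0 ≤ ζ ^ 3 * (b k * a (k - 1)) := by positivity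
  have t5 : 0 ≤ ζ ^ 3 * (b k * a (k - 2)) := by positivity
  have t6 : 0 ≤ ζ ^ 3 * (b k * a k) := by positivity
  have t7 : 0 ≤ ζ ^ 3 * (a k ^ 2 * a (k - 1)) := by positivity
  have t8 : 0 ≤ ζ ^ 3 * a k ^ 3 := by positivity
  norm_num
  nlinarith

/-- For the real part, `log ‖1 + δ‖ ≤ Re δ + ‖δ‖²/2` avoids any Taylor remainder and keeps the
constants small, as the Gaussian decay later requires. Here `0.115` covers `(3.79²/2 + 4.22)/100`.
-/
theorem re_log_le (h : PerturbedRecurrence n F q Q a b c ζ) {k : ℤ} (hk : k ≤ n) :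
    (Complex.log (1 + delta F k)).re ≤ (q k 1).re + ζ ^ 2 * (4.21 * b k + 0.115 * a k) := by
  have hz := h.zeta_nonneg
  have ha := h.a_nonneg k hk
  have ha' := h.a_le k hk
  have ha1 := h.a_nonneg (k - 1) (by omega)
  have ha1' := h.a_le (k - 1) (by omega)
  have hd := h.norm_delta_le hk
  have hd' := h.norm_delta_le_tenth hk
  have h1 := (Complex.re_le_norm _).trans (h.norm_delta_sub_le hk)
  rw [Complex.sub_re] at h1
  have hpos : 0 < ‖1 + delta F k‖ := by
    have := norm_sub_le (1 + delta F k) (delta F k)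
    rw [add_sub_cancel_right, norm_one] at this
    linarith
  have hn : ‖1 + delta F k‖ ^ 2 = 1 + (2 * (delta F k).re + ‖delta F k‖ ^ 2) := by
    rw [← Complex.normSq_eq_norm_sq, ← Complex.normSq_eq_norm_sq, Complex.normSq_add]
    simp
    ring
  have hlog : 2 * Real.log ‖1 + delta F k‖ ≤ 2 * (delta F k).re + ‖delta F k‖ ^ 2 := by
    have := Real.log_le_sub_one_of_pos (x := ‖1 + delta F k‖ ^ 2) (by positivity)
    rw [Real.log_pow, hn] at this
    push_cast at this
    linarith
  rw [Complex.log_re]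
  have hsq : ‖delta F k‖ ^ 2 ≤ (3.79 * (ζ * a k)) ^ 2 := by gcongr
  have s1 : ζ ^ 2 * (a k * a (k - 1)) ≤ ζ ^ 2 * (a k * (1 / 100)) := by gcongr
  have s2 : ζ ^ 2 * (a k * a k) ≤ ζ ^ 2 * (a k * (1 / 100)) := by gcongr
  have t3 : 0 ≤ ζ ^ 2 * a k := by positivity
  norm_num at *
  nlinarith

/-- The ratios telescope to `F n / F 0` and `F 0 = 1`. Summing principal logarithms of the ratios
avoids choosing a branch for `F n` itself. -/
theorem exp_sum_log (h : PerturbedRecurrence n F q Q a b c ζ) :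
    Complex.exp (∑ k ∈ Finset.Icc (1 : ℤ) n, Complex.log (1 + delta F k)) = F n := by
  rw [Complex.exp_sum]
  have h1 : ∀ k ∈ Finset.Icc (1 : ℤ) n,
      Complex.exp (Complex.log (1 + delta F k)) = F k / F (k - 1) := by
    intro k hk
    rw [Finset.mem_Icc] at hk
    have h2 := (h.norm_pred_le k hk.2).1
    have h3 := (h.norm_pred_le (k - 1) (by omega)).1
    have e : 1 + delta F k = F k / F (k - 1) := by
      rw [delta]
      ring
    rw [e, Complex.exp_log (div_ne_zero h2 h3)]
  rw [Finset.prod_congr rfl h1, prod_Icc_one_int (fun k => F k / F (k - 1))]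
  have H : ∀ N : ℕ, N ≤ n →
      ∏ i ∈ Finset.range N, F ((i : ℤ) + 1) / F ((i : ℤ) + 1 - 1) = F N := by
    intro N
    induction N with
    | zero => intro _; simp [h.init]
    | succ N ih =>
      intro hN
      rw [Finset.prod_range_succ, ih (by omega), add_sub_cancel_right]
      have := (h.norm_pred_le N (by omega)).1
      push_cast
      field_simp
  exact H n le_rfl

end PerturbedRecurrence

/-! ### Generating functions of one-dependent sums -/

/-- Bounded one-dependent variables `X 1, …, X n`, extended by zero to the nonpositive indices. -/
structure BoundedOneDependent {Ω : Type*} [MeasurableSpace Ω] (μ : Measure Ω) (X : ℤ → Ω → ℕ)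
    (n b : ℕ) : Prop where
  eq_zero : ∀ k ≤ 0, ∀ ω, X k ω = 0
  meas' : ∀ k ∈ Set.Icc (1 : ℤ) n, Measurable (X k)
  dep : IsOneDependent μ X n
  bdd : ∀ᵐ ω ∂μ, ∀ i ≤ (n : ℤ), X i ω ≤ b

/-- `e^{sX_k} - 1`. -/
noncomputable def expSubOne {Ω : Type*} (X : ℤ → Ω → ℕ) (s : ℂ) (k : ℤ) (ω : Ω) : ℂ :=
  Complex.exp (s * X k ω) - 1

/-- `e^{s(X_1 + ⋯ + X_j)}`. -/
noncomputable def expPartialSum {Ω : Type*} (X : ℤ → Ω → ℕ) (s : ℂ) (j : ℤ) (ω : Ω) : ℂ :=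
  Complex.exp (s * (∑ i ∈ Finset.Icc 1 j, X i ω : ℕ))

/-- `∏_{i < m} (e^{sX_{k-i}} - 1)`. -/
noncomputable def expBlock {Ω : Type*} (X : ℤ → Ω → ℕ) (s : ℂ) (k : ℤ) (m : ℕ) (ω : Ω) : ℂ :=
  ∏ i ∈ Finset.range m, expSubOne X s (k - i) ω

/-! ### Measurability of exponential factors and blocks -/

section Measurability

variable {Ω : Type*} {X : ℤ → Ω → ℕ}

theorem measurable_expSubOne {mΩ : MeasurableSpace Ω} {k : ℤ} (h : Measurable (X k)) (s : ℂ) :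
    Measurable (expSubOne X s k) :=
  (Measurable.of_discrete (f := fun x : ℕ => Complex.exp (s * x) - 1)).comp h

theorem measurable_expPartialSum {mΩ : MeasurableSpace Ω} {j : ℤ}
    (h : ∀ i ∈ Finset.Icc 1 j, Measurable (X i)) (s : ℂ) : Measurable (expPartialSum X s j) :=
  (Measurable.of_discrete (f := fun x : ℕ => Complex.exp (s * x))).comp
    (Finset.measurable_fun_sum (Finset.Icc 1 j) h)

theorem measurable_expBlock {mΩ : MeasurableSpace Ω} {k : ℤ} {m : ℕ}
    (h : ∀ i < m, Measurable (X (k - i))) (s : ℂ) : Measurable (expBlock X s k m) :=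
  Finset.measurable_fun_prod _ fun i hi => measurable_expSubOne (h i (Finset.mem_range.1 hi)) s

theorem expBlock_succ (s : ℂ) (k : ℤ) (m : ℕ) (ω : Ω) :
    expBlock X s k (m + 1) ω = expBlock X s k m ω * expSubOne X s (k - m) ω :=
  Finset.prod_range_succ _ _

theorem measurable_iSup_comap {j : ℤ} {S : Set ℤ} (hj : j ∈ S) :
    Measurable[⨆ l ∈ S, MeasurableSpace.comap (X l) ⊤] (X j) := by
  rw [measurable_iff_comap_le]
  exact le_iSup₂ (f := fun l (_ : l ∈ S) => MeasurableSpace.comap (X l) ⊤) j hj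

theorem expPartialSum_of_nonpos {s : ℂ} {j : ℤ} (hj : j ≤ 0) (ω : Ω) : expPartialSum X s j ω = 1 := by
  rw [expPartialSum, Finset.Icc_eq_empty (by omega)]
  simp

end Measurability

/-- The Taylor remainder of `(1 + z)^x`. -/
theorem norm_pow_sub_sum_choose_le {w : ℂ} {W : ℝ} (hW : 1 ≤ W) (p x : ℕ)
    (hx : ∀ y ≤ x, ‖w‖ ^ y ≤ W) :
    ‖w ^ x - ∑ i ∈ Finset.range p, (x.choose i : ℂ) * (w - 1) ^ i‖ ≤
      x.choose p * (W * ‖w - 1‖ ^ p) := by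
  induction x generalizing p with
  | zero =>
    cases p with
    | zero => simpa using hW
    | succ p =>
      rw [Finset.sum_range_succ']
      simp
  | succ x ih =>
    cases p with
    | zero =>
      simpa using hx (x + 1) le_rfl
    | succ p =>
      have ih' := fun p => ih p fun y hy => hx y (by omega)
      -- Pascal's rule for remainders: order `p + 1` at `x + 1` is order `p + 1` at `x` plus `w - 1`
      -- times order `p` at `x`.
      have e : w ^ (x + 1) - ∑ i ∈ Finset.range (p + 1), ((x + 1).choose i : ℂ) * (w - 1) ^ i =
          (w ^ x - ∑ i ∈ Finset.range (p + 1), (x.choose i : ℂ) * (w - 1) ^ i) +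
          (w - 1) * (w ^ x - ∑ i ∈ Finset.range p, (x.choose i : ℂ) * (w - 1) ^ i) := by
        rw [Finset.sum_range_succ', Finset.sum_range_succ' (n := p)]
        simp only [Nat.choose_succ_succ, Nat.cast_add, add_mul, Finset.sum_add_distrib,
          Nat.choose_zero_right, mul_sub, Finset.mul_sum]
        have : ∀ i : ℕ, (w - 1) * ((x.choose i : ℂ) * (w - 1) ^ i) =
            (x.choose i : ℂ) * (w - 1) ^ (i + 1) := fun i => by ring
        simp only [this]
        ring
      rw [e]
      refine (norm_add_le _ _).trans ?_
      rw [norm_mul, Nat.choose_succ_succ]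
      have h1 := ih' (p + 1)
      have h2 := mul_le_mul_of_nonneg_left (ih' p) (norm_nonneg (w - 1))
      push_cast
      refine (add_le_add h1 h2).trans (le_of_eq ?_)
      ring

/-! ### Pointwise Taylor estimates for `e^{sX_k} - 1` -/

section Pointwise

variable {Ω : Type*} {X : ℤ → Ω → ℕ} {s : ℂ} {b : ℕ} {W : ℝ}

theorem norm_exp_pow_le (hW : Real.exp (|s.re| * b) ≤ W) {y : ℕ} (hy : y ≤ b) :
    ‖Complex.exp s‖ ^ y ≤ W := by
  refine le_trans ?_ hW
  rw [Complex.norm_exp, ← Real.exp_nat_mul, Real.exp_le_exp]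
  have : (y : ℝ) ≤ b := by exact_mod_cast hy
  calc (y : ℝ) * s.re ≤ y * |s.re| := by gcongr; exact le_abs_self _
    _ ≤ b * |s.re| := by gcongr
    _ = _ := mul_comm _ _

theorem one_le_of_exp_le (hW : Real.exp (|s.re| * b) ≤ W) : 1 ≤ W :=
  le_trans (Real.one_le_exp (by positivity)) hW

theorem norm_expSubOne_le_const (hW : Real.exp (|s.re| * b) ≤ W) {k : ℤ} {ω : Ω}
    (hk : X k ω ≤ b) : ‖expSubOne X s k ω‖ ≤ W + 1 := by
  refine (norm_sub_le _ _).trans ?_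
  rw [mul_comm, Complex.exp_nat_mul, norm_pow, norm_one]
  linarith [norm_exp_pow_le hW hk]

theorem norm_expSubOne_le (hW : Real.exp (|s.re| * b) ≤ W) {k : ℤ} {ω : Ω} (hk : X k ω ≤ b) :
    ‖expSubOne X s k ω‖ ≤ W * ‖Complex.exp s - 1‖ * X k ω := by
  have := norm_pow_sub_sum_choose_le (w := Complex.exp s) (one_le_of_exp_le hW) 1 (X k ω)
    (fun y hy => norm_exp_pow_le hW (hy.trans hk))
  rw [expSubOne, mul_comm s, Complex.exp_nat_mul]
  simp at this
  linarith

theorem norm_expSubOne_sub_le (hW : Real.exp (|s.re| * b) ≤ W) {k : ℤ} {ω : Ω}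
    (hk : X k ω ≤ b) :
    ‖expSubOne X s k ω - (Complex.exp s - 1) * X k ω‖ ≤
      (W * ‖Complex.exp s - 1‖) ^ 2 * ((X k ω).descFactorial 2 / 2) := by
  have hW1 := one_le_of_exp_le hW
  have := norm_pow_sub_sum_choose_le (w := Complex.exp s) hW1 2 (X k ω)
    (fun y hy => norm_exp_pow_le hW (hy.trans hk))
  rw [expSubOne, mul_comm s, Complex.exp_nat_mul]
  have e : Complex.exp s ^ X k ω - 1 - (Complex.exp s - 1) * X k ω = Complex.exp s ^ X k ω -
      ∑ i ∈ Finset.range 2, ((X k ω).choose i : ℂ) * (Complex.exp s - 1) ^ i := by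
    simp [Finset.sum_range_succ]
    ring
  rw [e]
  refine this.trans ?_
  rw [Nat.descFactorial_eq_factorial_mul_choose]
  -- Since `W ≥ 1`, the error can be written in the single parameter `ζ = W‖z‖`.
  have h1 : W * ‖Complex.exp s - 1‖ ^ 2 ≤ (W * ‖Complex.exp s - 1‖) ^ 2 := by
    rw [mul_pow]
    gcongr
    nlinarith
  have h2 := mul_le_mul_of_nonneg_left h1 ((X k ω).choose 2).cast_nonneg (α := ℝ)
  refine h2.trans (le_of_eq ?_)
  push_cast [Nat.factorial]
  ring

theorem norm_expSubOne_sub_sub_le (hW : Real.exp (|s.re| * b) ≤ W) {k : ℤ} {ω : Ω}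
    (hk : X k ω ≤ b) :
    ‖expSubOne X s k ω - (Complex.exp s - 1) * X k ω -
        (Complex.exp s - 1) ^ 2 * ((X k ω).descFactorial 2 / 2)‖ ≤
      (W * ‖Complex.exp s - 1‖) ^ 3 * ((X k ω).descFactorial 3 / 6) := by
  have hW1 := one_le_of_exp_le hW
  have := norm_pow_sub_sum_choose_le (w := Complex.exp s) hW1 3 (X k ω)
    (fun y hy => norm_exp_pow_le hW (hy.trans hk))
  rw [expSubOne, mul_comm s, Complex.exp_nat_mul]
  have e : Complex.exp s ^ X k ω - 1 - (Complex.exp s - 1) * X k ω -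
      (Complex.exp s - 1) ^ 2 * ((X k ω).descFactorial 2 / 2) = Complex.exp s ^ X k ω -
      ∑ i ∈ Finset.range 3, ((X k ω).choose i : ℂ) * (Complex.exp s - 1) ^ i := by
    rw [Nat.descFactorial_eq_factorial_mul_choose]
    simp [Finset.sum_range_succ, Nat.factorial]
    ring
  rw [e]
  refine this.trans ?_
  rw [Nat.descFactorial_eq_factorial_mul_choose]
  have h1 : W * ‖Complex.exp s - 1‖ ^ 3 ≤ (W * ‖Complex.exp s - 1‖) ^ 3 := by
    rw [mul_pow]
    gcongr
    exact le_self_pow₀ hW1 (by norm_num)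
  have h2 := mul_le_mul_of_nonneg_left h1 ((X k ω).choose 3).cast_nonneg (α := ℝ)
  refine h2.trans (le_of_eq ?_)
  push_cast [Nat.factorial]
  ring

end Pointwise

namespace BoundedOneDependent

variable {Ω : Type*} [MeasurableSpace Ω] {μ : Measure Ω} {X : ℤ → Ω → ℕ} {n b : ℕ}

theorem measurable (h : BoundedOneDependent μ X n b) {k : ℤ} (hk : k ≤ n) : Measurable (X k) := by
  rcases le_or_gt k 0 with h0 | h0
  · have : X k = fun _ => 0 := funext (h.eq_zero k h0)
    rw [this]
    exact measurable_const
  · exact h.meas' k ⟨h0, hk⟩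

theorem indepFun (h : BoundedOneDependent μ X n b) {α β : Type*} [MeasurableSpace α]
    [MeasurableSpace β] {f : Ω → α} {g : Ω → β} {i j : ℤ} (hi : 1 ≤ i) (hij : 1 < j - i)
    (hf : Measurable[⨆ l ∈ Set.Icc 1 i, MeasurableSpace.comap (X l) ⊤] f)
    (hg : Measurable[⨆ l ∈ Set.Icc j (n : ℤ), MeasurableSpace.comap (X l) ⊤] g) :
    IndepFun f g μ :=
  indep_of_indep_of_le_left (indep_of_indep_of_le_right (h.dep i j hi hij) hg.comap_le) hf.comap_le

/-- Any function of three of the variables is integrable. -/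
theorem integrable_comp [IsProbabilityMeasure μ] (h : BoundedOneDependent μ X n b) {E : Type*} [NormedAddCommGroup E]
    [SecondCountableTopology E] [MeasurableSpace E] [BorelSpace E] (G : ℕ → ℕ → ℕ → E)
    {i j k : ℤ} (hi : i ≤ n) (hj : j ≤ n) (hk : k ≤ n) :
    Integrable (fun ω => G (X i ω) (X j ω) (X k ω)) μ := by
  have hm : Measurable (fun ω => G (X i ω) (X j ω) (X k ω)) :=
    (Measurable.of_discrete (f := fun x : ℕ × ℕ × ℕ => G x.1 x.2.1 x.2.2)).comp
      ((h.measurable hi).prodMk ((h.measurable hj).prodMk (h.measurable hk)))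
  refine Integrable.of_bound hm.aestronglyMeasurable
    (∑ x ∈ Finset.range (b + 1) ×ˢ Finset.range (b + 1) ×ˢ Finset.range (b + 1),
      ‖G x.1 x.2.1 x.2.2‖) ?_
  filter_upwards [h.bdd] with ω hω
  refine Finset.single_le_sum (f := fun x : ℕ × ℕ × ℕ => ‖G x.1 x.2.1 x.2.2‖)
    (fun _ _ => norm_nonneg _) (a := (X i ω, X j ω, X k ω)) ?_
  simp only [Finset.mem_product, Finset.mem_range, Nat.lt_succ_iff]
  exact ⟨hω i hi, hω j hj, hω k hk⟩

/-! ### The recurrence for the generating function -/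

section Generating

variable {s : ℂ}

theorem expSubOne_eq_zero (h : BoundedOneDependent μ X n b) {k : ℤ} (hk : k ≤ 0) (ω : Ω) :
    expSubOne X s k ω = 0 := by
  simp [expSubOne, h.eq_zero k hk]

theorem expPartialSum_eq (h : BoundedOneDependent μ X n b) (j : ℤ) (ω : Ω) :
    expPartialSum X s j ω = expPartialSum X s (j - 1) ω * (1 + expSubOne X s j ω) := by
  rcases le_or_gt j 0 with hj | hj
  · rw [expPartialSum_of_nonpos hj, expPartialSum_of_nonpos (by omega), h.expSubOne_eq_zero hj]
    simp
  · have e : Finset.Icc 1 j = insert j (Finset.Icc 1 (j - 1)) := by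
      ext i
      simp only [Finset.mem_Icc, Finset.mem_insert]
      omega
    rw [expPartialSum, expPartialSum, expSubOne, e, Finset.sum_insert (by simp)]
    rw [add_sub_cancel, ← Complex.exp_add]
    congr 1
    push_cast
    ring

theorem measurable_block (h : BoundedOneDependent μ X n b) {k : ℤ} (hk : k ≤ n) (m : ℕ) :
    Measurable (expBlock X s k m) :=
  measurable_expBlock (fun i _ => h.measurable (by omega)) s

theorem measurable_partialSum (h : BoundedOneDependent μ X n b) {j : ℤ} (hj : j ≤ n) :
    Measurable (expPartialSum X s j) :=
  measurable_expPartialSum (fun i hi => h.measurable (by rw [Finset.mem_Icc] at hi; omega)) s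

theorem norm_block_le (h : BoundedOneDependent μ X n b) {k : ℤ} (hk : k ≤ n) (m : ℕ) :
    ∀ᵐ ω ∂μ, ‖expBlock X s k m ω‖ ≤ (Real.exp (|s.re| * b) + 1) ^ m := by
  filter_upwards [h.bdd] with ω hω
  rw [expBlock, norm_prod]
  calc _ ≤ ∏ i ∈ Finset.range m, (Real.exp (|s.re| * b) + 1) :=
        Finset.prod_le_prod (fun _ _ => norm_nonneg _)
          fun i _ => norm_expSubOne_le_const le_rfl (hω _ (by omega))
    _ = _ := by simp

theorem norm_partialSum_le (h : BoundedOneDependent μ X n b) {j : ℤ} (hj : j ≤ n) :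
    ∀ᵐ ω ∂μ, ‖expPartialSum X s j ω‖ ≤ Real.exp (|s.re| * (n * b)) := by
  filter_upwards [h.bdd] with ω hω
  rw [expPartialSum, Complex.norm_exp, Real.exp_le_exp]
  have h1 : ∑ i ∈ Finset.Icc 1 j, X i ω ≤ n * b := by
    calc _ ≤ ∑ i ∈ Finset.Icc 1 j, b :=
          Finset.sum_le_sum fun i hi => hω i (by rw [Finset.mem_Icc] at hi; omega)
      _ = j.toNat * b := by simp
      _ ≤ n * b := by gcongr; omega
  have h2 : ((∑ i ∈ Finset.Icc 1 j, X i ω : ℕ) : ℝ) ≤ n * b := by exact_mod_cast h1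
  have h3 : (s * (∑ i ∈ Finset.Icc 1 j, X i ω : ℕ)).re =
      s.re * (∑ i ∈ Finset.Icc 1 j, X i ω : ℕ) := Complex.re_mul_ofReal s _
  rw [h3]
  calc _ ≤ |s.re| * (∑ i ∈ Finset.Icc 1 j, X i ω : ℕ) := by gcongr; exact le_abs_self _
    _ ≤ _ := by gcongr

theorem integrable_block [IsProbabilityMeasure μ] (h : BoundedOneDependent μ X n b) {k : ℤ} (hk : k ≤ n) (m : ℕ) :
    Integrable (expBlock X s k m) μ :=
  Integrable.of_bound (h.measurable_block hk m).aestronglyMeasurable _ (h.norm_block_le hk m)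

theorem integrable_mul_block [IsProbabilityMeasure μ] (h : BoundedOneDependent μ X n b) {j k : ℤ} (hj : j ≤ n)
    (hk : k ≤ n) (m : ℕ) :
    Integrable (fun ω => expPartialSum X s j ω * expBlock X s k m ω) μ :=
  (h.integrable_block hk m).bdd_mul (h.measurable_partialSum hj).aestronglyMeasurable
    (h.norm_partialSum_le hj)

/-- The block occupies the indices `k-m+1, …, k`, so `j ≤ k-m-1` leaves the gap that 1-dependence
requires. For `j ≤ 0`, not covered by 1-dependence, the first factor is the constant `1`. -/
theorem integral_mul_block [IsProbabilityMeasure μ] (h : BoundedOneDependent μ X n b) {j k : ℤ} (hk : k ≤ n) {m : ℕ}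
    (hj : j ≤ k - m - 1) :
    ∫ ω, expPartialSum X s j ω * expBlock X s k m ω ∂μ =
      (∫ ω, expPartialSum X s j ω ∂μ) * ∫ ω, expBlock X s k m ω ∂μ := by
  rcases le_or_gt j 0 with h0 | h0
  · simp [expPartialSum_of_nonpos h0]
  · refine IndepFun.integral_fun_mul_eq_mul_integral ?_
      (h.measurable_partialSum (by omega)).aestronglyMeasurable
      (h.measurable_block hk m).aestronglyMeasurable
    refine h.indepFun (i := j) (j := k - m + 1) (by omega) (by omega) ?_ ?_
    · exact measurable_expPartialSum (fun i hi => measurable_iSup_comap (S := Set.Icc 1 j) (Finset.mem_Icc.1 hi)) s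
    · exact measurable_expBlock (fun i hi => measurable_iSup_comap (S := Set.Icc (k - m + 1) n)
        ⟨by omega, by omega⟩) s

theorem integral_norm_mul_norm_block [IsProbabilityMeasure μ] (h : BoundedOneDependent μ X n b) {j k : ℤ} (hk : k ≤ n)
    {m : ℕ} (hj : j ≤ k - m - 1) :
    ∫ ω, ‖expSubOne X s j ω‖ * ‖expBlock X s k m ω‖ ∂μ =
      (∫ ω, ‖expSubOne X s j ω‖ ∂μ) * ∫ ω, ‖expBlock X s k m ω‖ ∂μ := by
  rcases le_or_gt j 0 with h0 | h0
  · simp [h.expSubOne_eq_zero h0]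
  · have hind : IndepFun (expSubOne X s j) (expBlock X s k m) μ := by
      refine h.indepFun (i := j) (j := k - m + 1) (by omega) (by omega) ?_ ?_
      · exact measurable_expSubOne (measurable_iSup_comap (S := Set.Icc 1 j) ⟨by omega, by omega⟩) s
      · exact measurable_expBlock (fun i hi => measurable_iSup_comap (S := Set.Icc (k - m + 1) n)
        ⟨by omega, by omega⟩) s
    exact (hind.comp measurable_norm measurable_norm).integral_fun_mul_eq_mul_integral
      (measurable_expSubOne (h.measurable (by omega)) s).norm.aestronglyMeasurable
      (h.measurable_block hk m).norm.aestronglyMeasurable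

/-- In `E e^{s(⋯+X_{k-m})} Y_k⋯Y_{k-m+1}` the last exponential factor is written as `1 + Y_{k-m}`.
The `1` opens a gap and yields a product of means; `Y_{k-m}` lengthens the block. The process stops
because a block reaching a nonpositive index vanishes, so every `L ≥ n` is admissible. -/
theorem integral_expPartialSum_rec [IsProbabilityMeasure μ] (h : BoundedOneDependent μ X n b) {k : ℤ} (hk : k ≤ n)
    {L : ℕ} (hL : n ≤ L) :
    ∫ ω, expPartialSum X s k ω ∂μ = ∫ ω, expPartialSum X s (k - 1) ω ∂μ +
      ∑ i ∈ Finset.range L, (∫ ω, expPartialSum X s (k - 2 - i) ω ∂μ) *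
        ∫ ω, expBlock X s k (i + 1) ω ∂μ := by
  have hU : ∀ m : ℕ, ∫ ω, expPartialSum X s (k - m) ω * expBlock X s k m ω ∂μ =
      (∫ ω, expPartialSum X s (k - m - 1) ω ∂μ) * (∫ ω, expBlock X s k m ω ∂μ) +
        ∫ ω, expPartialSum X s (k - (m + 1 : ℕ)) ω * expBlock X s k (m + 1) ω ∂μ := by
    intro m
    rw [← h.integral_mul_block hk (by omega), ← integral_add]
    · refine integral_congr_ae (Filter.Eventually.of_forall fun ω => ?_)
      have e : k - ((m + 1 : ℕ) : ℤ) = k - m - 1 := by push_cast; ring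
      simp only [e]
      rw [expBlock_succ, h.expPartialSum_eq (k - m)]
      ring
    · exact h.integrable_mul_block (by omega) hk _
    · exact h.integrable_mul_block (by omega) hk _
  have hsum : ∀ L : ℕ, ∫ ω, expPartialSum X s (k - 1) ω * expBlock X s k 1 ω ∂μ =
      ∑ i ∈ Finset.range L, (∫ ω, expPartialSum X s (k - 2 - i) ω ∂μ) *
        (∫ ω, expBlock X s k (i + 1) ω ∂μ) +
      ∫ ω, expPartialSum X s (k - (L + 1 : ℕ)) ω * expBlock X s k (L + 1) ω ∂μ := by
    intro L
    induction L with
    | zero => simp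
    | succ L ih =>
      rw [ih, Finset.sum_range_succ, hU (L + 1), ← add_assoc]
      have e : k - ((L + 1 : ℕ) : ℤ) - 1 = k - 2 - L := by push_cast; ring
      rw [e]
  have h0 := hU 0
  have hz : ∫ ω, expPartialSum X s (k - (L + 1 : ℕ)) ω * expBlock X s k (L + 1) ω ∂μ = 0 := by
    refine integral_eq_zero_of_ae (Filter.Eventually.of_forall fun ω => ?_)
    simp only [Pi.zero_apply]
    rw [expBlock_succ, h.expSubOne_eq_zero (by omega), mul_zero, mul_zero]
  have h1 := hsum L
  rw [hz, add_zero] at h1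
  rw [← h1]
  simpa [expBlock] using h0

/-- Everything follows from two pointwise bounds, `‖Y_i‖ ≤ W + 1 ≤ 2.01` and `‖Y_i‖ ≤ ζ X_i`,
together with 1-dependence for the decay in the block length. -/
theorem perturbedRecurrence [IsProbabilityMeasure μ] (h : BoundedOneDependent μ X n b) {W : ℝ}
    (hW : Real.exp (|s.re| * b) ≤ W) (hW' : W ≤ 1.002) (hb : 1 ≤ b)
    (hnu : ∀ k ≤ (n : ℤ), nu μ X 1 k ≤ 1 / 100) :
    PerturbedRecurrence n (fun j => ∫ ω, expPartialSum X s j ω ∂μ)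
      (fun k m => ∫ ω, expBlock X s k m ω ∂μ) (fun k m => ∫ ω, ‖expBlock X s k m ω‖ ∂μ)
      (fun k => nu μ X 1 k) (fun k => mix μ X k)
      (fun k => ∫ ω, (X (k - 2) ω : ℝ) * X (k - 1) ω * X k ω ∂μ)
      (W * ‖Complex.exp s - 1‖) := by
  set ζ := W * ‖Complex.exp s - 1‖ with hζ
  have hW1 : 1 ≤ W := one_le_of_exp_le hW
  have hζ0 : 0 ≤ ζ := by positivity
  have hζ1 : ζ ≤ 2.01 := by
    have h1 : ‖Complex.exp s‖ ≤ W := by simpa using norm_exp_pow_le hW hb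
    have h2 : ‖Complex.exp s - 1‖ ≤ 2.002 := by
      refine (norm_sub_le _ _).trans ?_
      rw [norm_one]
      norm_num at *
      linarith
    calc ζ ≤ 1.002 * 2.002 := mul_le_mul hW' h2 (norm_nonneg _) (by norm_num)
      _ ≤ 2.01 := by norm_num
  have hc : ∀ᵐ ω ∂μ, ∀ i ≤ (n : ℤ), ‖expSubOne X s i ω‖ ≤ 2.01 := by
    filter_upwards [h.bdd] with ω hω i hi
    have := norm_expSubOne_le_const hW (hω i hi)
    norm_num at *
    linarith
  have hl : ∀ᵐ ω ∂μ, ∀ i ≤ (n : ℤ), ‖expSubOne X s i ω‖ ≤ ζ * X i ω := by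
    filter_upwards [h.bdd] with ω hω i hi
    exact norm_expSubOne_le hW (hω i hi)
  have hint : ∀ {k : ℤ}, k ≤ n → ∀ m, Integrable (fun ω => ‖expBlock X s k m ω‖) μ :=
    fun hk m => (h.integrable_block hk m).norm
  have hnu1 : ∀ k, nu μ X 1 k = ∫ ω, (X k ω : ℝ) ∂μ := by
    intro k
    simp [nu]
  have hone : ∀ k ≤ (n : ℤ), ∫ ω, ‖expSubOne X s k ω‖ ∂μ ≤ ζ * nu μ X 1 k := by
    intro k hk
    rw [hnu1, ← integral_const_mul]
    refine integral_mono_ae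
      (h.integrable_comp (fun x _ _ => ‖Complex.exp (s * x) - 1‖) hk hk hk)
      (h.integrable_comp (fun x _ _ => ζ * (x : ℝ)) hk hk hk) ?_
    filter_upwards [hl] with ω hω
    exact hω k hk
  have hnn : ∀ k, 0 ≤ nu μ X 1 k := fun k => integral_nonneg fun ω => by positivity
  have htri : ∀ k ≤ (n : ℤ),
      Integrable (fun ω => (X (k - 2) ω : ℝ) * X (k - 1) ω * X k ω) μ := fun k hk =>
    h.integrable_comp (fun x y z => (x : ℝ) * y * z) (by omega) (by omega) hk
  have hmix : ∀ k ≤ (n : ℤ), Integrable (fun ω => (X (k - 1) ω : ℝ) * X k ω) μ := fun k hk =>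
    h.integrable_comp (fun x y _ => (x : ℝ) * y) (by omega) hk hk
  refine
    { init := fun k hk => ?_
      rec_eq := fun k hk L hL => h.integral_expPartialSum_rec hk hL
      norm_le := fun k _ i => norm_integral_le_integral_norm _
      step := fun k hk i _ => ?_
      le_one := fun k hk => ?_
      le_two := fun k hk => ?_
      le_two' := fun k hk => ?_
      le_three := fun k hk => ?_
      le_three' := fun k hk => ?_
      le_four := fun k hk => ?_
      a_nonneg := fun k _ => hnn k
      a_le := hnu
      b_nonneg := fun k _ => integral_nonneg fun ω => by positivity
      c_nonneg := fun k _ => integral_nonneg fun ω => by positivity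
      zeta_nonneg := hζ0
      zeta_le := hζ1 }
  · simp [expPartialSum_of_nonpos hk]
  -- Bounding the factor at `k - i` by `2.01` opens a gap: the factor at `k - i - 1` is then
  -- independent of the block of length `i` and has mean norm at most `2.01/100`. The product is
  -- below `0.0405`.
  · have h1 : ∫ ω, ‖expBlock X s k (i + 2) ω‖ ∂μ ≤
        ∫ ω, 2.01 * (‖expSubOne X s (k - i - 1) ω‖ * ‖expBlock X s k i ω‖) ∂μ := by
      refine integral_mono_ae (hint hk _) ?_ ?_
      · refine Integrable.const_mul ?_ _
        refine (hint hk i).bdd_mul (c := 2.01)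
          (measurable_expSubOne (h.measurable (by omega)) s).norm.aestronglyMeasurable ?_
        filter_upwards [hc] with ω hω
        rw [norm_norm]
        exact hω _ (by omega)
      · filter_upwards [hc] with ω hω
        have e : k - ((i + 1 : ℕ) : ℤ) = k - i - 1 := by push_cast; ring
        rw [expBlock_succ, expBlock_succ, norm_mul, norm_mul, e]
        have h2 := hω (k - i) (by omega)
        have h3 : 0 ≤ ‖expSubOne X s (k - i - 1) ω‖ * ‖expBlock X s k i ω‖ := by positivity
        nlinarith
    rw [integral_const_mul, h.integral_norm_mul_norm_block hk (by omega)] at h1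
    refine h1.trans ?_
    have h4 := hone (k - i - 1) (by omega)
    have h5 : ζ * nu μ X 1 (k - i - 1) ≤ 2.01 * (1 / 100) :=
      mul_le_mul hζ1 (hnu _ (by omega)) (hnn _) (by norm_num)
    have h6 : 0 ≤ ∫ ω, ‖expBlock X s k i ω‖ ∂μ := integral_nonneg fun ω => norm_nonneg _
    have h7 : ∫ ω, ‖expSubOne X s (k - i - 1) ω‖ ∂μ ≤ 0.0201 := by
      norm_num at *
      linarith
    have h8 := mul_le_mul_of_nonneg_right h7 h6
    norm_num at *
    linarith
  · simpa [expBlock] using hone k hk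
  · refine le_trans ?_ (mul_le_mul_of_nonneg_left (hone k hk) (by norm_num))
    rw [← integral_const_mul]
    refine integral_mono_ae (hint hk _)
      (h.integrable_comp (fun x _ _ => 2.01 * ‖Complex.exp (s * x) - 1‖) hk hk hk) ?_
    filter_upwards [hc] with ω hω
    have h2 := hω (k - 1) (by omega)
    simp only [expBlock, Finset.prod_range_succ, Finset.prod_range_zero, one_mul, norm_mul,
      Nat.cast_zero, Nat.cast_one, sub_zero]
    rw [mul_comm]
    gcongr
  · rw [mix, ← integral_const_mul]
    refine integral_mono_ae (hint hk _) ((hmix k hk).const_mul _) ?_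
    filter_upwards [hl] with ω hω
    have h1 := hω k hk
    have h2 := hω (k - 1) (by omega)
    simp only [expBlock, Finset.prod_range_succ, Finset.prod_range_zero, one_mul, norm_mul,
      Nat.cast_zero, Nat.cast_one, sub_zero]
    calc _ ≤ (ζ * X k ω) * (ζ * X (k - 1) ω) := by gcongr
      _ = _ := by ring
  · rw [mix, ← integral_const_mul, ← integral_const_mul]
    refine integral_mono_ae (hint hk _) (((hmix k hk).const_mul _).const_mul _) ?_
    filter_upwards [hl, hc] with ω hω hω'
    have h1 := hω k hk
    have h2 := hω (k - 1) (by omega)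
    have h3 := hω' (k - 2) (by omega)
    simp only [expBlock, Finset.prod_range_succ, Finset.prod_range_zero, one_mul, norm_mul,
      Nat.cast_zero, Nat.cast_one, sub_zero, Nat.cast_ofNat]
    calc _ ≤ (ζ * X k ω) * (ζ * X (k - 1) ω) * 2.01 := by gcongr
      _ = _ := by ring
  · rw [← integral_const_mul]
    refine integral_mono_ae (hint hk _) ((htri k hk).const_mul _) ?_
    filter_upwards [hl] with ω hω
    have h1 := hω k hk
    have h2 := hω (k - 1) (by omega)
    have h3 := hω (k - 2) (by omega)
    simp only [expBlock, Finset.prod_range_succ, Finset.prod_range_zero, one_mul, norm_mul,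
      Nat.cast_zero, Nat.cast_one, sub_zero, Nat.cast_ofNat]
    calc _ ≤ (ζ * X k ω) * (ζ * X (k - 1) ω) * (ζ * X (k - 2) ω) := by gcongr
      _ = _ := by ring
  · rw [← integral_const_mul, ← integral_const_mul]
    refine integral_mono_ae (hint hk _) (((htri k hk).const_mul _).const_mul _) ?_
    filter_upwards [hl, hc] with ω hω hω'
    have h1 := hω k hk
    have h2 := hω (k - 1) (by omega)
    have h3 := hω (k - 2) (by omega)
    have h4 := hω' (k - 3) (by omega)
    simp only [expBlock, Finset.prod_range_succ, Finset.prod_range_zero, one_mul, norm_mul,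
      Nat.cast_zero, Nat.cast_one, sub_zero, Nat.cast_ofNat]
    calc _ ≤ (ζ * X k ω) * (ζ * X (k - 1) ω) * (ζ * X (k - 2) ω) * 2.01 := by gcongr
      _ = _ := by ring

end Generating

end BoundedOneDependent

/-! ### Moments of one-dependent sums and expansion of the generating function -/

/-- Moves powers of `ν₁(k-1)` to the index `k`, at which `R0` and `R1` contain them. -/
theorem sum_Icc_pred_le {f : ℤ → ℝ} (h0 : f 0 = 0) (hf : ∀ k, 0 ≤ f k) (n : ℕ) :
    ∑ k ∈ Finset.Icc (1 : ℤ) n, f (k - 1) ≤ ∑ k ∈ Finset.Icc (1 : ℤ) n, f k := by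
  rw [sum_Icc_one_int (fun k => f (k - 1)), sum_Icc_one_int f]
  simp only [add_sub_cancel_right]
  have h1 := Finset.sum_range_succ (fun i : ℕ => f i) n
  have h2 := Finset.sum_range_succ' (fun i : ℕ => f i) n
  push_cast at h2
  rw [h0] at h2
  linarith [hf n]

theorem partialSum_cast {Ω : Type*} (X : ℤ → Ω → ℕ) (n : ℕ) (ω : Ω) :
    (partialSum X n ω : ℝ) = ∑ i ∈ Finset.range n, (X (i + 1) ω : ℝ) := by
  rw [partialSum, sum_Icc_one_int (fun k => X k ω)]
  push_cast
  rfl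

/-- `E X_{k-2} X_{k-1} X_k`. -/
noncomputable def triple {Ω : Type*} [MeasurableSpace Ω] (μ : Measure Ω) (X : ℤ → Ω → ℕ)
    (k : ℤ) : ℝ :=
  ∫ ω, (X (k - 2) ω : ℝ) * X (k - 1) ω * X k ω ∂μ

namespace BoundedOneDependent

variable {Ω : Type*} [MeasurableSpace Ω] {μ : Measure Ω} {X : ℤ → Ω → ℕ} {n b : ℕ}

theorem nu_nonneg (j : ℕ) (k : ℤ) : 0 ≤ nu μ X j k := integral_nonneg fun ω => by positivity

theorem mix_nonneg (k : ℤ) : 0 ≤ mix μ X k := integral_nonneg fun ω => by positivity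

theorem triple_nonneg (k : ℤ) : 0 ≤ triple μ X k := integral_nonneg fun ω => by positivity

theorem nu_one (k : ℤ) : nu μ X 1 k = ∫ ω, (X k ω : ℝ) ∂μ := by simp [nu]

theorem nu_two (k : ℤ) : nu μ X 2 k = ∫ ω, (X k ω : ℝ) * ((X k ω : ℝ) - 1) ∂μ := by
  simp only [nu, Nat.cast_descFactorial_two]

theorem nu_of_nonpos (h : BoundedOneDependent μ X n b) {j : ℕ} (hj : j ≠ 0) {k : ℤ}
    (hk : k ≤ 0) : nu μ X j k = 0 := by
  have : ∀ ω, (X k ω).descFactorial j = 0 := fun ω => by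
    rw [h.eq_zero k hk, Nat.descFactorial_eq_zero_iff_lt]
    omega
  simp [nu, this]

theorem memLp_sum [IsProbabilityMeasure μ] (h : BoundedOneDependent μ X n b) {N : ℕ}
    (hN : N ≤ n) : MemLp (fun ω => ∑ i ∈ Finset.range N, (X (i + 1) ω : ℝ)) 2 μ := by
  have hm : Measurable (fun ω => ∑ i ∈ Finset.range N, (X (i + 1) ω : ℝ)) :=
    Finset.measurable_fun_sum _ fun i hi =>
      Measurable.of_discrete.comp (h.measurable (by rw [Finset.mem_range] at hi; omega))
  refine MemLp.of_bound hm.aestronglyMeasurable (N * b) ?_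
  filter_upwards [h.bdd] with ω hω
  rw [Real.norm_of_nonneg (by positivity)]
  calc _ ≤ ∑ i ∈ Finset.range N, (b : ℝ) := Finset.sum_le_sum fun i hi => by
        rw [Finset.mem_range] at hi
        exact_mod_cast hω _ (by omega)
    _ = _ := by simp

theorem memLp_two [IsProbabilityMeasure μ] (h : BoundedOneDependent μ X n b) {k : ℤ}
    (hk : k ≤ n) : MemLp (fun ω => (X k ω : ℝ)) 2 μ := by
  refine MemLp.of_bound ((Measurable.of_discrete (f := fun x : ℕ => (x : ℝ))).comp
    (h.measurable hk)).aestronglyMeasurable b ?_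
  filter_upwards [h.bdd] with ω hω
  simpa using hω k hk

/-- Only the last summand is adjacent to `X (N+1)`; the others are independent of it. -/
theorem covariance_sum_eq [IsProbabilityMeasure μ] (h : BoundedOneDependent μ X n b) {N : ℕ}
    (hN : N + 1 ≤ n) :
    covariance (fun ω => ∑ i ∈ Finset.range N, (X (i + 1) ω : ℝ))
      (fun ω => (X ((N : ℤ) + 1) ω : ℝ)) μ =
    covariance (fun ω => (X N ω : ℝ)) (fun ω => (X ((N : ℤ) + 1) ω : ℝ)) μ := by
  cases N with
  | zero =>
    congr 1
    funext ω
    simp [h.eq_zero]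
  | succ M =>
    have hXm := h.memLp_two (k := ((M + 1 : ℕ) : ℤ) + 1) (by omega)
    have hXM := h.memLp_two (k := ((M + 1 : ℕ) : ℤ)) (by omega)
    have hS := h.memLp_sum (N := M) (by omega)
    have e : (fun ω => ∑ i ∈ Finset.range (M + 1), (X (i + 1) ω : ℝ)) =
        (fun ω => ∑ i ∈ Finset.range M, (X (i + 1) ω : ℝ)) +
          fun ω => (X ((M + 1 : ℕ) : ℤ) ω : ℝ) := by
      funext ω
      rw [Finset.sum_range_succ]
      simp
    rw [e, covariance_add_left hS hXM hXm]
    have hz : covariance (fun ω => ∑ i ∈ Finset.range M, (X (i + 1) ω : ℝ))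
        (fun ω => (X (((M + 1 : ℕ) : ℤ) + 1) ω : ℝ)) μ = 0 := by
      rcases Nat.eq_zero_or_pos M with hM | hM
      · subst hM
        simp [covariance]
      · refine IndepFun.covariance_eq_zero ?_ hS hXm
        refine h.indepFun (i := M) (j := M + 2) (by omega) (by omega) ?_ ?_
        · refine Finset.measurable_fun_sum _ fun i hi => ?_
          rw [Finset.mem_range] at hi
          exact Measurable.of_discrete.comp
            (measurable_iSup_comap (S := Set.Icc 1 (M : ℤ)) ⟨by omega, by omega⟩)
        · exact Measurable.of_discrete.comp
            (measurable_iSup_comap (S := Set.Icc ((M : ℤ) + 2) n) ⟨by push_cast; omega, by omega⟩)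
    rw [hz, zero_add]

theorem variance_sum_eq [IsProbabilityMeasure μ] (h : BoundedOneDependent μ X n b) {N : ℕ}
    (hN : N ≤ n) :
    variance (fun ω => ∑ i ∈ Finset.range N, (X (i + 1) ω : ℝ)) μ =
      ∑ i ∈ Finset.range N, (variance (fun ω => (X ((i : ℤ) + 1) ω : ℝ)) μ +
        2 * covariance (fun ω => (X i ω : ℝ)) (fun ω => (X ((i : ℤ) + 1) ω : ℝ)) μ) := by
  induction N with
  | zero => simp [variance_zero, ← Pi.zero_def]
  | succ N ih =>
    have e : (fun ω => ∑ i ∈ Finset.range (N + 1), (X (i + 1) ω : ℝ)) =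
        (fun ω => ∑ i ∈ Finset.range N, (X (i + 1) ω : ℝ)) +
          fun ω => (X ((N : ℤ) + 1) ω : ℝ) := by
      funext ω
      rw [Finset.sum_range_succ]
      simp
    rw [Finset.sum_range_succ, ← ih (by omega), e,
      variance_add (h.memLp_sum (by omega)) (h.memLp_two (by omega)), h.covariance_sum_eq hN]
    ring

theorem integrable_X [IsProbabilityMeasure μ] (h : BoundedOneDependent μ X n b) {k : ℤ}
    (hk : k ≤ n) : Integrable (fun ω => (X k ω : ℝ)) μ :=
  h.integrable_comp (fun x _ _ => (x : ℝ)) hk hk hk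

theorem lam_eq [IsProbabilityMeasure μ] (h : BoundedOneDependent μ X n b) :
    lam μ X n = ∑ k ∈ Finset.Icc (1 : ℤ) n, nu μ X 1 k := by
  rw [lam, sum_Icc_one_int]
  simp_rw [partialSum_cast, nu_one]
  refine integral_finsetSum _ fun i hi => h.integrable_X ?_
  rw [Finset.mem_range] at hi
  omega

theorem variance_eq [IsProbabilityMeasure μ] (h : BoundedOneDependent μ X n b) {k : ℤ}
    (hk : k ≤ n) :
    variance (fun ω => (X k ω : ℝ)) μ = nu μ X 2 k + nu μ X 1 k - nu μ X 1 k ^ 2 := by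
  have hi : Integrable (fun ω => (X k ω : ℝ) * ((X k ω : ℝ) - 1)) μ :=
    h.integrable_comp (fun x _ _ => (x : ℝ) * ((x : ℝ) - 1)) hk hk hk
  rw [variance_eq_sub (h.memLp_two hk), nu_one, nu_two, ← integral_add hi (h.integrable_X hk)]
  congr 1
  refine integral_congr_ae (Filter.Eventually.of_forall fun ω => ?_)
  simp only [Pi.pow_apply]
  ring

theorem covariance_eq [IsProbabilityMeasure μ] (h : BoundedOneDependent μ X n b) {k : ℤ}
    (hk : k ≤ n) :
    covariance (fun ω => (X (k - 1) ω : ℝ)) (fun ω => (X k ω : ℝ)) μ =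
      mix μ X k - nu μ X 1 (k - 1) * nu μ X 1 k := by
  rw [covariance_eq_sub (h.memLp_two (by omega)) (h.memLp_two hk), mix, nu_one, nu_one]
  rfl

/-- By 1-dependence only variances and neighbouring covariances survive in `Var S_n`. In `Var X_k =
ν₂ + ν₁ - ν₁²` the middle term sums to `λ` and cancels. -/
theorem Gam2_eq [IsProbabilityMeasure μ] (h : BoundedOneDependent μ X n b) :
    Gam2 μ X n = ∑ k ∈ Finset.Icc (1 : ℤ) n, (nu μ X 2 k / 2 - nu μ X 1 k ^ 2 / 2 +
      (mix μ X k - nu μ X 1 (k - 1) * nu μ X 1 k)) := by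
  have e : (fun ω => (partialSum X n ω : ℝ)) =
      fun ω => ∑ i ∈ Finset.range n, (X (i + 1) ω : ℝ) := funext (partialSum_cast X n)
  rw [Gam2, h.lam_eq, e, h.variance_sum_eq le_rfl, sum_Icc_one_int, sum_Icc_one_int,
    ← Finset.sum_sub_distrib, Finset.sum_div]
  refine Finset.sum_congr rfl fun i hi => ?_
  rw [Finset.mem_range] at hi
  have hc := h.covariance_eq (k := (i : ℤ) + 1) (by omega)
  rw [h.variance_eq (by omega)]
  rw [add_sub_cancel_right] at hc ⊢
  rw [hc]
  ring

/-- The term `k = 1` is zero because `X 0 = 0`. -/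
theorem abs_covariance_sum [IsProbabilityMeasure μ] (h : BoundedOneDependent μ X n b) :
    ∑ k ∈ Finset.Icc (1 : ℤ) n, |mix μ X k - nu μ X 1 (k - 1) * nu μ X 1 k| =
      ∑ k ∈ Finset.Icc (2 : ℤ) n,
        |covariance (fun ω => (X (k - 1) ω : ℝ)) (fun ω => (X k ω : ℝ)) μ| := by
  symm
  have hsub : Finset.Icc (2 : ℤ) n ⊆ Finset.Icc (1 : ℤ) n :=
    Finset.Icc_subset_Icc (by norm_num) le_rfl
  rw [← Finset.sum_subset hsub (f := fun k => |mix μ X k - nu μ X 1 (k - 1) * nu μ X 1 k|)]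
  · refine Finset.sum_congr rfl fun k hk => ?_
    rw [Finset.mem_Icc] at hk
    rw [h.covariance_eq hk.2]
  · intro k hk hk'
    rw [Finset.mem_Icc] at hk hk'
    have : k - 1 ≤ 0 := by omega
    simp [mix, h.eq_zero _ this, h.nu_of_nonpos one_ne_zero this]

/-! ### Expansion of the block means in terms of moments -/

section Expansion

variable [IsProbabilityMeasure μ] {s : ℂ} {W : ℝ}

theorem norm_integral_block_one_sub_le (h : BoundedOneDependent μ X n b)
    (hW : Real.exp (|s.re| * b) ≤ W) {k : ℤ} (hk : k ≤ n) :
    ‖∫ ω, expBlock X s k 1 ω ∂μ - (Complex.exp s - 1) * nu μ X 1 k‖ ≤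
      (W * ‖Complex.exp s - 1‖) ^ 2 * (nu μ X 2 k / 2) := by
  have e : (Complex.exp s - 1) * nu μ X 1 k = ∫ ω, (Complex.exp s - 1) * (X k ω : ℂ) ∂μ := by
    rw [integral_const_mul, nu_one, ← integral_complex_ofReal]
    simp
  have e2 : (W * ‖Complex.exp s - 1‖) ^ 2 * (nu μ X 2 k / 2) =
      ∫ ω, (W * ‖Complex.exp s - 1‖) ^ 2 * ((X k ω).descFactorial 2 / 2 : ℝ) ∂μ := by
    rw [integral_const_mul, integral_div, nu]
  rw [e, e2, ← integral_sub (h.integrable_block hk 1)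
    (h.integrable_comp (fun x _ _ => (Complex.exp s - 1) * (x : ℂ)) hk hk hk)]
  refine norm_integral_le_of_norm_le (h.integrable_comp (fun x _ _ =>
    (W * ‖Complex.exp s - 1‖) ^ 2 * (x.descFactorial 2 / 2 : ℝ)) hk hk hk) ?_
  filter_upwards [h.bdd] with ω hω
  simpa [expBlock] using norm_expSubOne_sub_le hW (hω k hk)

theorem norm_integral_block_one_sub_sub_le (h : BoundedOneDependent μ X n b)
    (hW : Real.exp (|s.re| * b) ≤ W) {k : ℤ} (hk : k ≤ n) :
    ‖∫ ω, expBlock X s k 1 ω ∂μ - ((Complex.exp s - 1) * nu μ X 1 k +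
        (Complex.exp s - 1) ^ 2 * (nu μ X 2 k / 2))‖ ≤
      (W * ‖Complex.exp s - 1‖) ^ 3 * (nu μ X 3 k / 6) := by
  have i1 : Integrable (fun ω => (Complex.exp s - 1) * (X k ω : ℂ)) μ :=
    h.integrable_comp (fun x _ _ => (Complex.exp s - 1) * (x : ℂ)) hk hk hk
  have i2 : Integrable
      (fun ω => (Complex.exp s - 1) ^ 2 * ((X k ω).descFactorial 2 / 2 : ℂ)) μ :=
    h.integrable_comp (fun x _ _ => (Complex.exp s - 1) ^ 2 * (x.descFactorial 2 / 2 : ℂ)) hk hk hk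
  have e : (Complex.exp s - 1) * nu μ X 1 k + (Complex.exp s - 1) ^ 2 * (nu μ X 2 k / 2) =
      ∫ ω, ((Complex.exp s - 1) * (X k ω : ℂ) +
        (Complex.exp s - 1) ^ 2 * ((X k ω).descFactorial 2 / 2 : ℂ)) ∂μ := by
    rw [integral_add i1 i2, integral_const_mul, integral_const_mul, integral_div, nu_one, nu,
      ← integral_complex_ofReal, ← integral_complex_ofReal]
    simp
  have e2 : (W * ‖Complex.exp s - 1‖) ^ 3 * (nu μ X 3 k / 6) =
      ∫ ω, (W * ‖Complex.exp s - 1‖) ^ 3 * ((X k ω).descFactorial 3 / 6 : ℝ) ∂μ := by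
    rw [integral_const_mul, integral_div, nu]
  have i12 : Integrable (fun ω => (Complex.exp s - 1) * (X k ω : ℂ) +
      (Complex.exp s - 1) ^ 2 * ((X k ω).descFactorial 2 / 2 : ℂ)) μ := i1.add i2
  rw [e, e2, ← integral_sub (h.integrable_block hk 1) i12]
  refine norm_integral_le_of_norm_le (h.integrable_comp (fun x _ _ =>
    (W * ‖Complex.exp s - 1‖) ^ 3 * (x.descFactorial 3 / 6 : ℝ)) hk hk hk) ?_
  filter_upwards [h.bdd] with ω hω
  simpa [expBlock, sub_sub] using norm_expSubOne_sub_sub_le hW (hω k hk)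

/-- `Y_k Y_{k-1} - z² X_k X_{k-1}` splits into two products, each with one second-order remainder;
their means are the mixed moments in `Ê⁺₂`. -/
theorem norm_integral_block_two_sub_le (h : BoundedOneDependent μ X n b)
    (hW : Real.exp (|s.re| * b) ≤ W) {k : ℤ} (hk : k ≤ n) :
    ‖∫ ω, expBlock X s k 2 ω ∂μ - (Complex.exp s - 1) ^ 2 * mix μ X k‖ ≤
      (W * ‖Complex.exp s - 1‖) ^ 3 *
        ((∫ ω, (X (k - 1) ω : ℝ) * ((X (k - 1) ω : ℝ) - 1) * X k ω ∂μ +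
          ∫ ω, (X (k - 1) ω : ℝ) * ((X k ω : ℝ) * ((X k ω : ℝ) - 1)) ∂μ) / 2) := by
  have hk1 : k - 1 ≤ (n : ℤ) := by omega
  set z := Complex.exp s - 1 with hz
  set ζ := W * ‖z‖ with hζ
  have hW1 : 1 ≤ W := one_le_of_exp_le hW
  have hzζ : ‖z‖ ≤ ζ := le_mul_of_one_le_left (norm_nonneg _) hW1
  have hζ0 : 0 ≤ ζ := (norm_nonneg _).trans hzζ
  have i0 : Integrable (fun ω => z ^ 2 * ((X (k - 1) ω : ℂ) * X k ω)) μ :=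
    h.integrable_comp (fun x y _ => z ^ 2 * ((x : ℂ) * y)) hk1 hk hk
  have i1 : Integrable (fun ω => (X (k - 1) ω : ℝ) * ((X (k - 1) ω : ℝ) - 1) * X k ω) μ :=
    h.integrable_comp (fun x y _ => (x : ℝ) * ((x : ℝ) - 1) * y) hk1 hk hk
  have i2 : Integrable (fun ω => (X (k - 1) ω : ℝ) * ((X k ω : ℝ) * ((X k ω : ℝ) - 1))) μ :=
    h.integrable_comp (fun x y _ => (x : ℝ) * ((y : ℝ) * ((y : ℝ) - 1))) hk1 hk hk
  have e : z ^ 2 * mix μ X k = ∫ ω, z ^ 2 * ((X (k - 1) ω : ℂ) * X k ω) ∂μ := by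
    rw [integral_const_mul, mix, ← integral_complex_ofReal]
    simp
  rw [e, ← integral_add i1 i2, ← integral_div, ← integral_const_mul,
    ← integral_sub (h.integrable_block hk 2) i0]
  refine norm_integral_le_of_norm_le (((i1.add i2).div_const 2).const_mul _) ?_
  filter_upwards [h.bdd] with ω hω
  have b0 := norm_expSubOne_sub_le hW (hω k hk)
  have b1 := norm_expSubOne_sub_le hW (hω _ hk1)
  have c1 := norm_expSubOne_le hW (hω _ hk1)
  rw [← hz, ← hζ, Nat.cast_descFactorial_two] at b0 b1
  rw [← hz, ← hζ] at c1
  have eb : expBlock X s k 2 ω - z ^ 2 * ((X (k - 1) ω : ℂ) * X k ω) =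
      (expSubOne X s k ω - z * X k ω) * expSubOne X s (k - 1) ω +
        z * X k ω * (expSubOne X s (k - 1) ω - z * X (k - 1) ω) := by
    simp only [expBlock, Finset.prod_range_succ, Finset.prod_range_zero, one_mul,
      Nat.cast_zero, Nat.cast_one, sub_zero]
    ring
  rw [eb]
  refine (norm_add_le _ _).trans ?_
  rw [norm_mul, norm_mul, norm_mul, Complex.norm_natCast]
  have d1 : ‖expSubOne X s k ω - z * X k ω‖ * ‖expSubOne X s (k - 1) ω‖ ≤
      (ζ ^ 2 * ((X k ω : ℝ) * ((X k ω : ℝ) - 1) / 2)) * (ζ * X (k - 1) ω) :=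
    mul_le_mul b0 c1 (norm_nonneg _) ((norm_nonneg _).trans b0)
  have d2 : ‖z‖ * (X k ω : ℝ) * ‖expSubOne X s (k - 1) ω - z * X (k - 1) ω‖ ≤
      (ζ * X k ω) * (ζ ^ 2 * ((X (k - 1) ω : ℝ) * ((X (k - 1) ω : ℝ) - 1) / 2)) :=
    mul_le_mul (by gcongr) b1 (norm_nonneg _) (by positivity)
  refine (add_le_add d1 d2).trans (le_of_eq ?_)
  ring

end Expansion

end BoundedOneDependent

/-! ### The logarithm of the generating function of the sum -/

namespace BoundedOneDependent

variable {Ω : Type*} [MeasurableSpace Ω] {μ : Measure Ω} {X : ℤ → Ω → ℕ} {n b : ℕ}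

/-- The hypotheses on the first two moments. -/
structure SmallMoments (μ : Measure Ω) (X : ℤ → Ω → ℕ) (n : ℕ) : Prop where
  nu_one_le : ∀ k ∈ Set.Icc (1 : ℤ) n, nu μ X 1 k ≤ 1 / 100
  sum_nu_two_le : ∑ k ∈ Finset.Icc (1 : ℤ) n, nu μ X 2 k ≤ lam μ X n / 20
  sum_cov_le : ∑ k ∈ Finset.Icc (2 : ℤ) n,
    |covariance (fun ω => (X (k - 1) ω : ℝ)) (fun ω => (X k ω : ℝ)) μ| ≤ lam μ X n / 20

theorem nu_one_le (h : BoundedOneDependent μ X n b) (hs : SmallMoments μ X n) {k : ℤ}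
    (hk : k ≤ n) : nu μ X 1 k ≤ 1 / 100 := by
  rcases le_or_gt k 0 with h0 | h0
  · rw [h.nu_of_nonpos one_ne_zero h0]
    norm_num
  · exact hs.nu_one_le k ⟨h0, hk⟩

theorem sum_mul_pred_le [IsProbabilityMeasure μ] (h : BoundedOneDependent μ X n b) (hs : SmallMoments μ X n) :
    ∑ k ∈ Finset.Icc (1 : ℤ) n, nu μ X 1 (k - 1) * nu μ X 1 k ≤ lam μ X n / 100 := by
  rw [h.lam_eq, Finset.sum_div]
  refine Finset.sum_le_sum fun k hk => ?_
  rw [Finset.mem_Icc] at hk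
  have h1 := h.nu_one_le hs (k := k - 1) (by omega)
  have h2 : 0 ≤ nu μ X 1 k := nu_nonneg 1 k
  nlinarith

/-- A mixed moment is a covariance plus a product of means: `0.06 = 1/20 + 1/100`. -/
theorem sum_mix_le [IsProbabilityMeasure μ] (h : BoundedOneDependent μ X n b) (hs : SmallMoments μ X n) :
    ∑ k ∈ Finset.Icc (1 : ℤ) n, mix μ X k ≤ 0.06 * lam μ X n := by
  have h1 := h.sum_mul_pred_le hs
  have h2 := hs.sum_cov_le
  rw [← h.abs_covariance_sum] at h2
  have h3 : ∑ k ∈ Finset.Icc (1 : ℤ) n, mix μ X k ≤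
      ∑ k ∈ Finset.Icc (1 : ℤ) n, (|mix μ X k - nu μ X 1 (k - 1) * nu μ X 1 k| +
        nu μ X 1 (k - 1) * nu μ X 1 k) := by
    refine Finset.sum_le_sum fun k _ => ?_
    linarith [le_abs_self (mix μ X k - nu μ X 1 (k - 1) * nu μ X 1 k)]
  rw [Finset.sum_add_distrib] at h3
  linarith

/-- The terms of `Gam2_eq` contribute `1/40 + 1/200 + 1/20 = 0.08`. This smallness keeps `Re(λz +
Γ₂z²)` under control and bounds the parameters of the translated, negative binomial and binomial
laws. -/
theorem abs_Gam2_le [IsProbabilityMeasure μ] (h : BoundedOneDependent μ X n b) (hs : SmallMoments μ X n) :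
    |Gam2 μ X n| ≤ 0.08 * lam μ X n := by
  rw [h.Gam2_eq]
  have h2 := hs.sum_cov_le
  have h3 := hs.sum_nu_two_le
  rw [← h.abs_covariance_sum] at h2
  have h4 : ∑ k ∈ Finset.Icc (1 : ℤ) n, nu μ X 1 k ^ 2 ≤ lam μ X n / 100 := by
    rw [h.lam_eq, Finset.sum_div]
    refine Finset.sum_le_sum fun k hk => ?_
    rw [Finset.mem_Icc] at hk
    have h1 := h.nu_one_le hs hk.2
    have h2 : 0 ≤ nu μ X 1 k := nu_nonneg 1 k
    nlinarith
  have h5 : ∀ k ∈ Finset.Icc (1 : ℤ) n,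
      |nu μ X 2 k / 2 - nu μ X 1 k ^ 2 / 2 + (mix μ X k - nu μ X 1 (k - 1) * nu μ X 1 k)| ≤
      nu μ X 2 k / 2 + nu μ X 1 k ^ 2 / 2 + |mix μ X k - nu μ X 1 (k - 1) * nu μ X 1 k| := by
    intro k _
    have h1 : 0 ≤ nu μ X 2 k := nu_nonneg 2 k
    refine (abs_add_le _ _).trans (add_le_add ?_ le_rfl)
    rw [abs_le]
    constructor <;> nlinarith [sq_nonneg (nu μ X 1 k)]
  refine (Finset.abs_sum_le_sum_abs _ _).trans ((Finset.sum_le_sum h5).trans ?_)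
  rw [Finset.sum_add_distrib, Finset.sum_add_distrib, ← Finset.sum_div, ← Finset.sum_div]
  norm_num
  linarith

theorem sum_sq_pred_le (h : BoundedOneDependent μ X n b) :
    ∑ k ∈ Finset.Icc (1 : ℤ) n, nu μ X 1 (k - 1) ^ 2 ≤
      ∑ k ∈ Finset.Icc (1 : ℤ) n, nu μ X 1 k ^ 2 :=
  sum_Icc_pred_le (f := fun k => nu μ X 1 k ^ 2)
    (by simp [h.nu_of_nonpos one_ne_zero le_rfl]) (fun k => sq_nonneg _) n

theorem abs_Gam2_le_R0 [IsProbabilityMeasure μ] (h : BoundedOneDependent μ X n b) : |Gam2 μ X n| ≤ 2 * R0 μ X n := by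
  rw [h.Gam2_eq, R0]
  have h5 : ∀ k ∈ Finset.Icc (1 : ℤ) n,
      |nu μ X 2 k / 2 - nu μ X 1 k ^ 2 / 2 + (mix μ X k - nu μ X 1 (k - 1) * nu μ X 1 k)| ≤
      nu μ X 2 k + 1.5 * nu μ X 1 k ^ 2 + mix μ X k + nu μ X 1 (k - 1) ^ 2 / 2 := by
    intro k _
    have h1 : 0 ≤ nu μ X 2 k := nu_nonneg 2 k
    have h2 : 0 ≤ mix μ X k := mix_nonneg k
    have h3 : 0 ≤ nu μ X 1 k := nu_nonneg 1 k
    have h4 : 0 ≤ nu μ X 1 (k - 1) := nu_nonneg 1 (k - 1)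
    norm_num
    rw [abs_le]
    constructor <;> nlinarith [sq_nonneg (nu μ X 1 k - nu μ X 1 (k - 1)), mul_nonneg h3 h4]
  refine (Finset.abs_sum_le_sum_abs _ _).trans ((Finset.sum_le_sum h5).trans ?_)
  have h6 := h.sum_sq_pred_le
  have h7 : 0 ≤ ∑ k ∈ Finset.Icc (1 : ℤ) n, nu μ X 2 k := Finset.sum_nonneg fun k _ => nu_nonneg 2 k
  have h8 : 0 ≤ ∑ k ∈ Finset.Icc (1 : ℤ) n, mix μ X k := Finset.sum_nonneg fun k _ => mix_nonneg k
  simp only [Finset.sum_add_distrib, ← Finset.mul_sum, ← Finset.sum_div]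
  norm_num
  linarith

/-- The summands of `R_1` in terms of moments. -/
theorem R1_eq (μ : Measure Ω) (X : ℤ → Ω → ℕ) (n : ℕ) :
    R1 μ X n = ∑ k ∈ Finset.Icc (1 : ℤ) n,
      (nu μ X 1 k ^ 3 + nu μ X 1 k * nu μ X 2 k + nu μ X 3 k +
        (nu μ X 1 (k - 2) + nu μ X 1 (k - 1) + nu μ X 1 k) * mix μ X k +
        ((∫ ω, (X (k - 1) ω : ℝ) * ((X (k - 1) ω : ℝ) - 1) * X k ω ∂μ +
            nu μ X 2 (k - 1) * nu μ X 1 k) +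
          (∫ ω, (X (k - 1) ω : ℝ) * ((X k ω : ℝ) * ((X k ω : ℝ) - 1)) ∂μ +
            nu μ X 1 (k - 1) * nu μ X 2 k)) +
        (triple μ X k + nu μ X 1 (k - 2) * mix μ X k +
          (mix μ X (k - 1) + nu μ X 1 (k - 2) * nu μ X 1 (k - 1)) * nu μ X 1 k)) := by
  rw [R1]
  refine Finset.sum_congr rfl fun k _ => ?_
  have e : k - 1 - 1 = k - 2 := by ring
  rw [Ep22, Ep3, Ep2, Ep2, Ep2, nu_two (k - 1), nu_two k, nu_one, nu_one, nu_one, triple, mix, mix,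
    e]

theorem R1_summand_nonneg (k : ℤ) :
    0 ≤ ∫ ω, (X (k - 1) ω : ℝ) * ((X (k - 1) ω : ℝ) - 1) * X k ω ∂μ ∧
      0 ≤ ∫ ω, (X (k - 1) ω : ℝ) * ((X k ω : ℝ) * ((X k ω : ℝ) - 1)) ∂μ := by
  have hx : ∀ x : ℕ, 0 ≤ (x : ℝ) * ((x : ℝ) - 1) := fun x => by
    rw [← Nat.cast_descFactorial_two]
    positivity
  exact ⟨integral_nonneg fun ω => mul_nonneg (hx _) (by positivity),
    integral_nonneg fun ω => mul_nonneg (by positivity) (hx _)⟩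

theorem sum_cube_le_R1 (μ : Measure Ω) (X : ℤ → Ω → ℕ) (n : ℕ) :
    ∑ k ∈ Finset.Icc (1 : ℤ) n, nu μ X 1 k ^ 3 ≤ R1 μ X n := by
  rw [R1_eq]
  refine Finset.sum_le_sum fun k _ => ?_
  obtain ⟨hu, hv⟩ := R1_summand_nonneg (μ := μ) (X := X) k
  have h0 := nu_nonneg (μ := μ) (X := X) 1 k
  have h1 := nu_nonneg (μ := μ) (X := X) 1 (k - 1)
  have h2 := nu_nonneg (μ := μ) (X := X) 1 (k - 2)
  have d0 := nu_nonneg (μ := μ) (X := X) 2 k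
  have d1 := nu_nonneg (μ := μ) (X := X) 2 (k - 1)
  have c0 := nu_nonneg (μ := μ) (X := X) 3 k
  have m0 := mix_nonneg (μ := μ) (X := X) k
  have m1 := mix_nonneg (μ := μ) (X := X) (k - 1)
  have t0 := triple_nonneg (μ := μ) (X := X) k
  simp only [add_assoc]
  refine le_add_of_nonneg_right ?_
  positivity

theorem R1_nonneg (μ : Measure Ω) (X : ℤ → Ω → ℕ) (n : ℕ) : 0 ≤ R1 μ X n :=
  le_trans (Finset.sum_nonneg fun k _ => pow_nonneg (nu_nonneg 1 k) 3) (sum_cube_le_R1 μ X n)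

theorem R0_nonneg (μ : Measure Ω) (X : ℤ → Ω → ℕ) (n : ℕ) : 0 ≤ R0 μ X n :=
  Finset.sum_nonneg fun k _ =>
    add_nonneg (add_nonneg (nu_nonneg 2 k) (sq_nonneg _)) (mix_nonneg k)

/-- The heart of the probabilistic part. The ratio expansions are summed over `k` after the block
means are replaced by moments: the bound on `Re L` gives Gaussian decay, the two norm bounds measure
the distance to the Poisson and compound Poisson exponents. -/
theorem exists_log_gen [IsProbabilityMeasure μ] (h : BoundedOneDependent μ X n b) (hs : SmallMoments μ X n) (hb : 1 ≤ b)
    {s : ℂ} {W : ℝ} (hW : Real.exp (|s.re| * b) ≤ W) (hW' : W ≤ 1.002) :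
    ∃ L : ℂ, Complex.exp L = ∫ ω, Complex.exp (s * partialSum X n ω) ∂μ ∧
      L.re ≤ lam μ X n * (Complex.exp s - 1).re +
        0.4 * lam μ X n * (W * ‖Complex.exp s - 1‖) ^ 2 ∧
      ‖L - lam μ X n * (Complex.exp s - 1)‖ ≤ 16 * (W * ‖Complex.exp s - 1‖) ^ 2 * R0 μ X n ∧
      ‖L - (lam μ X n * (Complex.exp s - 1) + Gam2 μ X n * (Complex.exp s - 1) ^ 2)‖ ≤
        300 * (W * ‖Complex.exp s - 1‖) ^ 3 * R1 μ X n := by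
  have hP := h.perturbedRecurrence hW hW' hb fun k hk => h.nu_one_le hs hk
  have hW1 : 1 ≤ W := one_le_of_exp_le hW
  set z := Complex.exp s - 1 with hz
  set ζ := W * ‖z‖ with hζ
  have hzζ : ‖z‖ ≤ ζ := le_mul_of_one_le_left (norm_nonneg _) hW1
  have hζ0 : 0 ≤ ζ := (norm_nonneg _).trans hzζ
  set F : ℤ → ℂ := fun j => ∫ ω, expPartialSum X s j ω ∂μ with hF
  refine ⟨∑ k ∈ Finset.Icc (1 : ℤ) n,
    Complex.log (1 + PerturbedRecurrence.delta F k), hP.exp_sum_log, ?_, ?_, ?_⟩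
  · rw [Complex.re_sum]
    have hterm : ∀ k ∈ Finset.Icc (1 : ℤ) n,
        (Complex.log (1 + PerturbedRecurrence.delta F k)).re ≤
          nu μ X 1 k * z.re + ζ ^ 2 * (nu μ X 2 k / 2 + 4.21 * mix μ X k + 0.115 * nu μ X 1 k) := by
      intro k hk
      have hk2 := (Finset.mem_Icc.1 hk).2
      have h1 := hP.re_log_le hk2
      have h2 := (Complex.re_le_norm _).trans (h.norm_integral_block_one_sub_le hW hk2)
      rw [← hz, ← hζ, Complex.sub_re, mul_comm z, Complex.re_ofReal_mul] at h2
      linarith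
    refine (Finset.sum_le_sum hterm).trans ?_
    rw [Finset.sum_add_distrib, ← Finset.sum_mul, ← h.lam_eq, ← Finset.mul_sum]
    simp only [Finset.sum_add_distrib, ← Finset.mul_sum, ← Finset.sum_div]
    rw [← h.lam_eq]
    have h1 := h.sum_mix_le hs
    have h2 := hs.sum_nu_two_le
    have h3 : 0 ≤ lam μ X n := by
      rw [h.lam_eq]
      exact Finset.sum_nonneg fun k _ => nu_nonneg 1 k
    -- `0.025 + 4.21·0.06 + 0.115 < 0.4`.
    have h4 : (∑ k ∈ Finset.Icc (1 : ℤ) n, nu μ X 2 k) / 2 +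
        4.21 * ∑ k ∈ Finset.Icc (1 : ℤ) n, mix μ X k + 0.115 * lam μ X n ≤ 0.4 * lam μ X n := by
      norm_num at *
      linarith
    have h5 := mul_le_mul_of_nonneg_left h4 (sq_nonneg ζ)
    linarith
  · have hterm : ∀ k ∈ Finset.Icc (1 : ℤ) n,
        ‖Complex.log (1 + PerturbedRecurrence.delta F k) - nu μ X 1 k * z‖ ≤
          ζ ^ 2 * (8 * mix μ X k + 12 * nu μ X 1 k ^ 2 + 4 * nu μ X 1 (k - 1) ^ 2 +
            nu μ X 2 k) := by
      intro k hk
      have hk2 := (Finset.mem_Icc.1 hk).2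
      have h1 := hP.norm_log_sub_le hk2
      have h2 := h.norm_integral_block_one_sub_le hW hk2
      rw [← hz, ← hζ] at h2
      have h3 := norm_add_le_of_le h1 h2
      rw [sub_add_sub_cancel, mul_comm z] at h3
      refine h3.trans ?_
      have h4 : nu μ X 1 k * nu μ X 1 (k - 1) ≤
          nu μ X 1 k ^ 2 / 2 + nu μ X 1 (k - 1) ^ 2 / 2 := by
        nlinarith [sq_nonneg (nu μ X 1 k - nu μ X 1 (k - 1))]
      have h5 : 0 ≤ nu μ X 2 k := nu_nonneg 2 k
      have h6 : 8 * (mix μ X k + nu μ X 1 k * nu μ X 1 (k - 1) + nu μ X 1 k ^ 2) +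
          nu μ X 2 k / 2 ≤ 8 * mix μ X k + 12 * nu μ X 1 k ^ 2 + 4 * nu μ X 1 (k - 1) ^ 2 +
            nu μ X 2 k := by linarith
      have h7 := mul_le_mul_of_nonneg_left h6 (sq_nonneg ζ)
      refine le_trans (le_of_eq ?_) h7
      ring
    have e : (lam μ X n : ℂ) * z = ∑ k ∈ Finset.Icc (1 : ℤ) n, (nu μ X 1 k : ℂ) * z := by
      rw [h.lam_eq, ← Finset.sum_mul]
      push_cast
      rfl
    rw [e, ← Finset.sum_sub_distrib]
    refine (norm_sum_le_of_le _ hterm).trans ?_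
    rw [← Finset.mul_sum]
    have h1 := h.sum_sq_pred_le
    have h2 : 0 ≤ ∑ k ∈ Finset.Icc (1 : ℤ) n, nu μ X 2 k :=
      Finset.sum_nonneg fun k _ => nu_nonneg 2 k
    have h3 : 0 ≤ ∑ k ∈ Finset.Icc (1 : ℤ) n, mix μ X k :=
      Finset.sum_nonneg fun k _ => mix_nonneg k
    have h4 : ∑ k ∈ Finset.Icc (1 : ℤ) n, (8 * mix μ X k + 12 * nu μ X 1 k ^ 2 +
        4 * nu μ X 1 (k - 1) ^ 2 + nu μ X 2 k) ≤ 16 * R0 μ X n := by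
      rw [R0]
      simp only [Finset.sum_add_distrib, ← Finset.mul_sum]
      linarith
    have h5 := mul_le_mul_of_nonneg_left h4 (sq_nonneg ζ)
    linarith
  · have hterm : ∀ k ∈ Finset.Icc (1 : ℤ) n,
        ‖Complex.log (1 + PerturbedRecurrence.delta F k) - (nu μ X 1 k * z +
          (nu μ X 2 k / 2 - nu μ X 1 k ^ 2 / 2 +
            (mix μ X k - nu μ X 1 (k - 1) * nu μ X 1 k) : ℝ) * z ^ 2)‖ ≤
          ζ ^ 3 * (150 * ((nu μ X 1 k ^ 3 + nu μ X 1 k * nu μ X 2 k + nu μ X 3 k +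
        (nu μ X 1 (k - 2) + nu μ X 1 (k - 1) + nu μ X 1 k) * mix μ X k +
        ((∫ ω, (X (k - 1) ω : ℝ) * ((X (k - 1) ω : ℝ) - 1) * X k ω ∂μ +
            nu μ X 2 (k - 1) * nu μ X 1 k) +
          (∫ ω, (X (k - 1) ω : ℝ) * ((X k ω : ℝ) * ((X k ω : ℝ) - 1)) ∂μ +
            nu μ X 1 (k - 1) * nu μ X 2 k)) +
        (triple μ X k + nu μ X 1 (k - 2) * mix μ X k +
          (mix μ X (k - 1) + nu μ X 1 (k - 2) * nu μ X 1 (k - 1)) * nu μ X 1 k)) +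
            nu μ X 1 (k - 1) ^ 3)) := by
      intro k hk
      have hk2 := (Finset.mem_Icc.1 hk).2
      have hk1 : k - 1 ≤ (n : ℤ) := by omega
      have h1 := hP.norm_log_sub_quadratic_le hk2
      have hp0 := h.norm_integral_block_one_sub_le hW hk2
      have hp1 := h.norm_integral_block_one_sub_le hW hk1
      have hpp := h.norm_integral_block_one_sub_sub_le hW hk2
      have hq := h.norm_integral_block_two_sub_le hW hk2
      have hn0 := hP.norm_q_one_le hk2
      have hn1 := hP.norm_q_one_le hk1
      rw [← hz, ← hζ] at hp0 hp1 hpp hq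
      change ‖_‖ ≤ _ * (_ * (triple μ X k + _ + _ + _ + _ + _ + _)) at h1
      obtain ⟨hu, hv⟩ := R1_summand_nonneg (μ := μ) (X := X) k
      have a0 := nu_nonneg (μ := μ) (X := X) 1 k
      have a1 := nu_nonneg (μ := μ) (X := X) 1 (k - 1)
      have a2 := nu_nonneg (μ := μ) (X := X) 1 (k - 2)
      have d0 := nu_nonneg (μ := μ) (X := X) 2 k
      have d1 := nu_nonneg (μ := μ) (X := X) 2 (k - 1)
      have c0 := nu_nonneg (μ := μ) (X := X) 3 k
      have m0 := mix_nonneg (μ := μ) (X := X) k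
      have m1 := mix_nonneg (μ := μ) (X := X) (k - 1)
      have t0 := triple_nonneg (μ := μ) (X := X) k
      generalize ∫ ω, (X (k - 1) ω : ℝ) * ((X (k - 1) ω : ℝ) - 1) * X k ω ∂μ = u at *
      generalize ∫ ω, (X (k - 1) ω : ℝ) * ((X k ω : ℝ) * ((X k ω : ℝ) - 1)) ∂μ = v at *
      generalize ∫ ω, expBlock X s k 1 ω ∂μ = p0 at *
      generalize ∫ ω, expBlock X s (k - 1) 1 ω ∂μ = p1 at *
      generalize ∫ ω, expBlock X s k 2 ω ∂μ = q0 at *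
      generalize Complex.log (1 + PerturbedRecurrence.delta F k) = l at *
      generalize nu μ X 1 k = α0 at *
      generalize nu μ X 1 (k - 1) = α1 at *
      generalize nu μ X 1 (k - 2) = α2 at *
      generalize nu μ X 2 k = β0 at *
      generalize nu μ X 2 (k - 1) = β1 at *
      generalize nu μ X 3 k = γ0 at *
      generalize mix μ X k = κ0 at *
      generalize mix μ X (k - 1) = κ1 at *
      generalize triple μ X k = τ at *
      have hzα : ‖z * (α0 : ℂ)‖ ≤ ζ * α0 := by
        rw [norm_mul, Complex.norm_real, Real.norm_of_nonneg a0]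
        gcongr
      have e1 : ‖p0 * p1 - α1 * α0 * z ^ 2‖ ≤
          (ζ ^ 2 * (β0 / 2)) * (ζ * α1) + (ζ * α0) * (ζ ^ 2 * (β1 / 2)) := by
        have : p0 * p1 - α1 * α0 * z ^ 2 =
            (p0 - z * α0) * p1 + (z * α0) * (p1 - z * α1) := by ring
        rw [this]
        refine norm_add_le_of_le ?_ ?_ <;> rw [norm_mul]
        · exact mul_le_mul hp0 hn1 (norm_nonneg _) (by positivity)
        · exact mul_le_mul hzα hp1 (norm_nonneg _) (by positivity)
      have e2 : ‖(p0 ^ 2 - α0 ^ 2 * z ^ 2) / 2‖ ≤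
          (ζ ^ 2 * (β0 / 2)) * (ζ * α0 + ζ * α0) / 2 := by
        have : p0 ^ 2 - α0 ^ 2 * z ^ 2 = (p0 - z * α0) * (p0 + z * α0) := by ring
        rw [this, norm_div, norm_mul, Complex.norm_ofNat]
        gcongr
        exact norm_add_le_of_le hn0 hzα
      -- The part of `p0 - p0 p1 + q0 - p0²/2` quadratic in `z` is exactly the `k`-th summand of
      -- `Γ₂z²`.
      have e : l - (α0 * z + (β0 / 2 - α0 ^ 2 / 2 + (κ0 - α1 * α0) : ℝ) * z ^ 2) =
          (l - (p0 - p0 * p1 + q0 - p0 ^ 2 / 2)) + ((p0 - (z * α0 + z ^ 2 * (β0 / 2))) +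
            ((q0 - z ^ 2 * κ0) + (-(p0 * p1 - α1 * α0 * z ^ 2) +
              -((p0 ^ 2 - α0 ^ 2 * z ^ 2) / 2)))) := by
        push_cast
        ring
      rw [e]
      refine (norm_add_le_of_le h1 (norm_add_le_of_le hpp (norm_add_le_of_le hq
        (norm_add_le_of_le ((norm_neg _).trans_le e1) ((norm_neg _).trans_le e2))))).trans ?_
      -- Products of neighbouring means are traded for cubes. The cube of `ν₁(k-1)` is carried along
      -- and absorbed after summation, which doubles `150` to `300`.
      have f1 : α0 * α1 ^ 2 ≤ α0 ^ 3 + α1 ^ 3 := by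
        nlinarith [mul_nonneg (add_nonneg a0 a1) (sq_nonneg (α0 - α1)), pow_nonneg a0 3,
          pow_nonneg a1 3, mul_nonneg a1 (sq_nonneg α0), mul_nonneg a0 (sq_nonneg α1)]
      have f2 : α0 ^ 2 * α1 ≤ α0 ^ 3 + α1 ^ 3 := by
        nlinarith [mul_nonneg (add_nonneg a0 a1) (sq_nonneg (α0 - α1)), pow_nonneg a0 3,
          pow_nonneg a1 3, mul_nonneg a1 (sq_nonneg α0), mul_nonneg a0 (sq_nonneg α1)]
      have key : 30 * (τ + κ0 * (α2 + α1 + α0) + α0 * κ1 + α0 * α1 * α2 + α0 * α1 ^ 2 +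
          α0 ^ 2 * α1 + α0 ^ 3) + (γ0 / 6 + ((u + v) / 2 + ((β0 * α1 + α0 * β1) / 2 +
            β0 * α0 / 2))) ≤
          150 * ((α0 ^ 3 + α0 * β0 + γ0 + (α2 + α1 + α0) * κ0 + ((u + β1 * α0) + (v + α1 * β0)) +
            (τ + α2 * κ0 + (κ1 + α2 * α1) * α0)) + α1 ^ 3) := by
        have g1 := mul_nonneg a0 d0
        have g2 := mul_nonneg a0 d1
        have g3 := mul_nonneg a1 d0
        have g4 := mul_nonneg a0 m0
        have g5 := mul_nonneg a1 m0
        have g6 := mul_nonneg a2 m0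
        have g7 := mul_nonneg a0 m1
        have g8 := mul_nonneg (mul_nonneg a0 a1) a2
        have g9 := pow_nonneg a0 3
        have g10 := pow_nonneg a1 3
        linarith
      have key' := mul_le_mul_of_nonneg_left key (pow_nonneg hζ0 3)
      refine le_trans (le_of_eq ?_) key'
      ring
    have e : (lam μ X n : ℂ) * z + Gam2 μ X n * z ^ 2 = ∑ k ∈ Finset.Icc (1 : ℤ) n,
        (nu μ X 1 k * z + (nu μ X 2 k / 2 - nu μ X 1 k ^ 2 / 2 +
            (mix μ X k - nu μ X 1 (k - 1) * nu μ X 1 k) : ℝ) * z ^ 2) := by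
      rw [h.lam_eq, h.Gam2_eq, Complex.ofReal_sum, Complex.ofReal_sum, Finset.sum_mul,
        Finset.sum_mul, ← Finset.sum_add_distrib]
    rw [e, ← Finset.sum_sub_distrib]
    refine (norm_sum_le_of_le _ hterm).trans ?_
    rw [← Finset.mul_sum, ← Finset.mul_sum, Finset.sum_add_distrib, ← R1_eq]
    have h1 : ∑ k ∈ Finset.Icc (1 : ℤ) n, nu μ X 1 (k - 1) ^ 3 ≤ R1 μ X n :=
      (sum_Icc_pred_le (f := fun k => nu μ X 1 k ^ 3)
        (by simp [h.nu_of_nonpos one_ne_zero le_rfl]) (fun k => pow_nonneg (nu_nonneg 1 k) 3)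
        n).trans (sum_cube_le_R1 μ X n)
    have h2 := mul_le_mul_of_nonneg_left h1 (pow_nonneg hζ0 3)
    linarith

end BoundedOneDependent

/-! ### Estimates for exponents near the imaginary axis -/

/-- Mean value inequality on the convex half-plane `Re ≤ r`, where `|exp'| ≤ e^r`. -/
theorem Complex.norm_exp_sub_exp_le {x y : ℂ} {r : ℝ} (hx : x.re ≤ r) (hy : y.re ≤ r) :
    ‖Complex.exp x - Complex.exp y‖ ≤ Real.exp r * ‖x - y‖ := by
  refine (convex_halfSpace_re_le r).norm_image_sub_le_of_norm_hasDerivWithin_le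
    (f := Complex.exp) (f' := Complex.exp) (fun w _ => (Complex.hasDerivAt_exp w).hasDerivWithinAt)
    (fun w hw => ?_) hy hx
  rw [Complex.norm_exp, Real.exp_le_exp]
  exact hw

theorem Complex.norm_log_one_add_sub_quadratic_le {u : ℂ} (hu : ‖u‖ < 1) :
    ‖Complex.log (1 + u) - (u - u ^ 2 / 2)‖ ≤ ‖u‖ ^ 3 * (1 - ‖u‖)⁻¹ / 3 := by
  have h := Complex.norm_log_sub_logTaylor_le 2 hu
  have e : Complex.logTaylor (2 + 1) u = u - u ^ 2 / 2 := by
    simp [Complex.logTaylor_succ, Complex.logTaylor_zero]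
    ring
  rw [e] at h
  norm_num at h
  exact h

theorem Complex.norm_exp_sub_one_sub_le (x : ℂ) :
    ‖Complex.exp x - 1 - x‖ ≤ ‖x‖ ^ 2 * Real.exp ‖x‖ := by
  have := Complex.norm_exp_sub_sum_le_norm_mul_exp x 2
  simpa [Finset.sum_range_succ, sub_sub] using this

theorem Complex.norm_exp_sub_quadratic_le (x : ℂ) :
    ‖Complex.exp x - 1 - x - x ^ 2 / 2‖ ≤ ‖x‖ ^ 3 * Real.exp ‖x‖ := by
  have := Complex.norm_exp_sub_sum_le_norm_mul_exp x 3
  simpa [Finset.sum_range_succ, sub_sub, Nat.factorial, add_assoc] using this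

/-! ### Geometry of `z = e^s - 1` near the imaginary axis -/

section Strip

variable {l v t : ℝ}

theorem exp_add_mul_I_sub_one_re (v t : ℝ) :
    (Complex.exp (v + t * Complex.I) - 1).re =
      (Real.exp v - 1) - Real.exp v * (1 - Real.cos t) := by
  simp [Complex.exp_re]
  ring

theorem norm_exp_add_mul_I_sub_one_sq (v t : ℝ) :
    ‖Complex.exp (v + t * Complex.I) - 1‖ ^ 2 =
      (Real.exp v - 1) ^ 2 + 2 * (Real.exp v * (1 - Real.cos t)) := by
  rw [← Complex.normSq_eq_norm_sq, Complex.normSq_apply, exp_add_mul_I_sub_one_re]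
  simp [Complex.exp_im]
  linear_combination Real.exp v ^ 2 * Real.sin_sq_add_cos_sq t

/-- The strip `λ v² ≤ 10⁻⁶`, `|t| ≤ π` around the imaginary axis. -/
structure InStrip (l v t : ℝ) : Prop where
  one_le : 1 ≤ l
  mul_sq_le : l * v ^ 2 ≤ 1 / 1000000
  abs_le_pi : |t| ≤ Real.pi

namespace InStrip

theorem abs_v_le (h : InStrip l v t) : |v| ≤ 1 / 1000 := by
  have h1 : v ^ 2 ≤ (1 / 1000) ^ 2 := by
    have := h.mul_sq_le
    nlinarith [h.one_le, sq_nonneg v]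
  exact abs_le_of_sq_le_sq h1 (by norm_num)

theorem exp_v_bounds (h : InStrip l v t) : |Real.exp v - 1 - v| ≤ v ^ 2 :=
  Real.abs_exp_sub_one_sub_id_le (h.abs_v_le.trans (by norm_num))

theorem exp_v_mem (h : InStrip l v t) : 0.998 ≤ Real.exp v ∧ Real.exp v ≤ 1.002 := by
  have h1 := abs_le.1 h.exp_v_bounds
  have h2 := abs_le.1 h.abs_v_le
  constructor <;> norm_num <;> nlinarith

theorem sq_exp_sub_one_le (h : InStrip l v t) : (Real.exp v - 1) ^ 2 ≤ 4 * v ^ 2 := by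
  have h1 := abs_le.1 h.exp_v_bounds
  have h2 := abs_le.1 h.abs_v_le
  have : |Real.exp v - 1| ≤ |2 * v| := by
    rw [abs_mul, abs_two, abs_le]
    have := sq_abs v
    have := abs_nonneg v
    have := le_abs_self v
    have := neg_abs_le v
    constructor <;> nlinarith [h.abs_v_le]
  calc _ ≤ (2 * v) ^ 2 := sq_le_sq.2 this
    _ = _ := by ring

theorem one_sub_cos_ge (h : InStrip l v t) : 0.2 * t ^ 2 ≤ 1 - Real.cos t := by
  have h1 := Real.cos_le_one_sub_mul_cos_sq h.abs_le_pi
  have h2 : (0.2 : ℝ) ≤ 2 / Real.pi ^ 2 := by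
    rw [le_div_iff₀ (by positivity)]
    have := Real.pi_lt_d2
    have := Real.pi_pos
    norm_num at *
    nlinarith
  nlinarith [sq_nonneg t]

theorem one_sub_cos_le (t : ℝ) : 2 * (1 - Real.cos t) ≤ t ^ 2 := by
  linarith [Real.one_sub_sq_div_two_le_cos (x := t)]

theorem norm_z_sq_le (h : InStrip l v t) :
    ‖Complex.exp (v + t * Complex.I) - 1‖ ^ 2 ≤ 4 * v ^ 2 + 1.002 * t ^ 2 := by
  rw [norm_exp_add_mul_I_sub_one_sq]
  have h1 := h.sq_exp_sub_one_le
  have h2 := h.exp_v_mem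
  have h3 := one_sub_cos_le t
  have h4 := h.one_sub_cos_ge
  nlinarith [sq_nonneg t]

theorem norm_z_le_two (h : InStrip l v t) :
    ‖Complex.exp (v + t * Complex.I) - 1‖ ≤ 2.002 := by
  refine (norm_sub_le _ _).trans ?_
  have := h.exp_v_mem
  rw [norm_one, Complex.norm_exp]
  simp
  norm_num at *
  linarith

theorem norm_s_le (h : InStrip l v t) :
    ‖(v + t * Complex.I : ℂ)‖ ≤ 2 * ‖Complex.exp (v + t * Complex.I) - 1‖ := by
  refine (pow_le_pow_iff_left₀ (norm_nonneg _) (by positivity) two_ne_zero).1 ?_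
  rw [mul_pow, norm_exp_add_mul_I_sub_one_sq, ← Complex.normSq_eq_norm_sq,
    Complex.normSq_add_mul_I]
  have h1 := abs_le.1 h.exp_v_bounds
  have h2 := h.exp_v_mem
  have h4 := h.one_sub_cos_ge
  have h5 : v ^ 2 / 4 ≤ (Real.exp v - 1) ^ 2 := by
    have : |v / 2| ≤ |Real.exp v - 1| := by
      have h6 : |v| ≤ |Real.exp v - 1| + |Real.exp v - 1 - v| := by
        have := abs_sub (Real.exp v - 1) (Real.exp v - 1 - v)
        rwa [sub_sub_cancel] at this
      have h7 := h.exp_v_bounds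
      have h8 := h.abs_v_le
      rw [abs_div, abs_two]
      nlinarith [sq_abs v, abs_nonneg v]
    have := sq_le_sq.2 this
    linarith
  have h6 : 0 ≤ 1 - Real.cos t := by linarith [Real.cos_le_one t]
  norm_num at *
  nlinarith [sq_nonneg t]

theorem norm_s_le_four (h : InStrip l v t) : ‖(v + t * Complex.I : ℂ)‖ ≤ 4 := by
  refine (norm_add_le _ _).trans ?_
  rw [norm_mul, Complex.norm_I, Complex.norm_real, Complex.norm_real, mul_one]
  have := Real.pi_lt_d2
  have := h.abs_le_pi
  have := h.abs_v_le
  simp only [Real.norm_eq_abs]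
  linarith

/-- `s = z - z²/2 + O(z³)` for `z = e^s - 1`. -/
theorem norm_s_sub_le (h : InStrip l v t) :
    ‖(v + t * Complex.I : ℂ) - (Complex.exp (v + t * Complex.I) - 1) +
      (Complex.exp (v + t * Complex.I) - 1) ^ 2 / 2‖ ≤
      200000 * ‖Complex.exp (v + t * Complex.I) - 1‖ ^ 3 := by
  have h1 := h.norm_s_le
  have h4 := h.norm_s_le_four
  set s : ℂ := v + t * Complex.I with hs
  have h2 := Complex.norm_exp_sub_one_sub_le s
  have h3 := Complex.norm_exp_sub_quadratic_le s
  set z := Complex.exp s - 1 with hz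
  have he : Real.exp ‖s‖ ≤ 81 := by
    calc Real.exp ‖s‖ ≤ Real.exp (4 * 1) := Real.exp_le_exp.2 (by linarith)
      _ = Real.exp 1 ^ 4 := by
          rw [← Real.exp_nat_mul]
          norm_num
      _ ≤ 3 ^ 4 := by
          have := Real.exp_one_lt_d9
          gcongr
          linarith
      _ = 81 := by norm_num
  have h5 : ‖z - s‖ ≤ ‖s‖ ^ 2 * 81 := h2.trans (by gcongr)
  have h6 : ‖z - s - s ^ 2 / 2‖ ≤ ‖s‖ ^ 3 * 81 := h3.trans (by gcongr)
  -- Taylor error of `z` plus the cost of replacing `s²` by `z²`; the constant covers `8(81 + 81 +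
  -- 2·81²)`.
  have e : s - z + z ^ 2 / 2 = -(z - s - s ^ 2 / 2) + (s * (z - s) + (z - s) ^ 2 / 2) := by ring
  rw [e]
  have h7 : ‖(z - s) ^ 2 / 2‖ ≤ 4 * 81 ^ 2 / 2 * ‖s‖ ^ 3 := by
    rw [norm_div, norm_pow, Complex.norm_ofNat]
    calc _ ≤ (‖s‖ ^ 2 * 81) ^ 2 / 2 := by gcongr
      _ = ‖s‖ * (81 ^ 2 / 2 * ‖s‖ ^ 3) := by ring
      _ ≤ 4 * (81 ^ 2 / 2 * ‖s‖ ^ 3) := by gcongr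
      _ = _ := by ring
  have h8 : ‖s * (z - s)‖ ≤ 81 * ‖s‖ ^ 3 := by
    rw [norm_mul]
    calc _ ≤ ‖s‖ * (‖s‖ ^ 2 * 81) := by gcongr
      _ = _ := by ring
  refine (norm_add_le_of_le ((norm_neg _).trans_le h6) (norm_add_le_of_le h8 h7)).trans ?_
  have h9 : ‖s‖ ^ 3 ≤ (2 * ‖z‖) ^ 3 := by gcongr
  have h10 := pow_nonneg (norm_nonneg z) 3
  rw [mul_pow] at h9
  linarith

/-- `Re z` contains `-e^v(1 - cos t)` and `‖z‖²` contains `2e^v(1 - cos t)`, so any coefficient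
below `1/2` leaves decay. With `0.45` a tenth survives, and `e^v(1 - cos t) ≥ 0.1 t²` gives
`lt²/100`. The terms of size `lv²` fit into the summand `1`. -/
theorem re_exponent_le (h : InStrip l v t) :
    l * (Complex.exp (v + t * Complex.I) - 1).re +
      0.45 * l * ‖Complex.exp (v + t * Complex.I) - 1‖ ^ 2 ≤ l * v + 1 - l * t ^ 2 / 100 := by
  rw [norm_exp_add_mul_I_sub_one_sq, exp_add_mul_I_sub_one_re]
  have h0 := h.one_le
  have h1 := (abs_le.1 h.exp_v_bounds).2
  have h2 := h.sq_exp_sub_one_le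
  have h3 := h.exp_v_mem.1
  have h4 := h.one_sub_cos_ge
  have h5 := h.mul_sq_le
  have a1 : l * (Real.exp v - 1) ≤ l * v + l * v ^ 2 := by nlinarith
  have a2 : l * (Real.exp v - 1) ^ 2 ≤ 4 * (l * v ^ 2) := by nlinarith
  have a3 : 0.1 * t ^ 2 ≤ Real.exp v * (1 - Real.cos t) := by
    norm_num at *
    nlinarith [sq_nonneg t]
  have a4 : l * (0.1 * t ^ 2) ≤ l * (Real.exp v * (1 - Real.cos t)) :=
    mul_le_mul_of_nonneg_left a3 (by linarith)
  norm_num at *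
  linarith

/-- `mv + (l-m)(e^v - 1) = lv + (l-m)(e^v - 1 - v)`: the translation leaves the linear term intact.
The upper bound on `m` keeps `l - m` comparable to `l` for the decay in `t`. -/
theorem re_translated_exponent_le (h : InStrip l v t) {m : ℝ} (hm : m ≤ 0.16 * l)
    (hm' : -(2 * l) ≤ m) :
    (m * (v + t * Complex.I) + (l - m : ℝ) * (Complex.exp (v + t * Complex.I) - 1)).re ≤
      l * v + 1 - l * t ^ 2 / 100 := by
  rw [Complex.add_re, Complex.re_ofReal_mul, Complex.re_ofReal_mul, exp_add_mul_I_sub_one_re]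
  have h0 := h.one_le
  have h1 := (abs_le.1 h.exp_v_bounds).2
  have h3 := h.exp_v_mem.1
  have h4 := h.one_sub_cos_ge
  have h5 := h.mul_sq_le
  have a1 : (l - m) * (Real.exp v - 1 - v) ≤ 3 * l * v ^ 2 := by
    calc _ ≤ (l - m) * v ^ 2 := mul_le_mul_of_nonneg_left h1 (by norm_num at *; linarith)
      _ ≤ _ := mul_le_mul_of_nonneg_right (by linarith) (sq_nonneg v)
  have a3 : 0.1 * t ^ 2 ≤ Real.exp v * (1 - Real.cos t) := by
    norm_num at *
    nlinarith [sq_nonneg t]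
  have a4 : 0.8 * l * (0.1 * t ^ 2) ≤ (l - m) * (Real.exp v * (1 - Real.cos t)) :=
    mul_le_mul (by norm_num at *; linarith) a3 (by positivity) (by norm_num at *; linarith)
  have e : ((v : ℂ) + t * Complex.I).re = v := by simp
  rw [e]
  have : 0 ≤ l * t ^ 2 := by positivity
  norm_num at *
  nlinarith

/-- A factor `‖z‖` is worth `1/√l`, its growth in `√l |t|` being paid for by a small part of the
Gaussian. -/
theorem norm_z_le_exp (h : InStrip l v t) :
    ‖Complex.exp (v + t * Complex.I) - 1‖ ≤ 50 / √l * Real.exp (l * t ^ 2 / 2000) := by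
  have h0 := h.one_le
  have hl : 0 < l := by linarith
  refine (pow_le_pow_iff_left₀ (norm_nonneg _) (by positivity) two_ne_zero).1 ?_
  rw [mul_pow, div_pow, Real.sq_sqrt hl.le, ← Real.exp_nat_mul]
  refine h.norm_z_sq_le.trans ?_
  rw [div_mul_eq_mul_div, le_div_iff₀ hl]
  have h1 := Real.add_one_le_exp (((2 : ℕ) : ℝ) * (l * t ^ 2 / 2000))
  have h5 := h.mul_sq_le
  have : 0 ≤ l * t ^ 2 := by positivity
  push_cast at h1 ⊢
  norm_num at *
  nlinarith

end InStrip

end Strip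

/-- Wasserstein norms of measures whose transform is `O(z²)` times the transform of a Poisson-like
measure. -/
theorem wassersteinNorm_le_of_transform {M : ℤ → ℝ} {l κ b₁ b₂ b₃ : ℝ} (hl : 1 ≤ l) (hκ : 0 < κ)
    (hκ1 : κ ≤ 1 / 1000) (h₁ : 0 ≤ b₁) (h₂ : 0 ≤ b₂) (h₃ : 0 ≤ b₃) (h0 : HasGen M 0 0) (φ : ℂ → ℂ)
    (hφ : ∀ v : ℝ, |v| = κ / √l → ∀ t : ℝ,
      HasGen M (v + t * Complex.I) (φ (v + t * Complex.I)))
    (hbd : ∀ v t : ℝ, |v| = κ / √l → InStrip l v t →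
      ‖φ (v + t * Complex.I)‖ ≤ (b₁ * ‖Complex.exp (v + t * Complex.I) - 1‖ ^ 2 +
        b₂ * ‖Complex.exp (v + t * Complex.I) - 1‖ ^ 3 +
        b₃ * ‖Complex.exp (v + t * Complex.I) - 1‖ ^ 4) *
          Real.exp (l * v + 1 - l * t ^ 2 / 100)) :
    wassersteinNorm M ≤
      ENNReal.ofReal (270000000 / κ * (b₁ / √l + b₂ / l + b₃ / (l * √l))) := by
  have hl0 : 0 < l := by linarith
  have hsq : 1 ≤ √l := Real.one_le_sqrt.2 hl
  have hs2 : √l ^ 2 = l := Real.sq_sqrt hl0.le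
  have hstrip : ∀ v t : ℝ, |v| = κ / √l → t ∈ Set.Icc (-Real.pi) Real.pi → InStrip l v t := by
    intro v t hv ht
    refine ⟨hl, ?_, abs_le.2 ht⟩
    rw [← sq_abs, hv, div_pow, hs2, mul_div_cancel₀ _ hl0.ne']
    nlinarith
  -- One `‖z‖` is reserved for the denominator; at most three others become `50y/√l`. Then
  -- `e^{-lt²/100} y³ ≤ e^{-lt²/200}`, and `375000 = 3·50³` includes `e ≤ 3`.
  have key := wassersteinNorm_le_of_gen (M := M) (h := κ / √l) (l := l)
    (a := 375000 * (b₁ / √l + b₂ / l + b₃ / (l * √l))) (b := l / 200) (by positivity)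
    (by rw [div_le_one (by positivity)]; linarith) (by positivity) (by positivity) h0 φ hφ ?_
  · refine key.trans (ENNReal.ofReal_le_ofReal ?_)
    have e : √(Real.pi / (l / 200)) = √(200 * Real.pi) / √l := by
      rw [← Real.sqrt_div (by positivity)]
      congr 1
      field_simp
    have e2 : √(200 * Real.pi) ≤ 30 := by
      rw [Real.sqrt_le_left (by norm_num)]
      linarith [Real.pi_lt_d2]
    rw [e]
    set B := b₁ / √l + b₂ / l + b₃ / (l * √l) with hB
    have hB0 : 0 ≤ B := by positivity
    calc 375000 * B * (√(200 * Real.pi) / √l) * (24 / (κ / √l))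
        = (375000 * 24 / κ * B) * √(200 * Real.pi) := by field_simp
      _ ≤ (375000 * 24 / κ * B) * 30 := by gcongr
      _ = _ := by ring
  · intro v hv t ht
    have hst := hstrip v t hv ht
    refine (hbd v t hv hst).trans ?_
    set r := ‖Complex.exp (v + t * Complex.I) - 1‖ with hr
    have hr0 : 0 ≤ r := norm_nonneg _
    set y := Real.exp (l * t ^ 2 / 2000) with hy
    have hy1 : 1 ≤ y := Real.one_le_exp (by positivity)
    have hry : r ≤ 50 / √l * y := hst.norm_z_le_exp
    have r1 : r ≤ 125000 / √l * y ^ 3 := by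
      refine hry.trans ?_
      have : y ≤ y ^ 3 := le_self_pow₀ hy1 (by norm_num)
      gcongr
      norm_num
    have r2 : r ^ 2 ≤ 125000 / l * y ^ 3 := by
      have : y ^ 2 ≤ y ^ 3 := pow_le_pow_right₀ hy1 (by norm_num)
      calc r ^ 2 ≤ (50 / √l * y) ^ 2 := by gcongr
        _ = 2500 / l * y ^ 2 := by rw [mul_pow, div_pow, hs2]; norm_num
        _ ≤ _ := by gcongr; norm_num
    have r3 : r ^ 3 ≤ 125000 / (l * √l) * y ^ 3 := by
      calc r ^ 3 ≤ (50 / √l * y) ^ 3 := by gcongr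
        _ = _ := by
          rw [mul_pow, div_pow, pow_succ (√l), hs2]
          norm_num
    have hexp : Real.exp (l * v + 1 - l * t ^ 2 / 100) * y ^ 3 ≤
        3 * (Real.exp (l * v) * Real.exp (-(l / 200) * t ^ 2)) := by
      rw [hy, ← Real.exp_nat_mul, ← Real.exp_add, ← Real.exp_add]
      calc _ ≤ Real.exp (1 + (l * v + -(l / 200) * t ^ 2)) := by
            rw [Real.exp_le_exp]
            have : 0 ≤ l * t ^ 2 := by positivity
            push_cast
            linarith
        _ = Real.exp 1 * Real.exp (l * v + -(l / 200) * t ^ 2) := Real.exp_add _ _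
        _ ≤ _ := by
            gcongr
            linarith [Real.exp_one_lt_d9]
    have hpoly : b₁ * r ^ 2 + b₂ * r ^ 3 + b₃ * r ^ 4 ≤
        r * (125000 * (b₁ / √l + b₂ / l + b₃ / (l * √l)) * y ^ 3) := by
      calc b₁ * r ^ 2 + b₂ * r ^ 3 + b₃ * r ^ 4 = r * (b₁ * r + b₂ * r ^ 2 + b₃ * r ^ 3) := by ring
        _ ≤ r * (b₁ * (125000 / √l * y ^ 3) + b₂ * (125000 / l * y ^ 3) +
              b₃ * (125000 / (l * √l) * y ^ 3)) := by gcongr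
        _ = _ := by ring
    set B := b₁ / √l + b₂ / l + b₃ / (l * √l) with hB
    have hB0 : 0 ≤ B := by positivity
    calc (b₁ * r ^ 2 + b₂ * r ^ 3 + b₃ * r ^ 4) * Real.exp (l * v + 1 - l * t ^ 2 / 100)
        ≤ r * (125000 * B * y ^ 3) * Real.exp (l * v + 1 - l * t ^ 2 / 100) := by gcongr
      _ = r * (125000 * B) * (Real.exp (l * v + 1 - l * t ^ 2 / 100) * y ^ 3) := by ring
      _ ≤ r * (125000 * B) * (3 * (Real.exp (l * v) * Real.exp (-(l / 200) * t ^ 2))) := by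
          gcongr
      _ = _ := by ring

/-! ### Exponents of the negative binomial and binomial distributions -/

section Exponents

variable {l g : ℝ}

theorem nbQ_spec (hl : 0 < l) (hg : 0 < g) (hgl : g ≤ 0.08 * l) :
    0 < nbQ l g ∧ nbQ l g < 1 ∧ 1 - nbQ l g ≤ 0.16 ∧ (1 - nbQ l g) / nbQ l g = 2 * g / l := by
  have h1 : 0 < l + 2 * g := by positivity
  have h2 : 1 - nbQ l g = 2 * g / (l + 2 * g) := by
    rw [nbQ]
    field_simp
    ring
  refine ⟨by rw [nbQ]; positivity, by rw [nbQ, div_lt_one h1]; linarith, ?_, ?_⟩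
  · rw [h2, div_le_iff₀ h1]
    norm_num at *
    linarith
  · rw [h2, nbQ]
    field_simp

/-- With `η = 2g/l` one has `rη = l` and `rη² = 2g`, so the Taylor polynomial of degree two of `-r
log(1 - ηz)` is exactly `lz + gz²`. The cubic term has size `rη³ = 4g²/l`. -/
theorem nb_exponent_bounds (hl : 0 < l) (hg : 0 < g) (hgl : g ≤ 0.08 * l) {z : ℂ}
    (hz : ‖z‖ ≤ 2.002) :
    ‖-(nbR l g * Complex.log (1 - (2 * g / l : ℝ) * z)) - (l * z + g * z ^ 2)‖ ≤
        2 * g ^ 2 / l * ‖z‖ ^ 3 ∧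
      (-(nbR l g * Complex.log (1 - (2 * g / l : ℝ) * z))).re ≤
        l * z.re + 0.45 * l * ‖z‖ ^ 2 := by
  set η := 2 * g / l with hη
  have hη0 : 0 < η := by positivity
  have hη1 : η ≤ 0.16 := by
    rw [hη, div_le_iff₀ hl]
    norm_num at *
    linarith
  set u : ℂ := -(η * z) with hu
  have hun : ‖u‖ = η * ‖z‖ := by
    rw [hu, norm_neg, norm_mul, Complex.norm_real, Real.norm_of_nonneg hη0.le]
  have hu1 : ‖u‖ ≤ 1 / 3 := by
    rw [hun]
    exact (mul_le_mul hη1 hz (norm_nonneg _) (by norm_num)).trans (by norm_num)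
  have h1 := Complex.norm_log_one_add_sub_quadratic_le (u := u) (by linarith)
  have h2 : ‖u‖ ^ 3 * (1 - ‖u‖)⁻¹ / 3 ≤ ‖u‖ ^ 3 / 2 := by
    have : (1 - ‖u‖)⁻¹ ≤ 3 / 2 := by
      rw [inv_le_comm₀ (by linarith) (by norm_num)]
      norm_num
      linarith
    have := mul_le_mul_of_nonneg_left this (pow_nonneg (norm_nonneg u) 3)
    linarith
  have hr : 0 < nbR l g := by rw [nbR]; positivity
  have hr1 : nbR l g * η = l := by
    rw [nbR, hη]
    field_simp
  have e : -(nbR l g * Complex.log (1 - (η : ℝ) * z)) - (l * z + g * z ^ 2) =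
      -(nbR l g * (Complex.log (1 + u) - (u - u ^ 2 / 2))) := by
    have c1 : (nbR l g : ℂ) * η = l := by exact_mod_cast hr1
    have c2 : (l : ℂ) * η = 2 * g := by
      have : l * η = 2 * g := by
        rw [hη]
        field_simp
      exact_mod_cast this
    rw [hu, ← sub_eq_add_neg]
    linear_combination z * c1 + η * z ^ 2 / 2 * c1 + z ^ 2 / 2 * c2
  have hmain : ‖-(nbR l g * Complex.log (1 - (η : ℝ) * z)) - (l * z + g * z ^ 2)‖ ≤
      2 * g ^ 2 / l * ‖z‖ ^ 3 := by
    rw [e, norm_neg, norm_mul, Complex.norm_real, Real.norm_of_nonneg hr.le]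
    calc _ ≤ nbR l g * (‖u‖ ^ 3 / 2) := by
          gcongr
          exact h1.trans h2
      _ = (nbR l g * η) * η ^ 2 / 2 * ‖z‖ ^ 3 := by
          rw [hun]
          ring
      _ = _ := by
          rw [hr1, hη]
          field_simp
  refine ⟨hmain, ?_⟩
  have h3 := (Complex.re_le_norm _).trans hmain
  rw [Complex.sub_re, Complex.add_re, Complex.re_ofReal_mul, Complex.re_ofReal_mul] at h3
  have h4 : (z ^ 2).re ≤ ‖z‖ ^ 2 := (Complex.re_le_norm _).trans (norm_pow z 2).le
  have h5 : 2 * g ^ 2 / l ≤ 0.02 * l := by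
    rw [div_le_iff₀ hl]
    norm_num at *
    nlinarith
  have h6 : 2 * g ^ 2 / l * ‖z‖ ^ 3 ≤ 0.02 * l * (‖z‖ ^ 2 * 2.002) := by
    rw [pow_succ ‖z‖ 2]
    gcongr
  have h7 : g * (z ^ 2).re ≤ 0.08 * l * ‖z‖ ^ 2 := by
    calc _ ≤ g * ‖z‖ ^ 2 := by gcongr
      _ ≤ _ := by gcongr
  have h8 : 0 ≤ l * ‖z‖ ^ 2 := by positivity
  norm_num at *
  linarith

/-- The unrounded number of trials satisfies `x ≥ 6.25 l ≥ 6.25`, so rounding down keeps `N ≥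
0.84x`; then `1/(0.84·6.25) < 0.1905` and `2/0.84 < 2.4`. The last bound is the rounding error
`|g|(x - N)/N`, with `x - N ≤ 1`. -/
theorem biN_spec (hl : 1 ≤ l) (hg : g < 0) (hgl : |g| ≤ 0.08 * l) :
    0 < (biN l g : ℝ) ∧ biP l g ≤ 0.1905 ∧ biP l g ≤ 2.4 * |g| / l ∧
      |l * biP l g / 2 - (|g|)| ≤ 2.4 * g ^ 2 / l ^ 2 := by
  have hl0 : 0 < l := by linarith
  have hg0 : 0 < |g| := abs_pos.2 hg.ne
  set x := l ^ 2 / (2 * |g|) with hx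
  have hx0 : 0 < x := by positivity
  have hxg : 2 * |g| * x = l ^ 2 := by
    rw [hx]
    field_simp
  have hx1 : 6.25 * l ≤ x := by
    rw [hx, le_div_iff₀ (by positivity)]
    norm_num at *
    nlinarith
  have hN1 : (biN l g : ℝ) ≤ x := Nat.floor_le hx0.le
  have hN2 : x < (biN l g : ℝ) + 1 := Nat.lt_floor_add_one x
  set N : ℝ := (biN l g : ℝ) with hN
  have hN3 : 0.84 * x ≤ N := by
    norm_num at *
    linarith
  have hN0 : 0 < N := by
    norm_num at *
    linarith
  have hp : biP l g = l / N := rfl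
  have hq : |g| / N ≤ 2.4 * |g| ^ 2 / l ^ 2 := by
    have hN4 : 21 / 25 * x ≤ N := by
      norm_num at *
      linarith
    rw [← hxg, div_le_div_iff₀ hN0 (by positivity), show (2.4 : ℝ) = 12 / 5 by norm_num]
    have hg2 := mul_pos hg0 hg0
    nlinarith [mul_le_mul_of_nonneg_left hN4 hg2.le, mul_pos hg2 hx0]
  refine ⟨hN0, ?_, ?_, ?_⟩
  · rw [hp, div_le_iff₀ hN0]
    norm_num at *
    linarith
  · rw [hp, div_le_div_iff₀ hN0 hl0]
    norm_num at *
    nlinarith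
  · have e : l * biP l g / 2 - |g| = |g| * (x - N) / N := by
      rw [hp]
      field_simp
      linear_combination -hxg
    rw [e, abs_of_nonneg (by have := sub_nonneg.2 hN1; positivity), ← sq_abs g]
    refine le_trans ?_ hq
    have : x - N ≤ 1 := by linarith
    gcongr
    nlinarith

/-- In `N log(1 + pz)` the linear term is exactly `lz`, the quadratic one `-(lp/2)z²` misses `gz²`
only through the rounding of `N`, and the cubic one has size `Np³ = lp² = O(g²/l)`. -/
theorem bi_exponent_bounds (hl : 1 ≤ l) (hg : g < 0) (hgl : |g| ≤ 0.08 * l) {z : ℂ}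
    (hz : ‖z‖ ≤ 2.002) :
    (1 + biP l g * z) ^ biN l g = Complex.exp (biN l g * Complex.log (1 + biP l g * z)) ∧
    ‖biN l g * Complex.log (1 + biP l g * z) - (l * z + g * z ^ 2)‖ ≤
        2.4 * g ^ 2 / l ^ 2 * ‖z‖ ^ 2 + 6 * g ^ 2 / l * ‖z‖ ^ 3 ∧
      (biN l g * Complex.log (1 + biP l g * z)).re ≤ l * z.re + 0.45 * l * ‖z‖ ^ 2 := by
  have hl0 : 0 < l := by linarith
  obtain ⟨hN, hp1, hp2, hp3⟩ := biN_spec hl hg hgl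
  have hNp : (biN l g : ℝ) * biP l g = l := by
    rw [biP]
    field_simp
  set p := biP l g with hp
  have hp0 : 0 ≤ p := by
    rw [hp, biP]
    positivity
  set u : ℂ := p * z with hu
  have hun : ‖u‖ = p * ‖z‖ := by
    rw [hu, norm_mul, Complex.norm_real, Real.norm_of_nonneg hp0]
  have hu1 : ‖u‖ ≤ 0.39 := by
    rw [hun]
    exact (mul_le_mul hp1 hz (norm_nonneg _) (by norm_num)).trans (by norm_num)
  have hu2 : ‖u‖ < 1 := by
    norm_num at *
    linarith
  have h1 := Complex.norm_log_one_add_sub_quadratic_le hu2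
  have h2 : ‖u‖ ^ 3 * (1 - ‖u‖)⁻¹ / 3 ≤ 0.6 * ‖u‖ ^ 3 := by
    have : (1 - ‖u‖)⁻¹ ≤ 1.8 := by
      rw [inv_le_comm₀ (by linarith) (by norm_num)]
      norm_num at *
      linarith
    have := mul_le_mul_of_nonneg_left this (pow_nonneg (norm_nonneg u) 3)
    norm_num at *
    linarith
  have h3 : ‖(biN l g : ℂ) * (Complex.log (1 + u) - (u - u ^ 2 / 2))‖ ≤
      0.6 * (l * p ^ 2) * ‖z‖ ^ 3 := by
    rw [norm_mul, Complex.norm_natCast]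
    calc _ ≤ (biN l g : ℝ) * (0.6 * ‖u‖ ^ 3) := by
          gcongr
          exact h1.trans h2
      _ = 0.6 * ((biN l g : ℝ) * p) * p ^ 2 * ‖z‖ ^ 3 := by
          rw [hun]
          ring
      _ = _ := by
          rw [hNp]
          ring
  have c1 : (biN l g : ℂ) * p = l := by exact_mod_cast hNp
  refine ⟨?_, ?_, ?_⟩
  · have hne : 1 + u ≠ 0 := by
      intro h0
      have : u = -1 := by linear_combination h0
      rw [this, norm_neg, norm_one] at hu2
      exact lt_irrefl _ hu2
    rw [Complex.exp_nat_mul, Complex.exp_log hne]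
  · have e : biN l g * Complex.log (1 + u) - (l * z + g * z ^ 2) =
        -((l * p / 2 - |g| : ℝ) * z ^ 2) +
          biN l g * (Complex.log (1 + u) - (u - u ^ 2 / 2)) := by
      rw [abs_of_neg hg, hu]
      push_cast
      linear_combination (z - p * z ^ 2 / 2) * c1
    rw [e]
    refine norm_add_le_of_le ?_ (h3.trans ?_)
    · rw [norm_neg, norm_mul, Complex.norm_real, norm_pow, Real.norm_eq_abs]
      gcongr
    · gcongr
      calc 0.6 * (l * p ^ 2) ≤ 0.6 * (l * (2.4 * |g| / l) ^ 2) := by gcongr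
        _ = 3.456 * g ^ 2 / l := by
          rw [div_pow, mul_pow, sq_abs]
          field_simp
          ring
        _ ≤ _ := by
          gcongr
          norm_num
  · have e : (biN l g : ℂ) * Complex.log (1 + u) = l * z + (-(l * p / 2 : ℝ) * z ^ 2 +
          biN l g * (Complex.log (1 + u) - (u - u ^ 2 / 2))) := by
      rw [hu]
      push_cast
      linear_combination (z - p * z ^ 2 / 2) * c1
    rw [e, Complex.add_re, Complex.re_ofReal_mul]
    have h4 : ‖-(l * p / 2 : ℝ) * z ^ 2‖ ≤ 0.1 * l * ‖z‖ ^ 2 := by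
      rw [norm_mul, norm_neg, Complex.norm_real, norm_pow, Real.norm_of_nonneg (by positivity)]
      gcongr
      norm_num at *
      nlinarith
    have h5 : 0.6 * (l * p ^ 2) * ‖z‖ ^ 3 ≤ 0.06 * l * ‖z‖ ^ 2 := by
      calc 0.6 * (l * p ^ 2) * ‖z‖ ^ 3 ≤ 0.6 * (l * 0.1905 ^ 2) * (‖z‖ ^ 2 * 2.002) := by
            rw [pow_succ ‖z‖ 2]
            gcongr
        _ = 0.6 * 0.1905 ^ 2 * 2.002 * (l * ‖z‖ ^ 2) := by ring
        _ ≤ 0.06 * (l * ‖z‖ ^ 2) := by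
            gcongr
            norm_num
        _ = _ := by ring
    have h6 := (Complex.re_le_norm _).trans (norm_add_le_of_le h4 (h3.trans h5))
    have h8 : 0 ≤ l * ‖z‖ ^ 2 := by positivity
    norm_num at *
    linarith

end Exponents

/-! ### Comparison of the sum with an approximating measure -/

namespace BoundedOneDependent

variable {Ω : Type*} [MeasurableSpace Ω] {μ : Measure Ω} [IsProbabilityMeasure μ]
  {X : ℤ → Ω → ℕ} {n b : ℕ}

theorem hasGen_sumLaw (h : BoundedOneDependent μ X n b) (s : ℂ) :
    HasGen (sumLaw μ X n) s (∫ ω, Complex.exp (s * partialSum X n ω) ∂μ) := by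
  have hm : Measurable (partialSum X n) := Finset.measurable_fun_sum _ fun i hi =>
    h.measurable (Finset.mem_Icc.1 hi).2
  have hbd : ∀ᵐ ω ∂μ, partialSum X n ω ∈ Finset.range (n * b + 1) := by
    filter_upwards [h.bdd] with ω hω
    rw [Finset.mem_range, Nat.lt_succ_iff, partialSum]
    calc _ ≤ ∑ i ∈ Finset.Icc (1 : ℤ) n, b :=
          Finset.sum_le_sum fun i hi => hω i (Finset.mem_Icc.1 hi).2
      _ = n * b := by simp
  have hset : ∀ k, MeasurableSet {ω | partialSum X n ω = k} := fun k =>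
    hm (measurableSet_singleton k)
  have e : ∫ ω, Complex.exp (s * partialSum X n ω) ∂μ = ∑ k ∈ Finset.range (n * b + 1),
      (μ.real {ω | partialSum X n ω = k} : ℂ) * Complex.exp s ^ k := by
    have e1 : ∫ ω, Complex.exp (s * partialSum X n ω) ∂μ =
        ∫ ω, ∑ k ∈ Finset.range (n * b + 1),
          Set.indicator {ω | partialSum X n ω = k} (fun _ => Complex.exp s ^ k) ω ∂μ := by
      refine integral_congr_ae ?_
      filter_upwards [hbd] with ω hω
      rw [Finset.sum_eq_single_of_mem _ hω]
      · rw [Set.indicator_of_mem (by simp), mul_comm, Complex.exp_nat_mul]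
      · intro k _ hk
        exact Set.indicator_of_notMem (fun h => hk h.symm) _
    rw [e1, integral_finsetSum _ fun k _ => (integrable_const _).indicator (hset k)]
    refine Finset.sum_congr rfl fun k _ => ?_
    rw [integral_indicator_const _ (hset k), Complex.real_smul]
  refine hasGen_onNat ?_
  rw [e]
  refine hasSum_sum_of_ne_finset_zero fun k hk => ?_
  have : μ {ω | partialSum X n ω = k} = 0 := by
    refine measure_mono_null (fun ω hω => ?_) hbd
    simp only [Set.mem_ofPred_eq] at hω
    subst hω
    exact hk
  simp [measureReal_def, this]

/-- Comparison of the law of the sum with a measure `A` through the logarithm `L` of the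
generating function of the sum. -/
theorem wassersteinNorm_sumLaw_sub_le (h : BoundedOneDependent μ X n b) (hs : SmallMoments μ X n)
    (hb : 1 ≤ b) (hl : 1 ≤ lam μ X n) {A : ℤ → ℝ} (φ : ℂ → ℂ)
    (hA : ∀ s : ℂ, |s.re| ≤ 1 / 1000 → HasGen A s (φ s)) (hφ0 : φ 0 = 1) {b₁ b₂ b₃ : ℝ}
    (h₁ : 0 ≤ b₁) (h₂ : 0 ≤ b₂) (h₃ : 0 ≤ b₃)
    (hbd : ∀ (v t : ℝ) (L z : ℂ), InStrip (lam μ X n) v t →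
      z = Complex.exp (v + t * Complex.I) - 1 → ‖z‖ ≤ 2.002 →
      lam μ X n * z.re + 0.45 * lam μ X n * ‖z‖ ^ 2 ≤ lam μ X n * v + 1 - lam μ X n * t ^ 2 / 100 →
      L.re ≤ lam μ X n * v + 1 - lam μ X n * t ^ 2 / 100 →
      ‖L - lam μ X n * z‖ ≤ 17 * R0 μ X n * ‖z‖ ^ 2 →
      ‖L - (lam μ X n * z + Gam2 μ X n * z ^ 2)‖ ≤ 310 * R1 μ X n * ‖z‖ ^ 3 →
      ‖Complex.exp L - φ (v + t * Complex.I)‖ ≤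
        (b₁ * ‖z‖ ^ 2 + b₂ * ‖z‖ ^ 3 + b₃ * ‖z‖ ^ 4) *
          Real.exp (lam μ X n * v + 1 - lam μ X n * t ^ 2 / 100)) :
    wassersteinNorm (sumLaw μ X n - A) ≤ ENNReal.ofReal (270000000000 * b *
      (b₁ / √(lam μ X n) + b₂ / lam μ X n + b₃ / (lam μ X n * √(lam μ X n)))) := by
  set l := lam μ X n with hldef
  have hl0 : 0 < l := by linarith
  have hsq : 1 ≤ √l := Real.one_le_sqrt.2 hl
  have hb1 : (1 : ℝ) ≤ b := by exact_mod_cast hb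
  -- On the lines `|v| = 1/(1000 b √λ)` one has `|v| X_k ≤ 1/1000` almost surely, which makes `W =
  -- 1.002` admissible. This is how `b` enters the constant.
  have hκ : (1 : ℝ) / (1000 * b) ≤ 1 / 1000 := by
    apply one_div_le_one_div_of_le <;> linarith
  have hv1 : ∀ v : ℝ, |v| = 1 / (1000 * b) / √l → |v| * b ≤ 1 / 1000 := by
    intro v hv
    rw [hv]
    have : 1 / (1000 * (b : ℝ)) / √l * b = 1 / 1000 / √l := by field_simp
    rw [this]
    exact div_le_self (by norm_num) hsq
  have hv2 : ∀ v : ℝ, |v| = 1 / (1000 * b) / √l → |v| ≤ 1 / 1000 := fun v hv =>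
    (le_mul_of_one_le_right (abs_nonneg v) hb1).trans (hv1 v hv)
  have key := wassersteinNorm_le_of_transform (M := sumLaw μ X n - A) (l := l)
    (κ := 1 / (1000 * b)) hl (by positivity) hκ h₁ h₂ h₃ ?_
    (fun s => ∫ ω, Complex.exp (s * partialSum X n ω) ∂μ - φ s) ?_ ?_
  · refine key.trans (le_of_eq ?_)
    congr 1
    field_simp
    ring
  · have := (h.hasGen_sumLaw 0).sub (hA 0 (by simp))
    simpa [hφ0] using this
  · intro v hv t
    exact (h.hasGen_sumLaw _).sub (hA _ (by simpa using hv2 v hv))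
  · intro v t hv hst
    have hre : ((v : ℂ) + t * Complex.I).re = v := by simp
    have hW' : Real.exp (1 / 1000) ≤ 1.002 := by
      have := (abs_le.1 (Real.abs_exp_sub_one_sub_id_le (x := 1 / 1000) (by norm_num))).2
      norm_num at *
      linarith
    obtain ⟨L, hL, hL1, hL2, hL3⟩ := h.exists_log_gen hs hb (s := v + t * Complex.I)
      (W := 1.002) (by
        rw [hre]
        exact (Real.exp_le_exp.2 (hv1 v hv)).trans hW') le_rfl
    rw [← hL]
    set z := Complex.exp (v + t * Complex.I) - 1 with hz
    have hz3 : 0 ≤ ‖z‖ ^ 3 := by positivity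
    have hz2 : 0 ≤ ‖z‖ ^ 2 := by positivity
    -- The powers of `W = 1.002` turn `0.4`, `16`, `300` into at most `0.45`, `17`, `310`.
    refine hbd v t L z hst rfl hst.norm_z_le_two hst.re_exponent_le ?_ ?_ ?_
    · refine hL1.trans (le_trans ?_ hst.re_exponent_le)
      rw [← hz, ← hldef, mul_pow]
      have : 0 ≤ l * ‖z‖ ^ 2 := by positivity
      norm_num at *
      linarith
    · refine hL2.trans ?_
      rw [mul_pow]
      have : 0 ≤ R0 μ X n * ‖z‖ ^ 2 := mul_nonneg (R0_nonneg μ X n) hz2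
      norm_num at *
      linarith
    · refine hL3.trans ?_
      rw [mul_pow]
      have : 0 ≤ R1 μ X n * ‖z‖ ^ 3 := mul_nonneg (R1_nonneg μ X n) hz3
      norm_num at *
      linarith

/-- Comparison of the law of the sum with a measure with transform `e^T`, where `T` is close to
`λ z + Γ₂ z²`. -/
theorem wassersteinNorm_sumLaw_sub_exp_le (h : BoundedOneDependent μ X n b)
    (hs : SmallMoments μ X n) (hb : 1 ≤ b) (hl : 1 ≤ lam μ X n) {A : ℤ → ℝ} (T : ℂ → ℂ)
    (hA : ∀ s : ℂ, |s.re| ≤ 1 / 1000 → HasGen A s (Complex.exp (T s)))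
    (hT0 : Complex.exp (T 0) = 1) {b₁ b₂ : ℝ} (h₁ : 0 ≤ b₁) (h₂ : 0 ≤ b₂)
    (hbd : ∀ (v t : ℝ) (z : ℂ), InStrip (lam μ X n) v t →
      z = Complex.exp (v + t * Complex.I) - 1 → ‖z‖ ≤ 2.002 →
      lam μ X n * z.re + 0.45 * lam μ X n * ‖z‖ ^ 2 ≤ lam μ X n * v + 1 - lam μ X n * t ^ 2 / 100 →
      (T (v + t * Complex.I)).re ≤ lam μ X n * v + 1 - lam μ X n * t ^ 2 / 100 ∧
      ‖T (v + t * Complex.I) - (lam μ X n * z + Gam2 μ X n * z ^ 2)‖ ≤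
        b₁ * ‖z‖ ^ 2 + b₂ * ‖z‖ ^ 3) :
    wassersteinNorm (sumLaw μ X n - A) ≤ ENNReal.ofReal (270000000000 * b *
      (b₁ / √(lam μ X n) + (310 * R1 μ X n + b₂) / lam μ X n)) := by
  have hR1 := R1_nonneg μ X n
  have key := h.wassersteinNorm_sumLaw_sub_le hs hb hl (fun s => Complex.exp (T s)) hA hT0 h₁
    (b₂ := 310 * R1 μ X n + b₂) (b₃ := 0) (by positivity) le_rfl ?_
  · simpa using key
  · intro v t L z hst hz hz2 hre hL1 _ hL3
    obtain ⟨hT1, hT2⟩ := hbd v t z hst hz hz2 hre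
    refine (Complex.norm_exp_sub_exp_le hL1 hT1).trans ?_
    rw [mul_comm]
    gcongr
    have e : L - T (v + t * Complex.I) = (L - (lam μ X n * z + Gam2 μ X n * z ^ 2)) -
        (T (v + t * Complex.I) - (lam μ X n * z + Gam2 μ X n * z ^ 2)) := by ring
    rw [e]
    refine (norm_sub_le_of_le hL3 hT2).trans (le_of_eq ?_)
    ring

/-! ### The six approximations -/

section Approximations

variable (h : BoundedOneDependent μ X n b) (hs : SmallMoments μ X n) (hb : 1 ≤ b)
  (hl : 1 ≤ lam μ X n)

include h hs hb hl

theorem wassersteinNorm_sub_poisson_le :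
    wassersteinNorm (sumLaw μ X n - poissonMass (lam μ X n)) ≤
      ENNReal.ofReal (270000000000 * b * (17 * R0 μ X n / √(lam μ X n))) := by
  have hR0 := R0_nonneg μ X n
  have key := h.wassersteinNorm_sumLaw_sub_le hs hb hl
    (fun s => Complex.exp (lam μ X n * (Complex.exp s - 1))) (fun s _ => hasGen_poisson _ s)
    (by simp) (b₁ := 17 * R0 μ X n) (b₂ := 0) (b₃ := 0) (by positivity) le_rfl le_rfl ?_
  · simpa using key
  · intro v t L z hst hz hz2 hre hL1 hL2 _
    rw [← hz]
    have hT : (lam μ X n * z).re ≤ lam μ X n * v + 1 - lam μ X n * t ^ 2 / 100 := by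
      rw [Complex.re_ofReal_mul]
      have : 0 ≤ 0.45 * lam μ X n * ‖z‖ ^ 2 := by positivity
      linarith
    refine (Complex.norm_exp_sub_exp_le hL1 hT).trans ?_
    rw [mul_comm]
    gcongr
    refine hL2.trans (le_of_eq ?_)
    ring

theorem wassersteinNorm_sub_poisson_sub_correction_le :
    wassersteinNorm (sumLaw μ X n - poissonMass (lam μ X n)
        - poissonCorrection (lam μ X n) (Gam2 μ X n)) ≤
      ENNReal.ofReal (270000000000 * b * (310 * R1 μ X n / lam μ X n +
        Gam2 μ X n ^ 2 / (lam μ X n * √(lam μ X n)))) := by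
  have hR1 := R1_nonneg μ X n
  have hg := h.abs_Gam2_le hs
  rw [sub_sub]
  have key := h.wassersteinNorm_sumLaw_sub_le hs hb hl
    (A := poissonMass (lam μ X n) + poissonCorrection (lam μ X n) (Gam2 μ X n))
    (fun s => Complex.exp (lam μ X n * (Complex.exp s - 1)) +
      Complex.exp (lam μ X n * (Complex.exp s - 1)) * (Gam2 μ X n * (Complex.exp s - 1) ^ 2))
    (fun s _ => by
      have := HasSum.add (hasGen_poisson (lam μ X n) s)
        (hasGen_poissonCorrection (lam μ X n) (Gam2 μ X n) s)
      unfold HasGen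
      convert! this using 1
      funext k
      simp only [Pi.add_apply]
      push_cast
      ring)
    (by simp) (b₁ := 0) (b₂ := 310 * R1 μ X n) (b₃ := Gam2 μ X n ^ 2) le_rfl (by positivity)
    (sq_nonneg _) ?_
  · simpa using key
  · intro v t L z hst hz hz2 hre hL1 _ hL3
    rw [← hz]
    set l := lam μ X n
    set g := Gam2 μ X n
    have hgz : ‖(g : ℂ) * z ^ 2‖ = |g| * ‖z‖ ^ 2 := by
      rw [norm_mul, norm_pow, Complex.norm_real, Real.norm_eq_abs]
    have hgz' : |g| * ‖z‖ ^ 2 ≤ 0.45 * l * ‖z‖ ^ 2 := by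
      gcongr
      norm_num at *
      linarith
    have hG : (l * z + g * z ^ 2).re ≤ l * v + 1 - l * t ^ 2 / 100 := by
      rw [Complex.add_re, Complex.re_ofReal_mul]
      have := (Complex.re_le_norm _).trans hgz.le
      linarith
    have h1 := Complex.norm_exp_sub_exp_le hL1 hG
    have h2 : ‖Complex.exp (l * z) * (Complex.exp (g * z ^ 2) - 1 - g * z ^ 2)‖ ≤
        g ^ 2 * ‖z‖ ^ 4 * Real.exp (l * v + 1 - l * t ^ 2 / 100) := by
      have h3 := Complex.norm_exp_sub_one_sub_le ((g : ℂ) * z ^ 2)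
      rw [hgz] at h3
      rw [norm_mul, Complex.norm_exp, Complex.re_ofReal_mul]
      calc _ ≤ Real.exp (l * z.re) * ((|g| * ‖z‖ ^ 2) ^ 2 * Real.exp (|g| * ‖z‖ ^ 2)) := by
            gcongr
        _ = |g| ^ 2 * ‖z‖ ^ 4 * Real.exp (l * z.re + |g| * ‖z‖ ^ 2) := by
            rw [Real.exp_add]
            ring
        _ ≤ _ := by
            rw [sq_abs]
            gcongr
            linarith
    -- Inserting `e^{lz + gz²}` leaves the error of linearizing `e^{gz²}`, of size `g²‖z‖⁴`.
    have e : Complex.exp L - (Complex.exp (l * z) + Complex.exp (l * z) * (g * z ^ 2)) =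
        (Complex.exp L - Complex.exp (l * z + g * z ^ 2)) +
          Complex.exp (l * z) * (Complex.exp (g * z ^ 2) - 1 - g * z ^ 2) := by
      rw [Complex.exp_add]
      ring
    rw [e]
    refine (norm_add_le_of_le h1 h2).trans ?_
    have h4 := mul_le_mul_of_nonneg_left hL3 (Real.exp_pos (l * v + 1 - l * t ^ 2 / 100)).le
    linarith

theorem wassersteinNorm_sub_compoundPoisson_le :
    wassersteinNorm (sumLaw μ X n - compoundPoissonMass (lam μ X n) (Gam2 μ X n)) ≤
      ENNReal.ofReal (270000000000 * b * (310 * R1 μ X n / lam μ X n)) := by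
  have hg := h.abs_Gam2_le hs
  have key := h.wassersteinNorm_sumLaw_sub_exp_le hs hb hl
    (fun s => lam μ X n * (Complex.exp s - 1) + Gam2 μ X n * (Complex.exp s - 1) ^ 2)
    (fun s _ => hasGen_compoundPoisson _ _ s) (by simp) (b₁ := 0) (b₂ := 0) le_rfl le_rfl ?_
  · simpa using key
  · intro v t z hst hz hz2 hre
    rw [← hz]
    refine ⟨?_, by simp⟩
    rw [Complex.add_re, Complex.re_ofReal_mul]
    have h1 : (Gam2 μ X n * z ^ 2).re ≤ 0.45 * lam μ X n * ‖z‖ ^ 2 := by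
      refine (Complex.re_le_norm _).trans ?_
      rw [norm_mul, norm_pow, Complex.norm_real, Real.norm_eq_abs]
      gcongr
      norm_num at *
      linarith
    linarith

theorem wassersteinNorm_sub_translatedPoisson_le :
    wassersteinNorm (sumLaw μ X n - translatedPoissonMass (lam μ X n) (Gam2 μ X n)) ≤
      ENNReal.ofReal (270000000000 * b * (Int.fract (-2 * Gam2 μ X n) / 2 / √(lam μ X n) +
        (310 * R1 μ X n + 200000 * (2 * |Gam2 μ X n| + Int.fract (-2 * Gam2 μ X n))) /
          lam μ X n)) := by
  have hg := abs_le.1 (h.abs_Gam2_le hs)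
  have hd0 := Int.fract_nonneg (-2 * Gam2 μ X n)
  have hd1 := Int.fract_lt_one (-2 * Gam2 μ X n)
  have hm : (⌊-2 * Gam2 μ X n⌋ : ℝ) = -2 * Gam2 μ X n - Int.fract (-2 * Gam2 μ X n) := by
    rw [Int.fract]
    ring
  refine h.wassersteinNorm_sumLaw_sub_exp_le hs hb hl
    (fun s => ⌊-2 * Gam2 μ X n⌋ * s + (lam μ X n - ⌊-2 * Gam2 μ X n⌋ : ℝ) * (Complex.exp s - 1))
    (fun s _ => hasGen_translatedPoisson _ _ s) (by simp)
    (by positivity) (by positivity) ?_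
  intro v t z hst hz hz2 hre
  have hm' : ((⌊-2 * Gam2 μ X n⌋ : ℤ) : ℂ) = ((⌊-2 * Gam2 μ X n⌋ : ℝ) : ℂ) := by push_cast; rfl
  have h3 := hst.norm_s_sub_le
  rw [← hz] at h3 ⊢
  rw [hm']
  set l := lam μ X n
  set g := Gam2 μ X n
  set d := Int.fract (-2 * g)
  set m : ℝ := (⌊-2 * g⌋ : ℝ)
  constructor
  · have := hst.re_translated_exponent_le (m := m) (by norm_num at *; linarith)
      (by norm_num at *; linarith)
    rwa [← hz] at this
  -- As `m = -2g - d`, replacing `s` by `z - z²/2` turns the exponent into `lz + gz² + (d/2)z²`: the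
  -- fractional part is the only second-order error.
  · have e : (m : ℂ) * (v + t * Complex.I) + (l - m : ℝ) * z - (l * z + g * z ^ 2) =
        (d / 2 : ℝ) * z ^ 2 + m * ((v + t * Complex.I : ℂ) - z + z ^ 2 / 2) := by
      have hmc : (m : ℂ) = -2 * g - d := by exact_mod_cast hm
      push_cast
      linear_combination (-z ^ 2 / 2) * hmc
    rw [e]
    have hmabs : |m| ≤ 2 * |g| + d := by
      rw [hm]
      refine (abs_sub _ _).trans (le_of_eq ?_)
      rw [abs_mul, abs_of_nonneg hd0]
      norm_num
    refine norm_add_le_of_le ?_ ?_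
    · rw [norm_mul, norm_pow, Complex.norm_real, Real.norm_of_nonneg (by positivity)]
    · rw [norm_mul, Complex.norm_real, Real.norm_eq_abs]
      calc _ ≤ (2 * |g| + d) * (200000 * ‖z‖ ^ 3) := by gcongr
        _ = _ := by ring

theorem wassersteinNorm_sub_negBinomial_le (hg0 : 0 < Gam2 μ X n) :
    wassersteinNorm (sumLaw μ X n - negBinomialMass (nbR (lam μ X n) (Gam2 μ X n))
        (nbQ (lam μ X n) (Gam2 μ X n))) ≤
      ENNReal.ofReal (270000000000 * b *
        ((310 * R1 μ X n + 2 * Gam2 μ X n ^ 2 / lam μ X n) / lam μ X n)) := by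
  have hg := (abs_le.1 (h.abs_Gam2_le hs)).2
  have hl0 : 0 < lam μ X n := by linarith
  obtain ⟨hq0, hq1, hq2, hq3⟩ := nbQ_spec hl0 hg0 hg
  have key := h.wassersteinNorm_sumLaw_sub_exp_le hs hb hl
    (A := negBinomialMass (nbR (lam μ X n) (Gam2 μ X n)) (nbQ (lam μ X n) (Gam2 μ X n)))
    (fun s => -(nbR (lam μ X n) (Gam2 μ X n) *
      Complex.log (1 - (2 * Gam2 μ X n / lam μ X n : ℝ) * (Complex.exp s - 1))))
    (fun s hsre => ?_) (by simp) (b₁ := 0)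
    (b₂ := 2 * Gam2 μ X n ^ 2 / lam μ X n) le_rfl (by positivity) ?_
  · simpa using key
  · rw [← hq3]
    -- `1 - q ≤ 0.16` puts the singularity far outside the strip.
    refine hasGen_negBinomial (by rw [nbR]; positivity) hq0 hq1 ?_
    rw [Complex.norm_exp]
    have h1 : Real.exp s.re ≤ 3 := by
      calc Real.exp s.re ≤ Real.exp 1 := by
            rw [Real.exp_le_exp]
            linarith [le_abs_self s.re]
        _ ≤ 3 := by linarith [Real.exp_one_lt_d9]
    calc _ ≤ 0.16 * 3 := mul_le_mul hq2 h1 (Real.exp_pos _).le (by norm_num)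
      _ < 1 := by norm_num
  · intro v t z hst hz hz2 hre
    rw [← hz]
    obtain ⟨hT1, hT2⟩ := nb_exponent_bounds hl0 hg0 hg hz2
    exact ⟨hT2.trans hre, by simpa using hT1⟩

theorem wassersteinNorm_sub_binomial_le (hg0 : Gam2 μ X n < 0) :
    wassersteinNorm (sumLaw μ X n - binomialMass (biN (lam μ X n) (Gam2 μ X n))
        (biP (lam μ X n) (Gam2 μ X n))) ≤
      ENNReal.ofReal (270000000000 * b *
        (2.4 * Gam2 μ X n ^ 2 / lam μ X n ^ 2 / √(lam μ X n) +
          (310 * R1 μ X n + 6 * Gam2 μ X n ^ 2 / lam μ X n) / lam μ X n)) := by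
  have hg := h.abs_Gam2_le hs
  have hl0 : 0 < lam μ X n := by linarith
  obtain ⟨hN, hp1, -, -⟩ := biN_spec hl hg0 hg
  have hp0 : 0 ≤ biP (lam μ X n) (Gam2 μ X n) := by
    rw [biP]
    positivity
  refine h.wassersteinNorm_sumLaw_sub_exp_le hs hb hl
    (fun s => biN (lam μ X n) (Gam2 μ X n) *
      Complex.log (1 + biP (lam μ X n) (Gam2 μ X n) * (Complex.exp s - 1)))
    (fun s hsre => ?_) (by simp) (by positivity) (by positivity) ?_
  · have hz : ‖(biP (lam μ X n) (Gam2 μ X n) : ℂ) * (Complex.exp s - 1)‖ < 1 := by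
      rw [norm_mul, Complex.norm_real, Real.norm_of_nonneg hp0]
      have h1 : ‖Complex.exp s - 1‖ ≤ 4 := by
        refine (norm_sub_le _ _).trans ?_
        rw [Complex.norm_exp, norm_one]
        have : Real.exp s.re ≤ Real.exp 1 := by
          rw [Real.exp_le_exp]
          linarith [le_abs_self s.re]
        linarith [Real.exp_one_lt_d9]
      calc _ ≤ 0.1905 * 4 := mul_le_mul hp1 h1 (norm_nonneg _) (by norm_num)
        _ < 1 := by norm_num
    have hne : 1 + (biP (lam μ X n) (Gam2 μ X n) : ℂ) * (Complex.exp s - 1) ≠ 0 := by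
      intro h0
      rw [← neg_eq_of_add_eq_zero_right h0, norm_neg, norm_one] at hz
      exact lt_irrefl _ hz
    rw [Complex.exp_nat_mul, Complex.exp_log hne]
    exact hasGen_binomial _ _ s
  · intro v t z hst hz hz2 hre
    rw [← hz]
    obtain ⟨-, hT1, hT2⟩ := bi_exponent_bounds hl hg0 hg hz2
    exact ⟨hT2.trans hre, hT1⟩

end Approximations

end BoundedOneDependent

/-! ### Choice of the constant and conclusion -/

theorem theorem2 (C₀ : ℝ) :
    ∃ C : ℝ, 0 < C ∧
      ∀ (Ω : Type*) [MeasurableSpace Ω] (μ : Measure Ω) [IsProbabilityMeasure μ]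
        (n : ℕ) (X : ℤ → Ω → ℕ),
        (∀ k ≤ 0, ∀ ω, X k ω = 0) →
        (∀ k ∈ Set.Icc (1 : ℤ) n, Measurable (X k)) →
        IsOneDependent μ X n →
        (∀ k ∈ Set.Icc (1 : ℤ) n, nu μ X 1 k ≤ 1 / 100 ∧ nu μ X 2 k ≤ nu μ X 1 k ∧
          ∀ᵐ ω ∂μ, |(X k ω : ℝ)| ≤ C₀) →
        1 ≤ lam μ X n →
        ∑ k ∈ Finset.Icc (1 : ℤ) n, nu μ X 2 k ≤ lam μ X n / 20 →
        ∑ k ∈ Finset.Icc (2 : ℤ) n,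
          |covariance (fun ω => (X (k - 1) ω : ℝ)) (fun ω => (X k ω : ℝ)) μ| ≤ lam μ X n / 20 →
        wassersteinNorm (sumLaw μ X n - poissonMass (lam μ X n)) ≤
          ENNReal.ofReal (C * (R0 μ X n / √(lam μ X n))) ∧
        wassersteinNorm (sumLaw μ X n - poissonMass (lam μ X n)
            - poissonCorrection (lam μ X n) (Gam2 μ X n)) ≤
          ENNReal.ofReal (C * (R0 μ X n ^ 2 / (lam μ X n * √(lam μ X n))
            + R1 μ X n / lam μ X n)) ∧
        wassersteinNorm (sumLaw μ X n - compoundPoissonMass (lam μ X n) (Gam2 μ X n)) ≤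
          ENNReal.ofReal (C * (R1 μ X n / lam μ X n)) ∧
        wassersteinNorm (sumLaw μ X n - translatedPoissonMass (lam μ X n) (Gam2 μ X n)) ≤
          ENNReal.ofReal (C * ((R1 μ X n + |Gam2 μ X n|) / lam μ X n
            + Int.fract (-2 * Gam2 μ X n) / √(lam μ X n))) ∧
        (0 < Gam2 μ X n →
          wassersteinNorm (sumLaw μ X n - negBinomialMass (nbR (lam μ X n) (Gam2 μ X n))
              (nbQ (lam μ X n) (Gam2 μ X n))) ≤
            ENNReal.ofReal (C * (R1 μ X n / lam μ X n + Gam2 μ X n ^ 2 / lam μ X n ^ 2))) ∧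
        (Gam2 μ X n < 0 →
          wassersteinNorm (sumLaw μ X n - binomialMass (biN (lam μ X n) (Gam2 μ X n))
              (biP (lam μ X n) (Gam2 μ X n))) ≤
            ENNReal.ofReal (C * (R1 μ X n / lam μ X n + Gam2 μ X n ^ 2 / lam μ X n ^ 2))) := by
  obtain ⟨b, hb1, hbC⟩ : ∃ b : ℕ, 1 ≤ b ∧ C₀ ≤ b :=
    ⟨max 1 ⌈C₀⌉₊, le_max_left _ _,
      (Nat.le_ceil C₀).trans (by exact_mod_cast le_max_right _ _)⟩
  have hb0 : (0 : ℝ) < b := by exact_mod_cast hb1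
  -- The factor `10⁶` dominates the remaining numerical constants, the largest being `400000` for
  -- the translated Poisson law.
  refine ⟨270000000000 * b * 1000000, by positivity, ?_⟩
  intro Ω _ μ _ n X h0 hmeas hdep hk hl hnu2 hcov
  have h : BoundedOneDependent μ X n b := by
    refine ⟨h0, hmeas, hdep, ?_⟩
    rw [ae_all_iff]
    intro i
    rcases le_or_gt i 0 with hi | hi
    · exact Filter.Eventually.of_forall fun ω _ => by simp [h0 i hi]
    · by_cases hin : i ≤ (n : ℤ)
      · filter_upwards [(hk i ⟨hi, hin⟩).2.2] with ω hω _
        rw [abs_of_nonneg (by positivity)] at hω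
        exact_mod_cast hω.trans hbC
      · exact Filter.Eventually.of_forall fun ω hi' => absurd hi' hin
  have hs : BoundedOneDependent.SmallMoments μ X n :=
    ⟨fun k hk' => (hk k hk').1, hnu2, hcov⟩
  have hR0 := BoundedOneDependent.R0_nonneg μ X n
  have hR1 := BoundedOneDependent.R1_nonneg μ X n
  have hgR := h.abs_Gam2_le_R0
  set l := lam μ X n with hldef
  have hl0 : 0 < l := by linarith
  have hsq : 1 ≤ √l := Real.one_le_sqrt.2 hl
  have hR1l : 0 ≤ R1 μ X n / l := by positivity
  have hgg : 0 ≤ Gam2 μ X n ^ 2 / l ^ 2 := by positivity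
  refine ⟨?_, ?_, ?_, ?_, fun hg => ?_, fun hg => ?_⟩
  · refine (h.wassersteinNorm_sub_poisson_le hs hb1 hl).trans (ENNReal.ofReal_le_ofReal ?_)
    rw [mul_assoc (270000000000 * (b : ℝ))]
    gcongr
    rw [← hldef, mul_div_assoc]
    have : 0 ≤ R0 μ X n / √l := by positivity
    linarith
  · refine (h.wassersteinNorm_sub_poisson_sub_correction_le hs hb1 hl).trans
      (ENNReal.ofReal_le_ofReal ?_)
    rw [mul_assoc (270000000000 * (b : ℝ))]
    gcongr
    rw [← hldef, mul_div_assoc]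
    have h1 : Gam2 μ X n ^ 2 / (l * √l) ≤ 4 * (R0 μ X n ^ 2 / (l * √l)) := by
      rw [← mul_div_assoc]
      gcongr
      have : |Gam2 μ X n| ^ 2 ≤ (2 * R0 μ X n) ^ 2 := by gcongr
      rw [sq_abs] at this
      linarith
    have : 0 ≤ R0 μ X n ^ 2 / (l * √l) := by positivity
    linarith
  · refine (h.wassersteinNorm_sub_compoundPoisson_le hs hb1 hl).trans
      (ENNReal.ofReal_le_ofReal ?_)
    rw [mul_assoc (270000000000 * (b : ℝ))]
    gcongr
    rw [← hldef, mul_div_assoc]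
    linarith
  · refine (h.wassersteinNorm_sub_translatedPoisson_le hs hb1 hl).trans
      (ENNReal.ofReal_le_ofReal ?_)
    rw [mul_assoc (270000000000 * (b : ℝ))]
    gcongr
    rw [← hldef]
    have hd0 := Int.fract_nonneg (-2 * Gam2 μ X n)
    set d := Int.fract (-2 * Gam2 μ X n)
    -- As `λ ≥ 1`, the third-order effect of the fractional part is absorbed by the second-order
    -- one.
    have h1 : d / l ≤ d / √l := by
      gcongr
      calc √l ≤ √l * √l := le_mul_of_one_le_left (by positivity) hsq
        _ = l := Real.mul_self_sqrt hl0.le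
    have h2 : 0 ≤ d / √l := by positivity
    have h3 : 0 ≤ |Gam2 μ X n| / l := by positivity
    have e : d / 2 / √l + (310 * R1 μ X n + 200000 * (2 * |Gam2 μ X n| + d)) / l =
        (d / √l) / 2 + 310 * (R1 μ X n / l) + 400000 * (|Gam2 μ X n| / l) +
          200000 * (d / l) := by ring
    rw [e, add_div]
    linarith
  · refine (h.wassersteinNorm_sub_negBinomial_le hs hb1 hl hg).trans
      (ENNReal.ofReal_le_ofReal ?_)
    rw [mul_assoc (270000000000 * (b : ℝ))]
    gcongr
    rw [← hldef]
    have e : (310 * R1 μ X n + 2 * Gam2 μ X n ^ 2 / l) / l =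
        310 * (R1 μ X n / l) + 2 * (Gam2 μ X n ^ 2 / l ^ 2) := by
      field_simp
    rw [e]
    linarith
  · refine (h.wassersteinNorm_sub_binomial_le hs hb1 hl hg).trans
      (ENNReal.ofReal_le_ofReal ?_)
    rw [mul_assoc (270000000000 * (b : ℝ))]
    gcongr
    rw [← hldef]
    have h1 : 2.4 * Gam2 μ X n ^ 2 / l ^ 2 / √l ≤ 2.4 * (Gam2 μ X n ^ 2 / l ^ 2) := by
      rw [mul_div_assoc]
      exact div_le_self (by positivity) hsq
    have e : (310 * R1 μ X n + 6 * Gam2 μ X n ^ 2 / l) / l =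
        310 * (R1 μ X n / l) + 6 * (Gam2 μ X n ^ 2 / l ^ 2) := by
      field_simp
    rw [e]
    norm_num at *
    linarith
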